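/- Let $n\ge 1$, let $k\in\mathbb R\setminus\{0\}$ and $m\in\frac12\mathbb Z$. Let $R_0=\{\pm e_i\pm e_j : i\neq j\}\cup\{\pm e_i\}\subset\mathbb R^n$ be the root system of type $B_n$, with root labels $k_\alpha=k_1=k$ for $\alpha=\pm e_i\pm e_j$ and $k_\alpha=k_2=mk$ for $\alpha=\pm e_i$, and let $W_0$ be its Weyl group, which acts on $\mathbb R^n$ by permutations and sign changes of the coordinates. A point $c\in\mathbb R^n$ is \emph{residual} if $$|\{\alpha\in R_0:\alpha(c)=k_\alpha\}|=|\{\alpha\in R_0:\alpha(c)=0\}|+n .$$ \textbf{Tableaux.} Draw the Young diagram of a partition $\lambda$ of $n$ with its longest row at the top and its longest column at the left. The content $c(\square)$ of a box $\square$ is its column index minus its row index. Let $c(\lambda,k,mk)\in\mathbb R^n$ be the point with coordinates $c(\square)k+mk$, $\square\in\lambda$ (its $W_0$-orbit does not depend on the order of the boxes). The $m$-tableau $T_m(\lambda)$ is the diagram of $\lambda$ in which each box $\square$ is filled with $|c(\square)+m|$. Put $\mathcal P_m(W_0c)=\{\lambda\vdash n : W_0c(\lambda,k,mk)=W_0c\}$.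 \textbf{Symbols.} Put $s=0$ if $m\in\mathbb Z$ and $s=1$ otherwise. Let $(\xi,\eta)$ be a double partition of $n$ (that is, $|\xi|+|\eta|=n$), parts being written in increasing order and zero parts being allowed. For $m\ge 0$ and $N\ge n$, extend $\xi$ to $N+\lceil m\rceil$ parts and $\eta$ to $N$ parts by zeroes. The entries of the $m$-symbol of $(\xi,\eta)$ (of length $N$) are the numbers $\xi_i+2(i-1)$ and $\eta_j+2(j-1)+s$. For $m<0$, the $m$-symbol of $(\xi,\eta)$ has the entries of the $|m|$-symbol of $(\eta,\xi)$. Write $(\xi,\eta)\sim_m(\xi',\eta')$ if the $m$-symbols of the two double partitions have, for some common length $N\ge n$, the same entries with the same multiplicities. \textbf{Jumps.} For a residual point $c$ let $M_l$ be the number of coordinates of $c$ equal to $\pm lk$. The positive jumps of $c$ are the $l>0$, $l\in m+\mathbb Z$, such that either $l\ge |m|$ and $M_l=M_{l+1}+1$, or $l\le |m|-1$ and $M_l=M_{l+1}$. If their number is not of the form $\lceil |m|\rceil+2r$ with $r\in\mathbb Z_{\ge 0}$, then $0$ (if $m\in\mathbb Z$) or $-\frac12$ (if $m\notin\mathbb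 Z$) is added as a jump. Let $j_1<j_2<\dots<j_{\lceil |m|\rceil+2r}$ be the jumps, and put $\delta=s/2$. For $m\ge 0$ let $\xi(c)$ be the partition with the parts $j_1+\delta,\ j_3+\delta,\dots,\ j_{2r-1}+\delta$ and $j_{2r+1+t}+\delta-t$ for $0\le t<\lceil m\rceil$, and let $\eta(c)$ be the partition with the parts $j_2+1-\delta,\ j_4+1-\delta,\dots,\ j_{2r}+1-\delta$. For $m<0$ use these formulas with $|m|$ in place of $m$ and interchange the two partitions. Let $\Sigma_m(W_0c)$ be the set of all double partitions $(\xi,\eta)$ of $n$ with $(\xi,\eta)\sim_m(\xi(c),\eta(c))$. \textbf{Splitting.} Cut $T_m(\lambda)$ successively into blocks: in each step locate the maximal remaining entry and cut off the horizontal or vertical block that runs from its box to the top left remaining box. A block consisting of one box $\square$ is horizontal if $c(\square)+m>0$ and vertical if $c(\square)+m<0$. The procedure is well-defined on $\lambda$ if in each step the maximal remaining entry occurs in only one box, and no block consists of a single box $\square$ with $c(\square)+m=0$. Then $\mathcal S_m(\lambda)=(\xi,\eta)$, where the parts of $\xi$ (of $\eta$) are the lengths of the horizontal (vertical) blocks.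 \textbf{Joining.} Given $(\xi,\eta)$, place horizontal blocks with the nonzero parts of $\xi$ as lengths and vertical blocks with the nonzero parts of $\eta$ as lengths, one after the other. After $h$ horizontal and $v$ vertical blocks have been placed, the next block starts at the box in row $h+1$ and column $v+1$. A block is said to reach the number $|c(\square)+m|$, where $\square$ is its last box, and in each step the block that reaches the largest number is placed. The procedure is well-defined on $(\xi,\eta)$ if in each step every remaining block of another length or of the other kind would reach a strictly smaller number than the chosen one, and the blocks placed so far form the diagram of a partition. Then $\mathcal J_m(\xi,\eta)$ is the partition whose diagram is obtained at the end. \textbf{Theorem.} Let $c\in\mathbb R^n$ be a residual point. Then $\mathcal S_m$ is well-defined on $\mathcal P_m(W_0c)$, $\mathcal J_m$ is well-defined on $\Sigma_m(W_0c)$, and they are mutually inverse bijections $$\mathcal S_m:\mathcal P_m(W_0c)\longleftrightarrow\Sigma_m(W_0c):\mathcal J_m .$$ -/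

import Mathlib

/-!
Combinatorics of residual points of type `B_n` with root labels `k₁ = k`, `k₂ = m k`, `2 m ∈ ℤ`.

Partitions are Young diagrams; `(i, j) ∈ lam` is the box in row `i` and column `j`, both counted from
`0`, the longest row being row `0` (top) and the longest column being column `0` (left).
A double partition of `n` is a pair `A` of Young diagrams with `A.1.card + A.2.card = n`.
-/

noncomputable section

namespace TypeB

/-! ### Root system, Weyl group, residual points -/

/-- The long roots `± e_i ± e_j`, `i ≠ j`, of the root system of type `B_n`. -/
def longRoots (n : ℕ) : Set (Fin n → ℝ) :=
  {α | ∃ i j : Fin n, i ≠ j ∧ ∃ a b : ℤˣ,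
    α = Pi.single i ((a : ℤ) : ℝ) + Pi.single j ((b : ℤ) : ℝ)}

/-- The short roots `± e_i` of the root system of type `B_n`. -/
def shortRoots (n : ℕ) : Set (Fin n → ℝ) :=
  {α | ∃ i : Fin n, ∃ a : ℤˣ, α = Pi.single i ((a : ℤ) : ℝ)}

/-- `c` is a residual point for the root labels `k₁` (long roots) and `k₂` (short roots):
`#{α | α(c) = k_α} = #{α | α(c) = 0} + n`. -/
def IsResidualPoint {n : ℕ} (k₁ k₂ : ℝ) (c : Fin n → ℝ) : Prop :=
  {α ∈ longRoots n | α ⬝ᵥ c = k₁}.ncard + {α ∈ shortRoots n | α ⬝ᵥ c = k₂}.ncard =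
    {α ∈ longRoots n ∪ shortRoots n | α ⬝ᵥ c = 0}.ncard + n

/-- The orbit of `c` under the Weyl group `W₀` of type `B_n`
(permutations and sign changes of the coordinates). -/
def weylOrbit {n : ℕ} (c : Fin n → ℝ) : Set (Fin n → ℝ) :=
  {d | ∃ (σ : Equiv.Perm (Fin n)) (ε : Fin n → ℤˣ), ∀ i, d i = ((ε i : ℤ) : ℝ) * c (σ i)}

/-! ### Tableaux -/

/-- The content of a box: column index minus row index. -/
def content (b : ℕ × ℕ) : ℤ := (b.2 : ℤ) - (b.1 : ℤ)

/-- The filling of the box `b` in an `m`-tableau. -/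
def entry (m : ℝ) (b : ℕ × ℕ) : ℝ := |(content b : ℝ) + m|

/-- The point `c(lam, k₁, k₂)`, whose coordinates are `content(b) k₁ + k₂` for the boxes `b` of `lam`
(taken in an arbitrary order; only the Weyl group orbit of this point is used). -/
def tableauPoint {n : ℕ} (lam : YoungDiagram) (h : lam.card = n) (k₁ k₂ : ℝ) : Fin n → ℝ :=
  fun i => (content ((lam.cells.equivFinOfCardEq h).symm i : ℕ × ℕ) : ℝ) * k₁ + k₂

/-- `P_m(W₀c)`: the partitions `lam` of `n` with `W₀ c(lam, k, m k) = W₀ c`. -/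
def partitionsOver {n : ℕ} (k m : ℝ) (c : Fin n → ℝ) : Set YoungDiagram :=
  {lam | ∃ h : lam.card = n, weylOrbit (tableauPoint lam h k (m * k)) = weylOrbit c}

/-- The partition whose nonzero parts are the nonzero members of a multiset. -/
def ofParts (s : Multiset ℕ) : YoungDiagram :=
  YoungDiagram.ofRowLens (s.sort (· ≥ ·)) (s.pairwise_sort (· ≥ ·)).sortedGE

/-! ### Symbols and similarity -/

/-- `1` if `m` is not an integer, `0` if it is. -/
def defect (m : ℝ) : ℕ := open Classical in if ∃ z : ℤ, m = z then 0 else 1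

/-- The entries of the row of a symbol which is obtained by adding `(s, s + 2, s + 4, …)` (`L` terms)
to the parts of `p` in increasing order, `p` being extended by zeroes to `L` parts. -/
def symbolRow (p : YoungDiagram) (L s : ℕ) : Multiset ℕ :=
  (Multiset.range L).map fun i => s + 2 * (L - 1 - i) + p.rowLen i

/-- The multiset of entries of the `m`-symbol of `A` whose shorter row has length `N`. The longer
row starts from `(0, 2, 4, …)` and has `⌈|m|⌉` entries more; it belongs to the first partition if
`0 ≤ m` and to the second one if `m < 0`. The shorter row starts from `(s, s + 2, …)` with
`s = 0` for integral `m` and `s = 1` otherwise. -/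
def symbolEntries (m : ℝ) (N : ℕ) (A : YoungDiagram × YoungDiagram) : Multiset ℕ :=
  open Classical in
  if 0 ≤ m then symbolRow A.1 (N + ⌈|m|⌉₊) 0 + symbolRow A.2 N (defect m)
  else symbolRow A.1 N (defect m) + symbolRow A.2 (N + ⌈|m|⌉₊) 0

/-- The relation `A ∼_m B` on double partitions of `n`: their `m`-symbols have representatives with
the same entries, with the same multiplicities. -/
def Similar (n : ℕ) (m : ℝ) (A B : YoungDiagram × YoungDiagram) : Prop :=
  ∃ N : ℕ, n ≤ N ∧ symbolEntries m N A = symbolEntries m N B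

/-! ### Jumps -/

/-- `M_l`: the number of coordinates of `c` that are equal to `l k` up to sign. -/
def mult {n : ℕ} (k : ℝ) (c : Fin n → ℝ) (l : ℝ) : ℕ := {i : Fin n | |c i| = l * |k|}.ncard

/-- The set `J⁺(c)` of positive jumps of `c`. -/
def posJumps {n : ℕ} (k m : ℝ) (c : Fin n → ℝ) : Set ℝ :=
  {l | 0 < l ∧ (∃ z : ℤ, l - m = z) ∧
    ((|m| ≤ l ∧ mult k c l = mult k c (l + 1) + 1) ∨
      (l ≤ |m| - 1 ∧ mult k c l = mult k c (l + 1)))}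

theorem posJumps_finite {n : ℕ} (k m : ℝ) (c : Fin n → ℝ) : (posJumps k m c).Finite := by
  have h1 : (Set.range fun i : Fin n => |c i| / |k|).Finite := Set.finite_range _
  have h2 : ((fun z : ℤ => m + z) '' Set.Icc (-⌈|m|⌉ - ⌈|m|⌉) (⌈|m|⌉ + ⌈|m|⌉)).Finite :=
    (Set.finite_Icc _ _).image _
  refine (h1.union h2).subset ?_
  rintro l ⟨hl, ⟨z, hz⟩, ⟨-, hM⟩ | ⟨hm, -⟩⟩
  · left
    by_cases hk : k = 0
    · subst hk
      simp [mult] at hM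
    · have hne : {i : Fin n | |c i| = l * |k|}.Nonempty := by
        apply Set.nonempty_of_ncard_ne_zero
        change mult k c l ≠ 0
        omega
      obtain ⟨i, hi⟩ := hne
      refine ⟨i, ?_⟩
      have hi' : |c i| = l * |k| := hi
      have : |k| ≠ 0 := abs_ne_zero.mpr hk
      simp only [hi']
      field_simp
  · right
    refine ⟨z, ⟨?_, ?_⟩, by simp only; linarith⟩
    · have := Int.le_ceil |m|
      have := le_abs_self m
      have : ((-⌈|m|⌉ - ⌈|m|⌉ : ℤ) : ℝ) ≤ z := by push_cast; linarith [abs_nonneg m]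
      exact_mod_cast this
    · have := Int.le_ceil |m|
      have := neg_abs_le m
      have : (z : ℝ) ≤ ((⌈|m|⌉ + ⌈|m|⌉ : ℤ) : ℝ) := by push_cast; linarith
      exact_mod_cast this

/-- The set `J(c)` of jumps of `c`: the positive jumps, to which `0` (for integral `m`) or `-1/2`
(otherwise) is added if this is necessary to have `⌈|m|⌉ + 2 r` jumps with `r ∈ ℕ`. -/
def jumps {n : ℕ} (k m : ℝ) (c : Fin n → ℝ) : Finset ℝ :=
  open Classical in
  if ∃ r : ℕ, (posJumps_finite k m c).toFinset.card = ⌈|m|⌉₊ + 2 * r then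
    (posJumps_finite k m c).toFinset
  else insert (-(defect m : ℝ) / 2) (posJumps_finite k m c).toFinset

/-- The jump `j_(i+1)`, where `j_1 < j_2 < …` are the jumps of `c`. -/
def jump {n : ℕ} (k m : ℝ) (c : Fin n → ℝ) (i : ℕ) : ℝ := (jumps k m c).sort.getD i 0

/-- The number `r`, where `⌈|m|⌉ + 2 r` is the number of jumps. -/
def jumpRank {n : ℕ} (k m : ℝ) (c : Fin n → ℝ) : ℕ := ((jumps k m c).card - ⌈|m|⌉₊) / 2

/-- With `δ = 0` for integral `m` and `δ = 1/2` otherwise, the partition with the parts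
`j_1 + δ, j_3 + δ, …, j_(2r-1) + δ` and
`j_(2r+1) + δ, j_(2r+2) + δ - 1, …, j_(2r+⌈|m|⌉) + δ - (⌈|m|⌉ - 1)`.
(For a residual point these numbers are natural numbers, and `⌊ ⌋₊` only changes their type.) -/
def jumpPartition₁ {n : ℕ} (k m : ℝ) (c : Fin n → ℝ) : YoungDiagram :=
  ofParts
    ((Multiset.range (jumpRank k m c)).map (fun i => ⌊jump k m c (2 * i) + (defect m : ℝ) / 2⌋₊) +
      (Multiset.range ⌈|m|⌉₊).map
        (fun t => ⌊jump k m c (2 * jumpRank k m c + t) + (defect m : ℝ) / 2 - t⌋₊))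

/-- With `δ` as before, the partition with the parts `j_2 + 1 - δ, j_4 + 1 - δ, …, j_(2r) + 1 - δ`. -/
def jumpPartition₂ {n : ℕ} (k m : ℝ) (c : Fin n → ℝ) : YoungDiagram :=
  ofParts ((Multiset.range (jumpRank k m c)).map
    fun i => ⌊jump k m c (2 * i + 1) + 1 - (defect m : ℝ) / 2⌋₊)

/-- The double partition `(ξ(c), η(c))`. -/
def jumpBipartition {n : ℕ} (k m : ℝ) (c : Fin n → ℝ) : YoungDiagram × YoungDiagram :=
  open Classical in
  if 0 ≤ m then (jumpPartition₁ k m c, jumpPartition₂ k m c)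
  else (jumpPartition₂ k m c, jumpPartition₁ k m c)

/-- `Σ_m(W₀c)`: the `∼_m`-class of `(ξ(c), η(c))` among the double partitions of `n`. -/
def correspondents {n : ℕ} (k m : ℝ) (c : Fin n → ℝ) : Set (YoungDiagram × YoungDiagram) :=
  {A | A.1.card + A.2.card = n ∧ Similar n m A (jumpBipartition k m c)}

/-! ### Splitting -/

/-- `SplitsFrom m lam h v X Y`: after `h` horizontal and `v` vertical blocks have been cut from the
`m`-tableau of `lam` (they cover the rows `< h` and the columns `< v`), the splitting procedure can be
carried out on the remaining boxes, and it produces horizontal blocks of lengths `X` and vertical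
blocks of lengths `Y`. In each step the maximal remaining entry has to occur in a single box; the
next block runs from that box to the top left remaining box `(h, v)`. A block of one box is horizontal
if `content + m > 0` and vertical if `content + m < 0`. -/
inductive SplitsFrom (m : ℝ) (lam : YoungDiagram) : ℕ → ℕ → Multiset ℕ → Multiset ℕ → Prop
  | done (h v : ℕ) (hd : (h, v) ∉ lam) : SplitsFrom m lam h v 0 0
  | horizontal (h v a : ℕ) (X Y : Multiset ℕ)
      (hmem : (h, v + a) ∈ lam) (hend : (h, v + a + 1) ∉ lam)
      (hmax : ∀ b ∈ lam, h ≤ b.1 → v ≤ b.2 → b ≠ (h, v + a) → entry m b < entry m (h, v + a))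
      (hone : a = 0 → 0 < (content (h, v) : ℝ) + m)
      (hrest : SplitsFrom m lam (h + 1) v X Y) :
      SplitsFrom m lam h v ((a + 1) ::ₘ X) Y
  | vertical (h v a : ℕ) (X Y : Multiset ℕ)
      (hmem : (h + a, v) ∈ lam) (hend : (h + a + 1, v) ∉ lam)
      (hmax : ∀ b ∈ lam, h ≤ b.1 → v ≤ b.2 → b ≠ (h + a, v) → entry m b < entry m (h + a, v))
      (hone : a = 0 → (content (h, v) : ℝ) + m < 0)
      (hrest : SplitsFrom m lam h (v + 1) X Y) :
      SplitsFrom m lam h v X ((a + 1) ::ₘ Y)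

/-- The splitting procedure is well-defined on `lam` and `S_m(lam) = A`. -/
def Splits (m : ℝ) (lam : YoungDiagram) (A : YoungDiagram × YoungDiagram) : Prop :=
  ∃ X Y : Multiset ℕ, SplitsFrom m lam 0 0 X Y ∧ A = (ofParts X, ofParts Y)

/-! ### Joining -/

/-- `JoinsFrom m lam mu h v X Y`: after `h` horizontal and `v` vertical blocks have been placed,
covering the diagram `mu`, the joining procedure can be carried out with the remaining horizontal
blocks of lengths `X` and vertical blocks of lengths `Y`, and it ends with the diagram `lam`. The next
block starts in the box `(h, v)`. In each step the chosen block is the one that reaches (ends on) the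
largest number in the `m`-tableau: any remaining block of another length or of the other kind would
reach a smaller number. After each step the placed blocks form the diagram of a partition. -/
inductive JoinsFrom (m : ℝ) (lam : YoungDiagram) :
    YoungDiagram → ℕ → ℕ → Multiset ℕ → Multiset ℕ → Prop
  | done (h v : ℕ) : JoinsFrom m lam lam h v 0 0
  | horizontal (mu mu' : YoungDiagram) (h v a : ℕ) (X Y : Multiset ℕ)
      (hX : ∀ x ∈ X, x ≠ a → entry m (h, v + x - 1) < entry m (h, v + a - 1))
      (hY : ∀ y ∈ Y, entry m (h + y - 1, v) < entry m (h, v + a - 1))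
      (hplace : mu'.cells = mu.cells ∪ {h} ×ˢ Finset.Ico v (v + a))
      (hrest : JoinsFrom m lam mu' (h + 1) v X Y) :
      JoinsFrom m lam mu h v (a ::ₘ X) Y
  | vertical (mu mu' : YoungDiagram) (h v a : ℕ) (X Y : Multiset ℕ)
      (hX : ∀ x ∈ X, entry m (h, v + x - 1) < entry m (h + a - 1, v))
      (hY : ∀ y ∈ Y, y ≠ a → entry m (h + y - 1, v) < entry m (h + a - 1, v))
      (hplace : mu'.cells = mu.cells ∪ Finset.Ico h (h + a) ×ˢ {v})
      (hrest : JoinsFrom m lam mu' h (v + 1) X Y) :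
      JoinsFrom m lam mu h v X (a ::ₘ Y)

/-- The joining procedure is well-defined on `A` and `J_m(A) = lam`. -/
def Joins (m : ℝ) (A : YoungDiagram × YoungDiagram) (lam : YoungDiagram) : Prop :=
  JoinsFrom m lam ⊥ 0 0 (A.1.rowLens : Multiset ℕ) (A.2.rowLens : Multiset ℕ)

end TypeB

end

noncomputable section

namespace TypeB

/-! ### Partitions given by their parts -/

/-! Write `m = q - s / 2` with `q = ⌈m⌉` and let first `m ≥ 0`; the case `m < 0` follows by
transposing diagrams, which negates contents and exchanges the two kinds of blocks.

Everything is encoded by words. A letter `(true, a)` is a (possibly empty) horizontal block whose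
last box has content plus `m` equal to `a - s / 2`; `(false, a)` is a vertical block for which this
value is `-(a - s / 2)`. Letters decrease along the word. The next block's position depends only on
the excess of the later letters, so letters and kinds determine the block lengths `rowParts` and
`colParts`.

Diagrams: the word of `lam` merges the ends of its first `H` rows and `V` columns, `H - V = q`. It
exists if no row end and column end give the same letter (`exists_hasWord`), and every jump word
comes from a diagram (`exists_diagram_of_jumpWord`). The first letter is the largest remaining
entry, so splitting and joining both read off the word (`HasWord.splitsFrom`, `HasWord.joinsFrom`).

Symbols: the symbol entry of a letter is the letter plus the number of later letters plus a
constant, whatever its kind (`IsJumpWord.symbol_eq`). Hence the double partitions similar to a given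
one are those of the words with the same letters and excess `q` (`exists_jumpWord_of_symbol_eq`).

Points: let `f x` be the number of coordinates of `c` and `-c` equal to `x k`. Counting pairs of
signed coordinates turns residuality into `∑ (f x - f (x + 1))² = 4 f m - 2 f 0 - 2 f (1/2)`, and
telescoping makes this the vanishing of a sum of nonnegative integers
(`IsResidualPoint.signedCount_structure`). So each letter has count `0` or `1`, and the jumps are
the letters of count `1`, up to the letter `0`, which is settled by parity. For a tableau point the
count of a letter is the number of rows and columns ending there (`letterCount_tableauPoint`). Thus
the diagrams over `c` are those whose words have the jumps as letters, and `(ξ(c), η(c))` belongs to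
one such word, the alternating one. Both sides of the bijection are the choices of kinds for the
jumps with excess `q`. -/

theorem lt_countP_iff_of_sortedGE {l : List ℕ} (hl : l.SortedGE) (i j : ℕ) :
    i < l.countP (fun x => decide (j < x)) ↔ ∃ h : i < l.length, j < l[i] := by
  rw [List.sortedGE_iff_pairwise] at hl
  induction l generalizing i with
  | nil => simp
  | cons a l ih =>
    rw [List.pairwise_cons] at hl
    rw [List.countP_cons]
    by_cases hj : j < a
    · cases i with
      | zero => simp [hj]
      | succ i => simpa [hj] using ih hl.2 i
    · have h0 : l.countP (fun x => decide (j < x)) = 0 := by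
        rw [List.countP_eq_zero]
        intro x hx
        have := hl.1 x hx
        simp only [decide_eq_true_eq]
        omega
      simp only [h0, hj, decide_false]
      constructor
      · intro h
        simp at h
      · rintro ⟨h, h'⟩
        cases i with
        | zero => exact absurd h' hj
        | succ i =>
          have := hl.1 (l[i]'(by simpa using h)) (List.getElem_mem _)
          simp only [List.getElem_cons_succ] at h'
          omega

/-- Frees `ofParts` from the sorting in its definition: only the numbers of parts above each bound
matter. -/
theorem mem_ofParts {s : Multiset ℕ} {b : ℕ × ℕ} :
    b ∈ ofParts s ↔ b.1 < s.countP (fun x => b.2 < x) := by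
  have h := lt_countP_iff_of_sortedGE (s.pairwise_sort (· ≥ ·)).sortedGE b.1 b.2
  rw [ofParts, YoungDiagram.mem_ofRowLens, ← h]
  conv_rhs => rw [← s.sort_eq (· ≥ ·)]
  rw [Multiset.coe_countP]

theorem ofParts_filter (s : Multiset ℕ) : ofParts (s.filter (fun x => 0 < x)) = ofParts s := by
  ext b
  rw [YoungDiagram.mem_cells, YoungDiagram.mem_cells, mem_ofParts, mem_ofParts,
    Multiset.countP_filter]
  have : (fun a => b.2 < a ∧ 0 < a) = fun a => b.2 < a := by
    funext a
    exact propext ⟨fun h => h.1, fun h => ⟨h, by omega⟩⟩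
  simp only [this]

theorem rowLen_ofParts_coe {l : List ℕ} (hl : l.SortedGE) (i : ℕ) :
    (ofParts (l : Multiset ℕ)).rowLen i = l.getD i 0 := by
  refine eq_of_forall_lt_iff fun j => ?_
  rw [← YoungDiagram.mem_iff_lt_rowLen, mem_ofParts, Multiset.coe_countP,
    lt_countP_iff_of_sortedGE hl]
  by_cases h : i < l.length
  · simp [h]
  · simp [h]

theorem ofParts_map_rowLen (p : YoungDiagram) {L : ℕ} (hL : p.colLen 0 ≤ L) :
    ofParts (((List.range L).map p.rowLen : List ℕ) : Multiset ℕ) = p := by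
  have hs : ((List.range L).map p.rowLen).SortedGE := by
    rw [List.sortedGE_iff_pairwise, List.pairwise_map]
    exact List.pairwise_lt_range.imp fun h => p.rowLen_anti _ _ h.le
  ext ⟨i, j⟩
  rw [YoungDiagram.mem_cells, YoungDiagram.mem_cells, YoungDiagram.mem_iff_lt_rowLen,
    YoungDiagram.mem_iff_lt_rowLen, rowLen_ofParts_coe hs]
  by_cases h : i < L
  · simp [h]
  · have : p.rowLen i = 0 := by
      by_contra h0
      have h1 : (i, 0) ∈ p := YoungDiagram.mem_iff_lt_rowLen.2 (Nat.pos_of_ne_zero h0)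
      have := YoungDiagram.mem_iff_lt_colLen.1 h1
      omega
    simp [h, this]

theorem rowLens_ofParts {s : Multiset ℕ} (hs : ∀ x ∈ s, 0 < x) :
    ((ofParts s).rowLens : Multiset ℕ) = s := by
  rw [ofParts, YoungDiagram.rowLens_ofRowLens_eq_self, Multiset.sort_eq]
  intro x hx
  exact hs x ((Multiset.mem_sort _).1 hx)

theorem card_cellsOfRowLens (l : List ℕ) : (YoungDiagram.cellsOfRowLens l).card = l.sum := by
  induction l with
  | nil => rfl
  | cons a l ih =>
    rw [YoungDiagram.cellsOfRowLens, Finset.card_union_of_disjoint, Finset.card_map, ih]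
    · simp
    · rw [Finset.disjoint_left]
      rintro ⟨i, j⟩ h h'
      rw [Finset.mem_map] at h'
      obtain ⟨⟨i', j'⟩, -, h'⟩ := h'
      simp only [Finset.singleton_product, Finset.mem_map, Finset.mem_range] at h
      simp [Prod.ext_iff] at h h'
      omega

theorem card_ofParts (s : Multiset ℕ) : (ofParts s).card = s.sum := by
  have : (ofParts s).card = (s.sort (· ≥ ·)).sum := card_cellsOfRowLens _
  rw [this, ← Multiset.sum_coe, Multiset.sort_eq]

theorem colLen_zero_le_card (p : YoungDiagram) : p.colLen 0 ≤ p.card := by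
  rw [YoungDiagram.colLen_eq_card]
  exact Finset.card_le_card (Finset.filter_subset _ _)

/-! ### Rows of symbols as lists -/

/-- The row of a symbol with the parts `l` (in decreasing order), starting from `s`. -/
def symbolList (s : ℕ) : List ℕ → List ℕ
  | [] => []
  | x :: l => (s + 2 * l.length + x) :: symbolList s l

theorem length_symbolList (s : ℕ) (l : List ℕ) : (symbolList s l).length = l.length := by
  induction l with
  | nil => rfl
  | cons a l ih => simp [symbolList, ih]

/-- The offsets depend only on the number of parts. -/
theorem sum_symbolList (s : ℕ) (l : List ℕ) :
    (symbolList s l).sum = (symbolList s (List.replicate l.length 0)).sum + l.sum := by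
  induction l with
  | nil => rfl
  | cons a l ih =>
    simp only [symbolList, List.sum_cons, ih, List.length_cons, List.replicate_succ,
      List.length_replicate]
    omega

theorem le_of_mem_symbolList {s : ℕ} {x : ℕ} {l : List ℕ} (hl : (x :: l).SortedGE) {e : ℕ}
    (he : e ∈ symbolList s (x :: l)) : e ≤ s + 2 * l.length + x := by
  rw [List.sortedGE_iff_pairwise] at hl
  induction l generalizing x with
  | nil =>
    simp only [symbolList, List.mem_cons, List.not_mem_nil, or_false] at he
    omega
  | cons y l ih =>
    rw [symbolList, List.mem_cons] at he
    obtain rfl | he := he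
    · rfl
    · have := ih (List.pairwise_cons.1 hl).2 he
      have := (List.pairwise_cons.1 hl).1 y (by simp)
      simp only [List.length_cons]
      omega

theorem symbolRow_ofParts {l : List ℕ} (hl : l.SortedGE) (s : ℕ) :
    symbolRow (ofParts (l : Multiset ℕ)) l.length s = symbolList s l := by
  have : symbolRow (ofParts (l : Multiset ℕ)) l.length s =
      ((List.range l.length).map fun i => s + 2 * (l.length - 1 - i) + l.getD i 0 : List ℕ) := by
    simp only [symbolRow, rowLen_ofParts_coe hl]
    rfl
  rw [this]
  clear this hl
  congr 1
  induction l with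
  | nil => rfl
  | cons a l ih =>
    rw [symbolList, List.length_cons, List.range_succ_eq_map, List.map_cons, List.map_map, ← ih]
    congr 1
    refine List.map_congr_left fun i _ => ?_
    simp only [Function.comp_apply, List.getD_cons_succ]
    congr 3
    omega

theorem sortedGE_map_rowLen (p : YoungDiagram) (L : ℕ) :
    ((List.range L).map p.rowLen).SortedGE := by
  rw [List.sortedGE_iff_pairwise, List.pairwise_map]
  exact List.pairwise_lt_range.imp fun h => p.rowLen_anti _ _ h.le

theorem symbolRow_eq_symbolList (p : YoungDiagram) {L : ℕ} (hL : p.colLen 0 ≤ L) (s : ℕ) :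
    symbolRow p L s = symbolList s ((List.range L).map p.rowLen) := by
  have h := symbolRow_ofParts (sortedGE_map_rowLen p L) s
  rw [ofParts_map_rowLen p hL] at h
  simpa using h

theorem sortedGE_append_replicate {l : List ℕ} (hl : l.SortedGE) (t : ℕ) :
    (l ++ List.replicate t 0).SortedGE := by
  rw [List.sortedGE_iff_pairwise] at *
  rw [List.pairwise_append]
  refine ⟨hl, ?_, ?_⟩
  · simp [List.pairwise_replicate]
  · intro a _ b hb
    rw [List.eq_of_mem_replicate hb]
    exact Nat.zero_le a

theorem ofParts_append_replicate (l : List ℕ) (t : ℕ) :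
    ofParts ((l ++ List.replicate t 0 : List ℕ) : Multiset ℕ) = ofParts (l : Multiset ℕ) := by
  rw [← ofParts_filter, ← ofParts_filter (l : Multiset ℕ)]
  congr 1
  rw [← Multiset.coe_add, Multiset.filter_add]
  have : Multiset.filter (fun x => 0 < x) ((List.replicate t 0 : List ℕ) : Multiset ℕ) = 0 := by
    rw [Multiset.filter_eq_nil]
    intro a ha
    rw [List.eq_of_mem_replicate (Multiset.mem_coe.1 ha)]
    simp
  rw [this, add_zero]

/-! ### Words of jumps -/

/-- The excess of horizontal over vertical letters of a word. -/
def excess : List (Bool × ℕ) → ℤ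
  | [] => 0
  | (true, _) :: w => excess w + 1
  | (false, _) :: w => excess w - 1

/-- The lengths of the horizontal blocks of a word. -/
def rowParts : List (Bool × ℕ) → List ℕ
  | [] => []
  | (true, a) :: w => (a - excess w).toNat :: rowParts w
  | (false, _) :: w => rowParts w

/-- The lengths of the vertical blocks of a word. -/
def colParts (s : ℕ) : List (Bool × ℕ) → List ℕ
  | [] => []
  | (true, _) :: w => colParts s w
  | (false, a) :: w => (a + excess w - s).toNat :: colParts s w

/-- The letters strictly decrease, and no vertical letter is smaller than `s`. -/
def IsJumpWord (s : ℕ) : List (Bool × ℕ) → Prop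
  | [] => True
  | (true, a) :: w => (∀ x ∈ w, x.2 < a) ∧ IsJumpWord s w
  | (false, a) :: w => s ≤ a ∧ (∀ x ∈ w, x.2 < a) ∧ IsJumpWord s w

/-! ### Counts and bounds for the blocks of a word -/

theorem excess_eq (s : ℕ) (w : List (Bool × ℕ)) :
    excess w = (rowParts w).length - (colParts s w).length := by
  induction w with
  | nil => rfl
  | cons p w ih =>
    obtain ⟨_ | _, a⟩ := p <;> simp only [excess, rowParts, colParts, ih, List.length_cons] <;>
      push_cast <;> ring

theorem length_rowParts_add (s : ℕ) (w : List (Bool × ℕ)) :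
    (rowParts w).length + (colParts s w).length = w.length := by
  induction w with
  | nil => rfl
  | cons p w ih =>
    obtain ⟨_ | _, a⟩ := p <;> simp only [rowParts, colParts, List.length_cons] <;> omega

/-- Letters below `a` are distinct, so there are at most `a` of them, and at most `a - s` vertical
ones. These bounds keep `toNat` in `rowParts` and `colParts` from truncating. -/
theorem IsJumpWord.excess_bounds {s : ℕ} (hs : s ≤ 1) {w : List (Bool × ℕ)} (hw : IsJumpWord s w)
    {a : ℕ} (ha : ∀ x ∈ w, x.2 < a) :
    excess w ≤ a ∧ (s ≤ a → (s : ℤ) ≤ a + excess w) := by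
  induction w generalizing a with
  | nil => simp [excess]
  | cons p w ih =>
    obtain ⟨_ | _, l⟩ := p
    · obtain ⟨h1, h2, h3⟩ := hw
      have hl := ha (false, l) (by simp)
      obtain ⟨i1, i2⟩ := ih h3 h2
      have := i2 h1
      simp only at hl
      simp only [excess]
      omega
    · obtain ⟨h2, h3⟩ := hw
      have hl := ha (true, l) (by simp)
      obtain ⟨i1, i2⟩ := ih h3 h2
      simp only at hl
      simp only [excess]
      by_cases hsl : s ≤ l
      · have := i2 hsl
        omega
      -- Here `s = 1`, and the letter `0` can only be the last one.
      · have hl0 : l = 0 := by omega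
        subst hl0
        have : w = [] := by
          cases w with
          | nil => rfl
          | cons p w => exact absurd (h2 p (by simp)) (by omega)
        subst this
        simp only [excess]
        omega

/-- The horizontal parts of a word whose letters are smaller than `a`. -/
theorem IsJumpWord.rowParts_bounds {s : ℕ} (hs : s ≤ 1) {w : List (Bool × ℕ)}
    (hw : IsJumpWord s w) {a : ℕ} (ha : ∀ x ∈ w, x.2 < a) {x : ℕ} (hx : x ∈ rowParts w) :
    x + excess w ≤ a ∧ (0 < x → s - a + 2 < x + excess w) := by
  -- If the preceding letter `a` is horizontal, a row of length `x` put in its place would reach the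
  -- shifted content `x + excess w`; if it is vertical, two less. The bounds serve both cases.
  induction w generalizing a with
  | nil => simp [rowParts] at hx
  | cons p w ih =>
    obtain ⟨_ | _, l⟩ := p
    · obtain ⟨h1, h2, h3⟩ := hw
      have hl := ha (false, l) (by simp)
      simp only at hl
      obtain ⟨i1, i2⟩ := ih h3 h2 hx
      simp only [excess]
      omega
    · obtain ⟨h2, h3⟩ := hw
      have hl := ha (true, l) (by simp)
      simp only at hl
      rw [rowParts, List.mem_cons] at hx
      simp only [excess]
      obtain rfl | hx := hx
      · have hb := h3.excess_bounds hs h2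
        refine ⟨by omega, fun hpos => ?_⟩
        -- A letter `0` is the last one and has an empty block; any other letter satisfies `s < 2 *
        -- l`.
        by_cases hl0 : l = 0
        · subst hl0
          have : w = [] := by
            cases w with
            | nil => rfl
            | cons p w => exact absurd (h2 p (by simp)) (by omega)
          subst this
          simp [excess] at hpos
        · omega
      · obtain ⟨i1, i2⟩ := ih h3 h2 hx
        omega

/-- The vertical parts of a word whose letters are smaller than `a`. -/
theorem IsJumpWord.colParts_bounds {s : ℕ} (hs : s ≤ 1) {w : List (Bool × ℕ)}
    (hw : IsJumpWord s w) {a : ℕ} (ha : ∀ x ∈ w, x.2 < a) (hsa : s ≤ a) {y : ℕ}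
    (hy : y ∈ colParts s w) :
    s - a ≤ excess w - y ∧ (0 < y → excess w - y + 2 < a) := by
  -- Mirror image: a column of length `y` would reach `excess w - y` in place of a vertical letter
  -- `a`, and two more in place of a horizontal one.
  induction w generalizing a with
  | nil => simp [colParts] at hy
  | cons p w ih =>
    obtain ⟨_ | _, l⟩ := p
    · obtain ⟨h1, h2, h3⟩ := hw
      have hl := ha (false, l) (by simp)
      simp only at hl
      rw [colParts, List.mem_cons] at hy
      simp only [excess]
      obtain rfl | hy := hy
      · have hb := h3.excess_bounds hs h2
        have := hb.2 h1
        refine ⟨by omega, fun hpos => ?_⟩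
        by_cases hl0 : l = 0
        · subst hl0
          have : w = [] := by
            cases w with
            | nil => rfl
            | cons p w => exact absurd (h2 p (by simp)) (by omega)
          subst this
          simp [excess] at hpos
        · omega
      · obtain ⟨i1, i2⟩ := ih h3 h2 h1 hy
        omega
    · obtain ⟨h2, h3⟩ := hw
      have hl := ha (true, l) (by simp)
      simp only at hl
      by_cases hsl : s ≤ l
      · obtain ⟨i1, i2⟩ := ih h3 h2 hsl hy
        simp only [excess]
        omega
      · have : w = [] := by
          cases w with
          | nil => rfl
          | cons p w => exact absurd (h2 p (by simp)) (by omega)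
        subst this
        simp [colParts] at hy

theorem IsJumpWord.sortedGE_rowParts {s : ℕ} (hs : s ≤ 1) {w : List (Bool × ℕ)}
    (hw : IsJumpWord s w) : (rowParts w).SortedGE := by
  rw [List.sortedGE_iff_pairwise]
  induction w with
  | nil => exact List.Pairwise.nil
  | cons p w ih =>
    obtain ⟨_ | _, l⟩ := p
    · exact ih hw.2.2
    · refine List.pairwise_cons.2 ⟨fun x hx => ?_, ih hw.2⟩
      have := (hw.2.rowParts_bounds hs hw.1 hx).1
      omega

theorem IsJumpWord.sortedGE_colParts {s : ℕ} (hs : s ≤ 1) {w : List (Bool × ℕ)}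
    (hw : IsJumpWord s w) : (colParts s w).SortedGE := by
  rw [List.sortedGE_iff_pairwise]
  induction w with
  | nil => exact List.Pairwise.nil
  | cons p w ih =>
    obtain ⟨_ | _, l⟩ := p
    · refine List.pairwise_cons.2 ⟨fun x hx => ?_, ih hw.2.2⟩
      have := (hw.2.2.colParts_bounds hs hw.2.1 hw.1 hx).1
      omega
    · exact ih hw.2

/-! ### The symbol of a word -/

/-- The part of the symbol of a word which comes from its letters. -/
def letterEntries (t : ℕ) : List ℕ → List ℕ
  | [] => []
  | a :: l => (a + l.length + 2 * t) :: letterEntries t l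

/-- The symbol of a pair of partitions without nonzero parts. -/
def zeroSymbol (s t : ℕ) : Multiset ℕ :=
  (symbolList 0 (List.replicate t 0) : Multiset ℕ) + symbolList s (List.replicate t 0)

/-- If `R` horizontal and `C` vertical letters follow a horizontal `a`, its entry is `2 (R + t) + a
- (R - C) = a + (R + C) + 2 t`; for a vertical `a`, `s + 2 (C + t) + a + (R - C) - s` is the same
number. So the kinds are invisible in the symbol. -/
theorem IsJumpWord.symbol_eq {s : ℕ} (hs : s ≤ 1) {w : List (Bool × ℕ)} (hw : IsJumpWord s w)
    (t : ℕ) :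
    (symbolList 0 (rowParts w ++ List.replicate t 0) : Multiset ℕ) +
        symbolList s (colParts s w ++ List.replicate t 0) =
      letterEntries t (w.map Prod.snd) + zeroSymbol s t := by
  induction w with
  | nil => simp [rowParts, colParts, letterEntries, zeroSymbol]
  | cons p w ih =>
    have hlen := length_rowParts_add s w
    have hex := excess_eq s w
    obtain ⟨_ | _, l⟩ := p
    · obtain ⟨h1, h2, h3⟩ := hw
      have := (h3.excess_bounds hs h2).2 h1
      simp only [rowParts, colParts, letterEntries, List.cons_append, symbolList, List.map_cons,
        List.length_map, List.length_append, List.length_replicate]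
      rw [← Multiset.cons_coe, ← Multiset.cons_coe, Multiset.add_cons, Multiset.cons_add, ih h3]
      congr 1
      omega
    · obtain ⟨h2, h3⟩ := hw
      have := (h3.excess_bounds hs h2).1
      simp only [rowParts, colParts, letterEntries, List.cons_append, symbolList, List.map_cons,
        List.length_map, List.length_append, List.length_replicate]
      rw [← Multiset.cons_coe, ← Multiset.cons_coe, Multiset.cons_add, Multiset.cons_add, ih h3]
      congr 1
      omega

theorem le_of_mem_letterEntries {t a : ℕ} {l : List ℕ} (hl : (a :: l).SortedGT) {e : ℕ}
    (he : e ∈ letterEntries t l) : e ≤ a + l.length + 2 * t := by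
  rw [List.sortedGT_iff_pairwise] at hl
  induction l generalizing a with
  | nil => simp [letterEntries] at he
  | cons b l ih =>
    rw [letterEntries, List.mem_cons] at he
    have := (List.pairwise_cons.1 hl).1 b (by simp)
    simp only [List.length_cons]
    obtain rfl | he := he
    · omega
    · have := ih (List.pairwise_cons.1 hl).2 he
      omega

theorem lt_of_mem_zeroSymbol {s t e : ℕ} (hs : s ≤ 1) (he : e ∈ zeroSymbol s t) : e < 2 * t := by
  have key : ∀ s' ≤ 1, e ∈ symbolList s' (List.replicate t 0) → e < 2 * t := by
    intro s' hs' h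
    cases t with
    | zero => simp [symbolList] at h
    | succ t =>
      rw [List.replicate_succ] at h
      have hsort : (0 :: List.replicate t 0 : List ℕ).SortedGE := by
        simpa using sortedGE_append_replicate (l := [0]) (by simp [List.sortedGE_iff_pairwise]) t
      have := le_of_mem_symbolList hsort h
      simp only [List.length_replicate] at this
      omega
  rw [zeroSymbol, Multiset.mem_add] at he
  obtain he | he := he
  · exact key 0 (by omega) (by simpa using he)
  · exact key s hs (by simpa using he)

theorem card_zeroSymbol (s t : ℕ) : (zeroSymbol s t).card = 2 * t := by
  simp [zeroSymbol, length_symbolList]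
  omega

/-- A symbol with the same entries as the zero symbol is the zero symbol. -/
theorem eq_replicate_of_symbol_eq_zeroSymbol {s t : ℕ} (hs : s ≤ 1) {xs ys : List ℕ}
    (h : (symbolList 0 xs : Multiset ℕ) + symbolList s ys = zeroSymbol s t) :
    xs = List.replicate t 0 ∧ ys = List.replicate t 0 := by
  have hcard := congrArg Multiset.card h
  rw [card_zeroSymbol] at hcard
  simp only [Multiset.card_add, Multiset.coe_card, length_symbolList] at hcard
  -- The entries of the zero symbol are below `2 * t`, so neither row is longer than `t`. The total
  -- `2 * t` forces equality, and then the sums leave no room for nonzero parts.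
  have hx : xs.length ≤ t := by
    cases xs with
    | nil => simp
    | cons x xs =>
      have : 0 + 2 * xs.length + x < 2 * t := by
        refine lt_of_mem_zeroSymbol hs ?_
        rw [← h, Multiset.mem_add]
        left
        simp [symbolList]
      simp only [List.length_cons]
      omega
  have hy : ys.length ≤ t := by
    cases ys with
    | nil => simp
    | cons y ys =>
      have : s + 2 * ys.length + y < 2 * t := by
        refine lt_of_mem_zeroSymbol hs ?_
        rw [← h, Multiset.mem_add]
        right
        simp [symbolList]
      simp only [List.length_cons]
      omega
  have hx' : xs.length = t := by omega
  have hy' : ys.length = t := by omega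
  have hsum := congrArg Multiset.sum h
  rw [zeroSymbol] at hsum
  simp only [Multiset.sum_add, Multiset.sum_coe] at hsum
  rw [sum_symbolList 0 xs, sum_symbolList s ys, hx', hy'] at hsum
  have h1 : xs.sum = 0 := by omega
  have h2 : ys.sum = 0 := by omega
  rw [List.sum_eq_zero_iff] at h1 h2
  exact ⟨List.eq_replicate_iff.2 ⟨hx', h1⟩, List.eq_replicate_iff.2 ⟨hy', h2⟩⟩

theorem exists_jumpWord_of_symbol_eq {s t : ℕ} (hs : s ≤ 1) {vs : List ℕ} (hv : vs.SortedGT)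
    {xs ys : List ℕ} (hx : xs.SortedGE) (hy : ys.SortedGE)
    (h : (symbolList 0 xs : Multiset ℕ) + symbolList s ys = letterEntries t vs + zeroSymbol s t) :
    ∃ w, IsJumpWord s w ∧ w.map Prod.snd = vs ∧ xs = rowParts w ++ List.replicate t 0 ∧
      ys = colParts s w ++ List.replicate t 0 := by
  induction vs generalizing xs ys with
  | nil =>
    obtain ⟨h1, h2⟩ := eq_replicate_of_symbol_eq_zeroSymbol hs (by simpa [letterEntries] using h)
    exact ⟨[], trivial, rfl, by simpa [rowParts] using h1, by simpa [colParts] using h2⟩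
  | cons a vs ih =>
    have hv' : vs.SortedGT := by
      rw [List.sortedGT_iff_pairwise] at hv ⊢
      exact (List.pairwise_cons.1 hv).2
    have hav : ∀ b ∈ vs, b < a := by
      rw [List.sortedGT_iff_pairwise] at hv
      exact (List.pairwise_cons.1 hv).1
    -- The largest entry. It must be the head of one of the two rows, and which one it is decides
    -- the kind of the letter `a`.
    set e := a + vs.length + 2 * t with he
    have hmax : ∀ b ∈ (letterEntries t (a :: vs) : Multiset ℕ) + zeroSymbol s t, b ≤ e := by
      intro b hb
      rw [Multiset.mem_add, Multiset.mem_coe, letterEntries, List.mem_cons] at hb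
      obtain (rfl | hb) | hb := hb
      · rfl
      · exact le_of_mem_letterEntries hv hb
      · have := lt_of_mem_zeroSymbol hs hb
        omega
    have hmem : e ∈ (symbolList 0 xs : Multiset ℕ) + symbolList s ys := by
      rw [h]
      simp [letterEntries, he]
    rw [← h] at hmax
    have hword : ∀ w : List (Bool × ℕ), w.map Prod.snd = vs → ∀ x ∈ w, x.2 < a := by
      rintro w rfl x hx
      exact hav _ (List.mem_map_of_mem hx)
    rw [Multiset.mem_add, Multiset.mem_coe, Multiset.mem_coe] at hmem
    obtain hmem | hmem := hmem
    · cases xs with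
      | nil => simp [symbolList] at hmem
      | cons x xs =>
        have h1 := le_of_mem_symbolList hx hmem
        have h2 : 0 + 2 * xs.length + x ≤ e := hmax _ (by simp [symbolList])
        have h3 : 0 + 2 * xs.length + x = e := by omega
        have hx' : xs.SortedGE := by
          rw [List.sortedGE_iff_pairwise] at hx ⊢
          exact (List.pairwise_cons.1 hx).2
        have h4 : (symbolList 0 xs : Multiset ℕ) + symbolList s ys =
            letterEntries t vs + zeroSymbol s t := by
          rw [symbolList, letterEntries, h3, ← he, ← Multiset.cons_coe, ← Multiset.cons_coe,
            Multiset.cons_add, Multiset.cons_add] at h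
          exact (Multiset.cons_inj_right e).1 h
        obtain ⟨w, hw, hwv, rfl, rfl⟩ := ih hv' hx' hy h4
        refine ⟨(true, a) :: w, ⟨hword w hwv, hw⟩, by simp [hwv], ?_, rfl⟩
        rw [rowParts, List.cons_append]
        congr 1
        have hlen := length_rowParts_add s w
        have hex := excess_eq s w
        rw [← hwv, List.length_map] at he
        simp only [List.length_append, List.length_replicate] at h3
        omega
    · cases ys with
      | nil => simp [symbolList] at hmem
      | cons y ys =>
        have h1 := le_of_mem_symbolList hy hmem
        have h2 : s + 2 * ys.length + y ≤ e := hmax _ (by simp [symbolList])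
        have h3 : s + 2 * ys.length + y = e := by omega
        have hy' : ys.SortedGE := by
          rw [List.sortedGE_iff_pairwise] at hy ⊢
          exact (List.pairwise_cons.1 hy).2
        have h4 : (symbolList 0 xs : Multiset ℕ) + symbolList s ys =
            letterEntries t vs + zeroSymbol s t := by
          rw [symbolList, letterEntries, h3, ← he, ← Multiset.cons_coe, ← Multiset.cons_coe,
            Multiset.add_cons, Multiset.cons_add] at h
          exact (Multiset.cons_inj_right e).1 h
        obtain ⟨w, hw, hwv, rfl, rfl⟩ := ih hv' hx hy' h4
        have hlen := length_rowParts_add s w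
        have hex := excess_eq s w
        rw [← hwv, List.length_map] at he
        simp only [List.length_append, List.length_replicate] at h3
        -- Otherwise `a = 0` is the last letter and `e = 2 * t`, less than the head `s + 2 * t + y`
        -- of the second row.
        have hsa : s ≤ a := by
          by_contra hsa
          have : w = [] := by
            cases w with
            | nil => rfl
            | cons p w => exact absurd (hword _ hwv p (by simp)) (by omega)
          subst this
          simp only [colParts, List.length_nil] at h3 he
          omega
        refine ⟨(false, a) :: w, ⟨hsa, hword w hwv, hw⟩, by simp [hwv], rfl, ?_⟩
        rw [colParts, List.cons_append]
        congr 1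
        omega

section Words

/-! ### Words of Young diagrams -/

/-- Doubled entries are integers, so comparisons of entries become integer arithmetic. -/
theorem entry_eq {m : ℝ} {q : ℤ} {s : ℕ} (hm : m = q - (s : ℝ) / 2) (b : ℕ × ℕ) :
    entry m b = ((|2 * ((b.2 : ℤ) - b.1 + q) - s| : ℤ) : ℝ) / 2 := by
  have : ((content b : ℝ) + m) = ((2 * ((b.2 : ℤ) - b.1 + q) - s : ℤ) : ℝ) / 2 := by
    rw [hm, content]
    push_cast
    ring
  rw [entry, this, abs_div, Int.cast_abs, abs_of_pos (by norm_num : (0 : ℝ) < 2)]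

theorem entry_lt_entry {m : ℝ} {q : ℤ} {s : ℕ} (hm : m = q - (s : ℝ) / 2) {b b' : ℕ × ℕ}
    (h : |2 * ((b.2 : ℤ) - b.1 + q) - s| < |2 * ((b'.2 : ℤ) - b'.1 + q) - s|) :
    entry m b < entry m b' := by
  rw [entry_eq hm, entry_eq hm]
  have : ((|2 * ((b.2 : ℤ) - b.1 + q) - s| : ℤ) : ℝ) <
    ((|2 * ((b'.2 : ℤ) - b'.1 + q) - s| : ℤ) : ℝ) := Int.cast_lt.2 h
  linarith

/-- The shifted contents of the last boxes of the rows from `h` on and of the columns from `v` on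
are, up to the first ones which are too small, the letters of `w`. -/
def HasWord (lam : YoungDiagram) (q : ℤ) (s : ℕ) : ℕ → ℕ → List (Bool × ℕ) → Prop
  | h, v, [] => (h : ℤ) - v = q ∧ (h, v) ∉ lam
  | h, v, (true, a) :: w => (lam.rowLen h : ℤ) - 1 - h + q = a ∧ HasWord lam q s (h + 1) v w
  | h, v, (false, a) :: w => (lam.colLen v : ℤ) - 1 - v - q + s = a ∧ HasWord lam q s h (v + 1) w

variable {lam : YoungDiagram} {q : ℤ} {s : ℕ} {h v : ℕ} {w : List (Bool × ℕ)}

/-- Each letter moves the corner by one row or one column, and the last corner has `h - v = q`. This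
locates the current corner from the letters still to come. -/
theorem HasWord.excess_eq (hw : HasWord lam q s h v w) : excess w = q - h + v := by
  induction w generalizing h v with
  | nil => simp only [excess]; linarith [hw.1]
  | cons p w ih =>
    obtain ⟨_ | _, a⟩ := p <;> simp only [excess, ih hw.2] <;> push_cast <;> ring

theorem rowLen_le_of_notMem (hn : (h, v) ∉ lam) : lam.rowLen h ≤ v := by
  rw [YoungDiagram.mem_iff_lt_rowLen] at hn
  omega

theorem colLen_le_of_notMem (hn : (h, v) ∉ lam) : lam.colLen v ≤ h := by
  rw [YoungDiagram.mem_iff_lt_colLen] at hn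
  omega

/-- The end of row `h` is the next horizontal letter of `w`. If there is none, the final corner lies
in row `h` outside of `lam` and makes this end negative. -/
theorem HasWord.row_lt (hw : HasWord lam q s h v w) {a : ℕ} (ha : ∀ x ∈ w, x.2 < a) :
    (lam.rowLen h : ℤ) - 1 - h + q < a := by
  induction w generalizing h v with
  | nil =>
    have := rowLen_le_of_notMem hw.2
    have := hw.1
    omega
  | cons p w ih =>
    obtain ⟨_ | _, l⟩ := p
    · exact ih hw.2 fun x hx => ha x (by simp [hx])
    · have := hw.1
      have := ha (true, l) (by simp)
      simp only at this
      omega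

/-- As for rows, but the final corner only puts the column end below `s`; hence the condition `s ≤
a`. -/
theorem HasWord.col_lt (hw : HasWord lam q s h v w) {a : ℕ} (ha : ∀ x ∈ w, x.2 < a)
    (hsa : s ≤ a) : (lam.colLen v : ℤ) - 1 - v - q + s < a := by
  induction w generalizing h v with
  | nil =>
    have := colLen_le_of_notMem hw.2
    have := hw.1
    omega
  | cons p w ih =>
    obtain ⟨_ | _, l⟩ := p
    · have := hw.1
      have := ha (false, l) (by simp)
      simp only at this
      omega
    · exact ih hw.2 fun x hx => ha x (by simp [hx])

/-- When the boxes are used up the word may go on: its remaining letters are empty blocks, that is,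
zero parts. -/
theorem HasWord.rowParts_eq_zero (hw : HasWord lam q s h v w) (hn : (h, v) ∉ lam) {x : ℕ}
    (hx : x ∈ rowParts w) : x = 0 := by
  induction w generalizing h v with
  | nil => simp [rowParts] at hx
  | cons p w ih =>
    obtain ⟨_ | _, l⟩ := p
    · exact ih hw.2 (fun h' => hn (lam.up_left_mem le_rfl (Nat.le_succ v) h')) hx
    · rw [rowParts, List.mem_cons] at hx
      obtain rfl | hx := hx
      · have h1 := hw.1
        have h2 := hw.2.excess_eq
        have := rowLen_le_of_notMem hn
        push_cast at h2
        omega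
      · exact ih hw.2 (fun h' => hn (lam.up_left_mem (Nat.le_succ h) le_rfl h')) hx

theorem HasWord.colParts_eq_zero (hw : HasWord lam q s h v w) (hn : (h, v) ∉ lam) {y : ℕ}
    (hy : y ∈ colParts s w) : y = 0 := by
  induction w generalizing h v with
  | nil => simp [colParts] at hy
  | cons p w ih =>
    obtain ⟨_ | _, l⟩ := p
    · rw [colParts, List.mem_cons] at hy
      obtain rfl | hy := hy
      · have h1 := hw.1
        have h2 := hw.2.excess_eq
        have := colLen_le_of_notMem hn
        push_cast at h2
        omega
      · exact ih hw.2 (fun h' => hn (lam.up_left_mem le_rfl (Nat.le_succ v) h')) hy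
    · exact ih hw.2 (fun h' => hn (lam.up_left_mem (Nat.le_succ h) le_rfl h')) hy

/-- The nonzero members of a list of numbers, as a multiset. -/
def posParts (l : List ℕ) : Multiset ℕ := (l : Multiset ℕ).filter (fun x => 0 < x)

theorem posParts_cons_of_pos {a : ℕ} (ha : 0 < a) (l : List ℕ) :
    posParts (a :: l) = a ::ₘ posParts l := by
  rw [posParts, ← Multiset.cons_coe, Multiset.filter_cons_of_pos _ ha, posParts]

theorem posParts_eq_zero {l : List ℕ} (hl : ∀ x ∈ l, x = 0) : posParts l = 0 := by
  rw [posParts, Multiset.filter_eq_nil]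
  intro a ha
  simp [hl a (Multiset.mem_coe.1 ha)]

theorem mem_posParts {l : List ℕ} {x : ℕ} : x ∈ posParts l ↔ x ∈ l ∧ 0 < x := by
  simp [posParts]

/-- A remaining box lies weakly before the end of row `h` and of column `v`, so its content is
between those of the two ends. By `row_lt` or `col_lt` the end given by the first letter has the
larger absolute value, and no other box attains it. -/
theorem HasWord.splitsFrom {m : ℝ} (hm : m = q - (s : ℝ) / 2) (hs : s ≤ 1)
    (hw : HasWord lam q s h v w) (hj : IsJumpWord s w) :
    SplitsFrom m lam h v (posParts (rowParts w)) (posParts (colParts s w)) := by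
  induction w generalizing h v with
  | nil =>
    rw [posParts_eq_zero (by simp [rowParts]), posParts_eq_zero (by simp [colParts])]
    exact .done h v hw.2
  | cons p w ih =>
    by_cases hn : (h, v) ∈ lam
    swap
    · rw [posParts_eq_zero fun x hx => hw.rowParts_eq_zero hn hx,
        posParts_eq_zero fun x hx => hw.colParts_eq_zero hn hx]
      exact .done h v hn
    have hrow := YoungDiagram.mem_iff_lt_rowLen.1 hn
    have hcol := YoungDiagram.mem_iff_lt_colLen.1 hn
    have hbox : ∀ b ∈ lam, h ≤ b.1 → v ≤ b.2 →
        (b.2 : ℤ) < lam.rowLen h ∧ (b.1 : ℤ) < lam.colLen v := by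
      rintro ⟨i, j⟩ hb hi hj
      have h1 := YoungDiagram.mem_iff_lt_rowLen.1 (lam.up_left_mem hi le_rfl hb)
      have h2 := YoungDiagram.mem_iff_lt_colLen.1 (lam.up_left_mem le_rfl hj hb)
      simp only
      omega
    obtain ⟨_ | _, l⟩ := p
    · obtain ⟨h1, h2⟩ := hw
      obtain ⟨hj0, hj1, hj2⟩ := hj
      have hex := h2.excess_eq
      push_cast at hex
      have hlt := h2.row_lt hj1
      -- The block reaches `l - s / 2 > 0`. This resolves the absolute value and gives the kind of a
      -- block of one box.
      have hl1 : s < 2 * l := by omega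
      obtain ⟨a, ha⟩ : ∃ a, lam.colLen v = h + a + 1 := ⟨lam.colLen v - h - 1, by omega⟩
      have hpart : ((l : ℤ) + excess w - s).toNat = a + 1 := by omega
      rw [rowParts, colParts, hpart, posParts_cons_of_pos (Nat.succ_pos a)]
      refine .vertical h v a _ _ ?_ ?_ ?_ ?_ (ih h2 hj2)
      · rw [YoungDiagram.mem_iff_lt_colLen]
        omega
      · rw [YoungDiagram.mem_iff_lt_colLen]
        omega
      · rintro ⟨i, j⟩ hb hi hjv hne
        have hb' := hbox _ hb hi hjv
        simp only [ne_eq, Prod.mk.injEq] at hne hi hjv hb'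
        apply entry_lt_entry hm
        simp only
        rw [abs_lt, abs_of_nonpos (by omega)]
        omega
      · rintro rfl
        rw [hm, content]
        have : (2 * ((v : ℤ) - h + q) - s : ℤ) < 0 := by omega
        have : ((2 * ((v : ℤ) - h + q) - s : ℤ) : ℝ) < 0 := by exact_mod_cast this
        push_cast at this ⊢
        linarith
    · obtain ⟨h1, h2⟩ := hw
      obtain ⟨hj1, hj2⟩ := hj
      have hex := h2.excess_eq
      push_cast at hex
      have hlt : (lam.colLen v : ℤ) - 1 - v - q + s < l := by
        by_cases hsl : s ≤ l
        · exact h2.col_lt hj1 hsl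
        · have : w = [] := by
            cases w with
            | nil => rfl
            | cons p w => exact absurd (hj1 p (by simp)) (by omega)
          -- A letter `0` just before the final corner gives row `h` the length `v`, which
          -- contradicts `hn`.
          subst this
          have h3 := colLen_le_of_notMem h2.2
          have h4 := h2.1
          push_cast at h4
          omega
      have hl1 : s < 2 * l := by omega
      obtain ⟨a, ha⟩ : ∃ a, lam.rowLen h = v + a + 1 := ⟨lam.rowLen h - v - 1, by omega⟩
      have hpart : ((l : ℤ) - excess w).toNat = a + 1 := by omega
      rw [rowParts, colParts, hpart, posParts_cons_of_pos (Nat.succ_pos a)]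
      refine .horizontal h v a _ _ ?_ ?_ ?_ ?_ (ih h2 hj2)
      · rw [YoungDiagram.mem_iff_lt_rowLen]
        omega
      · rw [YoungDiagram.mem_iff_lt_rowLen]
        omega
      · rintro ⟨i, j⟩ hb hi hjv hne
        have hb' := hbox _ hb hi hjv
        simp only [ne_eq, Prod.mk.injEq] at hne hi hjv hb'
        apply entry_lt_entry hm
        simp only
        rw [abs_lt, abs_of_nonneg (by omega)]
        omega
      · rintro rfl
        rw [hm, content]
        have : (0 : ℤ) < (2 * ((v : ℤ) - h + q) - s : ℤ) := by omega
        have : (0 : ℝ) < ((2 * ((v : ℤ) - h + q) - s : ℤ) : ℝ) := by exact_mod_cast this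
        push_cast at this ⊢
        linarith

/-- These are the intermediate diagrams of the joining procedure, the boxes covered by `h` rows and
`v` columns; moving up or left preserves the condition. -/
theorem exists_mem_iff_covered (lam : YoungDiagram) (h v : ℕ) :
    ∃ mu : YoungDiagram, ∀ b, b ∈ mu ↔ b ∈ lam ∧ (b.1 < h ∨ b.2 < v) := by
  have hlow : IsLowerSet
      ((lam.cells.filter fun b => b.1 < h ∨ b.2 < v : Finset (ℕ × ℕ)) : Set (ℕ × ℕ)) := by
    rintro ⟨i, j⟩ ⟨i', j'⟩ hij hb
    have h1 : i' ≤ i := hij.1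
    have h2 : j' ≤ j := hij.2
    rw [Finset.mem_coe, Finset.mem_filter, YoungDiagram.mem_cells] at hb ⊢
    exact ⟨lam.up_left_mem h1 h2 hb.1, by simp only at hb ⊢; omega⟩
  refine ⟨⟨_, hlow⟩, fun b => ?_⟩
  rw [YoungDiagram.mem_mk, Finset.mem_filter, YoungDiagram.mem_cells]

theorem eq_of_mem_iff_covered {mu : YoungDiagram}
    (hmu : ∀ b, b ∈ mu ↔ b ∈ lam ∧ (b.1 < h ∨ b.2 < v)) (hn : (h, v) ∉ lam) : mu = lam := by
  ext ⟨i, j⟩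
  rw [YoungDiagram.mem_cells, YoungDiagram.mem_cells, hmu]
  refine ⟨fun hb => hb.1, fun hb => ⟨hb, ?_⟩⟩
  by_contra hcon
  rw [not_or, not_lt, not_lt] at hcon
  exact hn (lam.up_left_mem hcon.1 hcon.2 hb)

/-- Together with `excess_eq`, the bounds on `rowParts` and `colParts` say that every other
remaining block would reach less than the first letter. Their second halves need nonzero parts,
which `posParts` supplies. -/
theorem HasWord.joinsFrom {m : ℝ} (hm : m = q - (s : ℝ) / 2) (hs : s ≤ 1)
    (hw : HasWord lam q s h v w) (hj : IsJumpWord s w) {mu : YoungDiagram}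
    (hmu : ∀ b, b ∈ mu ↔ b ∈ lam ∧ (b.1 < h ∨ b.2 < v)) :
    JoinsFrom m lam mu h v (posParts (rowParts w)) (posParts (colParts s w)) := by
  induction w generalizing h v mu with
  | nil =>
    rw [posParts_eq_zero (by simp [rowParts]), posParts_eq_zero (by simp [colParts]),
      eq_of_mem_iff_covered hmu hw.2]
    exact .done h v
  | cons p w ih =>
    by_cases hn : (h, v) ∈ lam
    swap
    · rw [posParts_eq_zero fun x hx => hw.rowParts_eq_zero hn hx,
        posParts_eq_zero fun x hx => hw.colParts_eq_zero hn hx,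
        eq_of_mem_iff_covered hmu hn]
      exact .done h v
    have hrow := YoungDiagram.mem_iff_lt_rowLen.1 hn
    have hcol := YoungDiagram.mem_iff_lt_colLen.1 hn
    obtain ⟨_ | _, l⟩ := p
    · obtain ⟨h1, h2⟩ := hw
      obtain ⟨hj0, hj1, hj2⟩ := hj
      have hex := h2.excess_eq
      push_cast at hex
      have hlt := h2.row_lt hj1
      have hl1 : s < 2 * l := by omega
      obtain ⟨a, ha⟩ : ∃ a, lam.colLen v = h + a + 1 := ⟨lam.colLen v - h - 1, by omega⟩
      have hpart : ((l : ℤ) + excess w - s).toNat = a + 1 := by omega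
      rw [rowParts, colParts, hpart, posParts_cons_of_pos (Nat.succ_pos a)]
      obtain ⟨mu', hmu'⟩ := exists_mem_iff_covered lam h (v + 1)
      refine .vertical mu mu' h v (a + 1) _ _ ?_ ?_ ?_ (ih h2 hj2 hmu')
      · intro x hx
        obtain ⟨hx, hpos⟩ := mem_posParts.1 hx
        obtain ⟨b1, b2⟩ := hj2.rowParts_bounds hs hj1 hx
        have b3 := b2 hpos
        apply entry_lt_entry hm
        simp only
        rw [abs_lt, abs_of_nonpos (by omega)]
        omega
      · intro y hy hne
        obtain ⟨hy, hpos⟩ := mem_posParts.1 hy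
        obtain ⟨b1, b2⟩ := hj2.colParts_bounds hs hj1 hj0 hy
        have b3 := b2 hpos
        apply entry_lt_entry hm
        simp only
        rw [abs_lt, abs_of_nonpos (by omega)]
        omega
      · ext ⟨i, j⟩
        rw [Finset.mem_union, YoungDiagram.mem_cells, YoungDiagram.mem_cells, hmu', hmu]
        simp only [Finset.mem_product, Finset.mem_Ico, Finset.mem_singleton]
        constructor
        · rintro ⟨hb, hij⟩
          by_cases hc : i < h ∨ j < v
          · exact Or.inl ⟨hb, hc⟩
          · right
            have hjv : j = v := by omega
            subst hjv
            have := YoungDiagram.mem_iff_lt_colLen.1 hb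
            omega
        · rintro (⟨hb, hc⟩ | ⟨hi, rfl⟩)
          · exact ⟨hb, by omega⟩
          · exact ⟨YoungDiagram.mem_iff_lt_colLen.2 (by omega), by omega⟩
    · obtain ⟨h1, h2⟩ := hw
      obtain ⟨hj1, hj2⟩ := hj
      have hex := h2.excess_eq
      push_cast at hex
      have hlt : (lam.colLen v : ℤ) - 1 - v - q + s < l := by
        by_cases hsl : s ≤ l
        · exact h2.col_lt hj1 hsl
        · have : w = [] := by
            cases w with
            | nil => rfl
            | cons p w => exact absurd (hj1 p (by simp)) (by omega)
          subst this
          have h3 := colLen_le_of_notMem h2.2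
          have h4 := h2.1
          push_cast at h4
          omega
      have hl1 : s < 2 * l := by omega
      obtain ⟨a, ha⟩ : ∃ a, lam.rowLen h = v + a + 1 := ⟨lam.rowLen h - v - 1, by omega⟩
      have hpart : ((l : ℤ) - excess w).toNat = a + 1 := by omega
      rw [rowParts, colParts, hpart, posParts_cons_of_pos (Nat.succ_pos a)]
      obtain ⟨mu', hmu'⟩ := exists_mem_iff_covered lam (h + 1) v
      refine .horizontal mu mu' h v (a + 1) _ _ ?_ ?_ ?_ (ih h2 hj2 hmu')
      · intro x hx hne
        obtain ⟨hx, hpos⟩ := mem_posParts.1 hx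
        obtain ⟨b1, b2⟩ := hj2.rowParts_bounds hs hj1 hx
        have b3 := b2 hpos
        apply entry_lt_entry hm
        simp only
        rw [abs_lt, abs_of_nonneg (by omega)]
        omega
      · intro y hy
        obtain ⟨hy, hpos⟩ := mem_posParts.1 hy
        obtain ⟨b1, b2⟩ := hj2.colParts_bounds hs hj1 (by omega) hy
        have b3 := b2 hpos
        apply entry_lt_entry hm
        simp only
        rw [abs_lt, abs_of_nonneg (by omega)]
        omega
      · ext ⟨i, j⟩
        rw [Finset.mem_union, YoungDiagram.mem_cells, YoungDiagram.mem_cells, hmu', hmu]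
        simp only [Finset.mem_product, Finset.mem_Ico, Finset.mem_singleton]
        constructor
        · rintro ⟨hb, hij⟩
          by_cases hc : i < h ∨ j < v
          · exact Or.inl ⟨hb, hc⟩
          · right
            have hih : i = h := by omega
            subst hih
            have := YoungDiagram.mem_iff_lt_rowLen.1 hb
            omega
        · rintro (⟨hb, hc⟩ | ⟨rfl, hi⟩)
          · exact ⟨hb, by omega⟩
          · exact ⟨YoungDiagram.mem_iff_lt_rowLen.2 (by omega), by omega⟩

/-! ### Words and last boxes -/

/-- Beyond the final corner, rows end at negative values and columns at values below `s`, so the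
word misses no admissible end. -/
theorem HasWord.mem_letters_iff (hw : HasWord lam q s h v w) (hj : IsJumpWord s w) (a : ℕ) :
    a ∈ w.map Prod.snd ↔ (∃ i, h ≤ i ∧ (lam.rowLen i : ℤ) - 1 - i + q = a) ∨
      (s ≤ a ∧ ∃ j, v ≤ j ∧ (lam.colLen j : ℤ) - 1 - j - q + s = a) := by
  induction w generalizing h v with
  | nil =>
    simp only [List.map_nil, List.not_mem_nil, false_iff, not_or, not_and, not_exists]
    have h1 := rowLen_le_of_notMem hw.2
    have h2 := colLen_le_of_notMem hw.2
    have h3 := hw.1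
    refine ⟨fun i hi => ?_, fun hs j hj => ?_⟩
    · have := lam.rowLen_anti _ _ hi
      omega
    · have := lam.colLen_anti _ _ hj
      omega
  | cons p w ih =>
    obtain ⟨_ | _, l⟩ := p
    · obtain ⟨h1, h2⟩ := hw
      rw [List.map_cons, List.mem_cons, ih h2 hj.2.2]
      constructor
      · rintro (rfl | h | ⟨hs, j, hj', h⟩)
        · exact Or.inr ⟨hj.1, v, le_rfl, h1⟩
        · exact Or.inl h
        · exact Or.inr ⟨hs, j, by omega, h⟩
      · rintro (h | ⟨hs, j, hj', h⟩)
        · exact Or.inr (Or.inl h)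
        · obtain rfl | hlt := eq_or_lt_of_le hj'
          · exact Or.inl (by simp only; omega)
          · exact Or.inr (Or.inr ⟨hs, j, hlt, h⟩)
    · obtain ⟨h1, h2⟩ := hw
      rw [List.map_cons, List.mem_cons, ih h2 hj.2]
      constructor
      · rintro (rfl | ⟨i, hi, h⟩ | h)
        · exact Or.inl ⟨h, le_rfl, h1⟩
        · exact Or.inl ⟨i, by omega, h⟩
        · exact Or.inr h
      · rintro (⟨i, hi, h'⟩ | h')
        · obtain rfl | hlt := eq_or_lt_of_le hi
          · exact Or.inl (by simp only; omega)
          · exact Or.inr (Or.inl ⟨i, hlt, h'⟩)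
        · exact Or.inr (Or.inr h')

theorem IsJumpWord.sortedGT (hj : IsJumpWord s w) : (w.map Prod.snd).SortedGT := by
  rw [List.sortedGT_iff_pairwise]
  induction w with
  | nil => exact List.Pairwise.nil
  | cons p w ih =>
    have key : (∀ x ∈ w, x.2 < p.2) ∧ IsJumpWord s w := by
      obtain ⟨_ | _, l⟩ := p
      · exact hj.2
      · exact hj
    rw [List.map_cons, List.pairwise_cons]
    refine ⟨fun b hb => ?_, ih key.2⟩
    obtain ⟨x, hx, rfl⟩ := List.mem_map.1 hb
    exact key.1 x hx

/-- A diagram without coinciding letters has a word. -/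
theorem exists_hasWord_from (lam : YoungDiagram) (q : ℤ) (s : ℕ) {H V : ℕ}
    (hHV : (H : ℤ) - V = q) (hcorner : (H, V) ∉ lam)
    (hrow : ∀ i < H, (0 : ℤ) ≤ (lam.rowLen i : ℤ) - 1 - i + q)
    (hcol : ∀ j < V, (s : ℤ) ≤ (lam.colLen j : ℤ) - 1 - j - q + s)
    (hdisj : ∀ i < H, ∀ j < V, (lam.rowLen i : ℤ) - 1 - i + q ≠ (lam.colLen j : ℤ) - 1 - j - q + s)
    (d : ℕ) {h v : ℕ} (hh : h ≤ H) (hv : v ≤ V) (hd : H - h + (V - v) = d) :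
    ∃ w, IsJumpWord s w ∧ HasWord lam q s h v w ∧ ∀ x ∈ w,
      (h < H ∧ (x.2 : ℤ) ≤ (lam.rowLen h : ℤ) - 1 - h + q) ∨
        (v < V ∧ (x.2 : ℤ) ≤ (lam.colLen v : ℤ) - 1 - v - q + s) := by
  induction d generalizing h v with
  | zero =>
    obtain rfl : h = H := by omega
    obtain rfl : v = V := by omega
    exact ⟨[], trivial, ⟨hHV, hcorner⟩, by simp⟩
  | succ d ih =>
    have hrl := lam.rowLen_anti h (h + 1) (by omega)
    have hcl := lam.colLen_anti v (v + 1) (by omega)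
    -- Merge the decreasing sequences of row ends and column ends by taking the larger current one;
    -- `hdisj` excludes ties.
    by_cases hc : h < H ∧
      (v < V → (lam.colLen v : ℤ) - 1 - v - q + s < (lam.rowLen h : ℤ) - 1 - h + q)
    · obtain ⟨h1, h2⟩ := hc
      obtain ⟨w, hw1, hw2, hw3⟩ := ih (h := h + 1) (v := v) h1 hv (by omega)
      obtain ⟨a, ha⟩ := Int.eq_ofNat_of_zero_le (hrow h h1)
      refine ⟨(true, a) :: w, ⟨fun x hx => ?_, hw1⟩, ⟨ha, hw2⟩, fun x hx => Or.inl ⟨h1, ?_⟩⟩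
      · have := hw3 x hx
        push_cast at this
        omega
      · rw [List.mem_cons] at hx
        obtain rfl | hx := hx
        · exact ha.ge
        · have := hw3 x hx
          push_cast at this
          omega
    · have h1 : v < V := by
        by_contra hcon
        exact hc ⟨by omega, fun h' => absurd h' hcon⟩
      have h2 : h < H → (lam.rowLen h : ℤ) - 1 - h + q < (lam.colLen v : ℤ) - 1 - v - q + s := by
        intro hlt
        have := hdisj h hlt v h1
        by_contra hcon
        exact hc ⟨hlt, fun _ => by omega⟩
      obtain ⟨w, hw1, hw2, hw3⟩ := ih (h := h) (v := v + 1) hh h1 (by omega)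
      have hs := hcol v h1
      obtain ⟨a, ha⟩ := Int.eq_ofNat_of_zero_le ((Int.natCast_nonneg s).trans hs)
      refine ⟨(false, a) :: w, ⟨by omega, fun x hx => ?_, hw1⟩, ⟨ha, hw2⟩,
        fun x hx => Or.inr ⟨h1, ?_⟩⟩
      · have := hw3 x hx
        push_cast at this
        omega
      · rw [List.mem_cons] at hx
        obtain rfl | hx := hx
        · exact ha.ge
        · have := hw3 x hx
          push_cast at this
          omega

theorem exists_hasWord (lam : YoungDiagram) (q : ℤ) {s : ℕ}
    (hdisj : ∀ a : ℕ, s ≤ a → ∀ i j, (lam.rowLen i : ℤ) - 1 - i + q = a →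
      (lam.colLen j : ℤ) - 1 - j - q + s ≠ a) :
    ∃ w, IsJumpWord s w ∧ HasWord lam q s 0 0 w := by
  classical
  have hex : ∃ i : ℕ, (lam.rowLen i : ℤ) - 1 - i + q < 0 := by
    refine ⟨lam.rowLen 0 + q.natAbs, ?_⟩
    have := lam.rowLen_anti 0 (lam.rowLen 0 + q.natAbs) (by omega)
    omega
  -- Row `H` is the first with a negative end, so `H ≥ q` and `V = H - q` makes sense. The `H × V`
  -- rectangle lies in `lam` but its outer corner `(H, V)` does not; hence the first `V` columns end
  -- at letters at least `s`.
  set H := Nat.find hex with hH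
  have hH1 : (lam.rowLen H : ℤ) - 1 - H + q < 0 := Nat.find_spec hex
  have hH2 : ∀ i < H, (0 : ℤ) ≤ (lam.rowLen i : ℤ) - 1 - i + q := fun i hi => by
    have := Nat.find_min hex hi
    omega
  obtain ⟨V, hV⟩ : ∃ V : ℕ, (H : ℤ) - V = q := ⟨(H - q).toNat, by omega⟩
  have hcorner : (H, V) ∉ lam := by
    rw [YoungDiagram.mem_iff_lt_rowLen]
    omega
  have hcol : ∀ j < V, (s : ℤ) ≤ (lam.colLen j : ℤ) - 1 - j - q + s := by
    intro j hj
    have h1 : H ≤ lam.colLen (V - 1) := by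
      cases hc : H with
      | zero => exact Nat.zero_le _
      | succ H' =>
        have h2 := hH2 H' (by omega)
        have : (H', V - 1) ∈ lam := by
          rw [YoungDiagram.mem_iff_lt_rowLen]
          omega
        exact YoungDiagram.mem_iff_lt_colLen.1 this
    have h3 := lam.colLen_anti j (V - 1) (by omega)
    omega
  obtain ⟨w, h1, h2, -⟩ := exists_hasWord_from lam q s hV hcorner hH2 hcol
    (fun i hi j hj heq => by
      have h3 := hH2 i hi
      have h4 := hcol j hj
      obtain ⟨a, ha⟩ := Int.eq_ofNat_of_zero_le h3
      exact hdisj a (by omega) i j ha (by omega)) _ (Nat.zero_le H) (Nat.zero_le V) rfl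
  exact ⟨w, h1, h2⟩

/-! ### The diagram of a word -/

/-- The horizontal letters of a word. -/
def rowLetters : List (Bool × ℕ) → List ℕ
  | [] => []
  | (true, a) :: w => a :: rowLetters w
  | (false, _) :: w => rowLetters w

/-- The vertical letters of a word. -/
def colLetters : List (Bool × ℕ) → List ℕ
  | [] => []
  | (true, _) :: w => colLetters w
  | (false, a) :: w => a :: colLetters w

theorem hasWord_of_letters
    (hrow : ∀ (i : ℕ) (hi : i < (rowLetters w).length),
      (lam.rowLen (h + i) : ℤ) - 1 - (h + i : ℕ) + q = (rowLetters w)[i])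
    (hcol : ∀ (j : ℕ) (hj : j < (colLetters w).length),
      (lam.colLen (v + j) : ℤ) - 1 - (v + j : ℕ) - q + s = (colLetters w)[j])
    (hq : ((h + (rowLetters w).length : ℕ) : ℤ) - (v + (colLetters w).length : ℕ) = q)
    (hn : (h + (rowLetters w).length, v + (colLetters w).length) ∉ lam) :
    HasWord lam q s h v w := by
  induction w generalizing h v with
  | nil => exact ⟨hq, hn⟩
  | cons p w ih =>
    obtain ⟨_ | _, a⟩ := p
    · refine ⟨by simpa [colLetters] using hcol 0 (by simp [colLetters]), ih hrow ?_ ?_ ?_⟩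
      · intro j hj
        have := hcol (j + 1) (by simpa [colLetters] using hj)
        rw [show v + 1 + j = v + (j + 1) by ring]
        simpa [colLetters] using this
      · rw [← hq]
        simp only [colLetters, rowLetters, List.length_cons]
        push_cast
        ring
      · simpa only [colLetters, rowLetters, List.length_cons,
          show v + 1 + (colLetters w).length = v + ((colLetters w).length + 1) by ring] using hn
    · refine ⟨by simpa [rowLetters] using hrow 0 (by simp [rowLetters]), ih ?_ hcol ?_ ?_⟩
      · intro j hj
        have := hrow (j + 1) (by simpa [rowLetters] using hj)
        rw [show h + 1 + j = h + (j + 1) by ring]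
        simpa [rowLetters] using this
      · rw [← hq]
        simp only [colLetters, rowLetters, List.length_cons]
        push_cast
        ring
      · simpa only [colLetters, rowLetters, List.length_cons,
          show h + 1 + (rowLetters w).length = h + ((rowLetters w).length + 1) by ring] using hn

theorem excess_eq_letters (w : List (Bool × ℕ)) :
    excess w = (rowLetters w).length - (colLetters w).length := by
  induction w with
  | nil => rfl
  | cons p w ih =>
    obtain ⟨_ | _, a⟩ := p <;> simp only [excess, rowLetters, colLetters, ih, List.length_cons] <;>
      push_cast <;> ring

theorem rowLetters_sublist (w : List (Bool × ℕ)) : (rowLetters w).Sublist (w.map Prod.snd) := by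
  induction w with
  | nil => exact List.Sublist.slnil
  | cons p w ih =>
    obtain ⟨_ | _, a⟩ := p
    · exact ih.cons _
    · exact ih.cons_cons _

theorem colLetters_sublist (w : List (Bool × ℕ)) : (colLetters w).Sublist (w.map Prod.snd) := by
  induction w with
  | nil => exact List.Sublist.slnil
  | cons p w ih =>
    obtain ⟨_ | _, a⟩ := p
    · exact ih.cons_cons _
    · exact ih.cons _

theorem IsJumpWord.le_of_mem_colLetters (hj : IsJumpWord s w) {a : ℕ} (ha : a ∈ colLetters w) :
    s ≤ a := by
  induction w with
  | nil => simp [colLetters] at ha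
  | cons p w ih =>
    obtain ⟨_ | _, b⟩ := p
    · rw [colLetters, List.mem_cons] at ha
      obtain rfl | ha := ha
      · exact hj.1
      · exact ih hj.2.2 ha
    · exact ih hj.2 ha

theorem getElem_add_le_of_sortedGT {l : List ℕ} (hl : l.SortedGT) {i k : ℕ} (hik : i ≤ k)
    (hk : k < l.length) : l[k] + (k - i) ≤ l[i] := by
  obtain ⟨d, rfl⟩ := Nat.exists_eq_add_of_le hik
  induction d with
  | zero => simp
  | succ d ih =>
    have h1 := ih (by omega) (by omega)
    have h2 : l[i + (d + 1)] < l[i + d] := hl.getElem_gt_getElem_of_lt (by omega)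
    omega

/-- Horizontal letters prescribe the first `R.length` rows, vertical ones the first `K.length`
columns. The prescriptions agree: as the letters strictly decrease, `hR1` and `hK1` make all these
rows and columns contain the `R.length × K.length` rectangle, outside of which they do not meet. -/
theorem exists_diagram_of_jumpWord (hj : IsJumpWord s w) :
    ∃ lam, HasWord lam (excess w) s 0 0 w := by
  classical
  set R := rowLetters w with hR
  set K := colLetters w with hK
  have hq := excess_eq_letters w
  rw [← hR, ← hK] at hq
  set q := excess w with hqd
  have hRs : R.SortedGT := by
    have := hj.sortedGT
    rw [List.sortedGT_iff_pairwise] at this ⊢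
    exact this.sublist (rowLetters_sublist w)
  have hKs : K.SortedGT := by
    have := hj.sortedGT
    rw [List.sortedGT_iff_pairwise] at this ⊢
    exact this.sublist (colLetters_sublist w)
  have hR1 : ∀ i (hi : i < R.length), R.length - 1 - i ≤ R[i] := by
    intro i hi
    have := getElem_add_le_of_sortedGT hRs (show i ≤ R.length - 1 by omega) (by omega)
    omega
  have hK1 : ∀ i (hi : i < K.length), K.length - 1 - i + s ≤ K[i] := by
    intro i hi
    have := getElem_add_le_of_sortedGT hKs (show i ≤ K.length - 1 by omega) (by omega)
    have := hj.le_of_mem_colLetters (List.getElem_mem (l := K) (n := K.length - 1) (by omega))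
    omega
  let P : ℕ × ℕ → Prop := fun b =>
    (∃ hi : b.1 < R.length, (b.2 : ℤ) - b.1 + q ≤ R[b.1]) ∨
      (∃ hj : b.2 < K.length, (b.1 : ℤ) - b.2 - q + s ≤ K[b.2])
  have hPfin : {b | P b}.Finite := by
    let B := R.sum + K.sum + R.length + K.length + q.natAbs
    refine (Set.finite_Iic ((B, B) : ℕ × ℕ)).subset ?_
    rintro ⟨i, j⟩ (⟨hi, hb⟩ | ⟨hi, hb⟩)
    · have := List.le_sum_of_mem (List.getElem_mem (l := R) hi)
      simp only at hi hb this
      exact Prod.mk_le_mk.2 ⟨by omega, by omega⟩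
    · have := List.le_sum_of_mem (List.getElem_mem (l := K) hi)
      simp only at hi hb this
      exact Prod.mk_le_mk.2 ⟨by omega, by omega⟩
  have hPlow : IsLowerSet {b | P b} := by
    rintro ⟨i, j⟩ ⟨i', j'⟩ hij hb
    have h1 : i' ≤ i := hij.1
    have h2 : j' ≤ j := hij.2
    obtain ⟨hi, hb⟩ | ⟨hi, hb⟩ := hb
    · simp only at hi hb
      have := getElem_add_le_of_sortedGT hRs h1 hi
      exact Or.inl ⟨by simp only; omega, by simp only; omega⟩
    · simp only at hi hb
      have := getElem_add_le_of_sortedGT hKs h2 hi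
      exact Or.inr ⟨by simp only; omega, by simp only; omega⟩
  let lam : YoungDiagram := ⟨hPfin.toFinset, by simpa using hPlow⟩
  have hmem : ∀ b, b ∈ lam ↔ P b := fun b => by
    rw [← YoungDiagram.mem_cells]
    simp [lam]
  refine ⟨lam, hasWord_of_letters ?_ ?_ ?_ ?_⟩
  · intro i hi
    rw [← hR] at hi
    have hi1 := hR1 i hi
    suffices lam.rowLen i = (R[i] + 1 + i - q).toNat by
      simp only [Nat.zero_add, ← hR]
      omega
    refine eq_of_forall_lt_iff fun j => ?_
    rw [← YoungDiagram.mem_iff_lt_rowLen, hmem]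
    constructor
    · rintro (⟨h1, h2⟩ | ⟨h1, h2⟩)
      · simp only at h1 h2
        omega
      · simp only at h1 h2
        omega
    · intro h1
      exact Or.inl ⟨hi, by simp only; omega⟩
  · intro j hj'
    rw [← hK] at hj'
    have hj1 := hK1 j hj'
    suffices lam.colLen j = (K[j] + 1 + j + q - s).toNat by
      simp only [Nat.zero_add, ← hK]
      omega
    refine eq_of_forall_lt_iff fun i => ?_
    rw [← YoungDiagram.mem_iff_lt_colLen, hmem]
    constructor
    · rintro (⟨h1, h2⟩ | ⟨h1, h2⟩)
      · simp only at h1 h2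
        omega
      · simp only at h1 h2
        omega
    · intro h1
      exact Or.inr ⟨hj', by simp only; omega⟩
  · rw [← hR, ← hK]
    push_cast
    omega
  · rw [← hR, ← hK, hmem]
    rintro (⟨h1, h2⟩ | ⟨h1, h2⟩)
    · simp at h1
    · simp at h1

end Words

/-! ### Splitting and joining are deterministic -/

/-- The box with the strictly maximal entry is the end of the next block. It fixes the kind as well,
except for the single box `(h, v)`, where the sign of content plus `m` decides. -/
theorem SplitsFrom.unique {m : ℝ} {lam : YoungDiagram} {h v : ℕ} {X Y X' Y' : Multiset ℕ}
    (h1 : SplitsFrom m lam h v X Y) (h2 : SplitsFrom m lam h v X' Y') : X = X' ∧ Y = Y' := by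
  induction h1 generalizing X' Y' with
  | done h v hd =>
    cases h2 with
    | done => exact ⟨rfl, rfl⟩
    | horizontal _ _ a X Y hmem => exact absurd (lam.up_left_mem le_rfl (by omega) hmem) hd
    | vertical _ _ a X Y hmem => exact absurd (lam.up_left_mem (by omega) le_rfl hmem) hd
  | horizontal h v a X Y hmem hend hmax hone hrest ih =>
    cases h2 with
    | done _ _ hd => exact absurd (lam.up_left_mem le_rfl (by omega) hmem) hd
    | horizontal _ _ a' X' Y' hmem' hend' hmax' hone' hrest' =>
      have : a = a' := by
        rw [YoungDiagram.mem_iff_lt_rowLen] at hmem hend hmem' hend'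
        omega
      subst this
      obtain ⟨rfl, rfl⟩ := ih hrest'
      exact ⟨rfl, rfl⟩
    | vertical _ _ a' X' Y' hmem' hend' hmax' hone' hrest' =>
      exfalso
      by_cases hb : (h + a', v) = (h, v + a)
      · simp only [Prod.mk.injEq] at hb
        have := hone (by omega)
        have := hone' (by omega)
        linarith
      · have h1 := hmax _ hmem' (by simp) (by simp) hb
        have h2 := hmax' _ hmem (by simp) (by simp) (Ne.symm hb)
        exact lt_asymm h1 h2
  | vertical h v a X Y hmem hend hmax hone hrest ih =>
    cases h2 with
    | done _ _ hd => exact absurd (lam.up_left_mem (by omega) le_rfl hmem) hd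
    | vertical _ _ a' X' Y' hmem' hend' hmax' hone' hrest' =>
      have : a = a' := by
        rw [YoungDiagram.mem_iff_lt_colLen] at hmem hend hmem' hend'
        omega
      subst this
      obtain ⟨rfl, rfl⟩ := ih hrest'
      exact ⟨rfl, rfl⟩
    | horizontal _ _ a' X' Y' hmem' hend' hmax' hone' hrest' =>
      exfalso
      by_cases hb : (h, v + a') = (h + a, v)
      · simp only [Prod.mk.injEq] at hb
        have := hone (by omega)
        have := hone' (by omega)
        linarith
      · have h1 := hmax _ hmem' (by simp) (by simp) hb
        have h2 := hmax' _ hmem (by simp) (by simp) (Ne.symm hb)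
        exact lt_asymm h1 h2

theorem Splits.unique {m : ℝ} {lam : YoungDiagram} {A B : YoungDiagram × YoungDiagram}
    (hA : Splits m lam A) (hB : Splits m lam B) : A = B := by
  obtain ⟨X, Y, h1, rfl⟩ := hA
  obtain ⟨X', Y', h2, rfl⟩ := hB
  obtain ⟨rfl, rfl⟩ := h1.unique h2
  rfl

/-- If two different elements are chosen from one multiset, each remains when the other is taken.
The strict maximality in `JoinsFrom` forbids this, so joining is deterministic. -/
theorem cons_eq_cons_of_imp {a b : ℕ} {X Y : Multiset ℕ} (h : a ::ₘ X = b ::ₘ Y)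
    (hab : a ≠ b → b ∈ X → a ∈ Y → False) : a = b ∧ X = Y := by
  by_cases hne : a = b
  · subst hne
    exact ⟨rfl, (Multiset.cons_inj_right a).1 h⟩
  · exfalso
    obtain h | ⟨-, cs, h1, h2⟩ := Multiset.cons_eq_cons.1 h
    · exact hne h.1
    · exact hab hne (by rw [h1]; exact Multiset.mem_cons_self _ _)
        (by rw [h2]; exact Multiset.mem_cons_self _ _)

theorem JoinsFrom.unique {m : ℝ} {lam lam' mu : YoungDiagram} {h v : ℕ} {X Y : Multiset ℕ}
    (h1 : JoinsFrom m lam mu h v X Y) (h2 : JoinsFrom m lam' mu h v X Y) : lam = lam' := by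
  induction h1 with
  | done h v =>
    have key : ∀ X Y, JoinsFrom m lam' lam h v X Y → X = 0 → Y = 0 → lam = lam' := by
      intro X Y hj hX hY
      cases hj with
      | done => rfl
      | horizontal => exact absurd hX Multiset.cons_ne_zero
      | vertical => exact absurd hY Multiset.cons_ne_zero
    exact key 0 0 h2 rfl rfl
  | horizontal mu mu' h v a X Y hX hY hplace hrest ih =>
    generalize hX' : a ::ₘ X = X' at h2
    cases h2 with
    | done => exact absurd hX' (Multiset.cons_ne_zero)
    | horizontal _ mu'' _ _ a' X' _ hX1 hY1 hplace' hrest' =>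
      obtain ⟨rfl, rfl⟩ := cons_eq_cons_of_imp hX' fun hne h1 h2 =>
        lt_asymm (hX _ h1 (Ne.symm hne)) (hX1 _ h2 hne)
      obtain rfl : mu' = mu'' := YoungDiagram.ext (hplace.trans hplace'.symm)
      exact ih hrest'
    | vertical _ mu'' _ _ a' _ Y' hX1 hY1 hplace' hrest' =>
      exfalso
      subst hX'
      exact lt_asymm (hY a' (Multiset.mem_cons_self _ _)) (hX1 a (Multiset.mem_cons_self _ _))
  | vertical mu mu' h v a X Y hX hY hplace hrest ih =>
    generalize hY' : a ::ₘ Y = Y' at h2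
    cases h2 with
    | done => exact absurd hY' (Multiset.cons_ne_zero)
    | vertical _ mu'' _ _ a' _ Y' hX1 hY1 hplace' hrest' =>
      obtain ⟨rfl, rfl⟩ := cons_eq_cons_of_imp hY' fun hne h1 h2 =>
        lt_asymm (hY _ h1 (Ne.symm hne)) (hY1 _ h2 hne)
      obtain rfl : mu' = mu'' := YoungDiagram.ext (hplace.trans hplace'.symm)
      exact ih hrest'
    | horizontal _ mu'' _ _ a' X' _ hX1 hY1 hplace' hrest' =>
      exfalso
      subst hY'
      exact lt_asymm (hX a' (Multiset.mem_cons_self _ _)) (hY1 a (Multiset.mem_cons_self _ _))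

/-! ### Transposition -/

theorem content_swap (b : ℕ × ℕ) : content b.swap = -content b := by
  simp [content]

theorem entry_neg_swap (m : ℝ) (b : ℕ × ℕ) : entry (-m) b.swap = entry m b := by
  rw [entry, entry, content_swap, ← abs_neg]
  push_cast
  ring_nf

theorem entry_neg_mk (m : ℝ) (i j : ℕ) : entry (-m) (j, i) = entry m (i, j) :=
  entry_neg_swap m (i, j)

theorem SplitsFrom.transpose {m : ℝ} {lam : YoungDiagram} {h v : ℕ} {X Y : Multiset ℕ}
    (hsp : SplitsFrom m lam h v X Y) : SplitsFrom (-m) lam.transpose v h Y X := by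
  induction hsp with
  | done h v hd => exact .done v h (by simpa using hd)
  | horizontal h v a X Y hmem hend hmax hone hrest ih =>
    refine .vertical v h a Y X (by simpa using hmem) (by simpa using hend) ?_ ?_ ih
    · rintro ⟨i, j⟩ hb hi hj hne
      rw [entry_neg_mk, entry_neg_mk]
      refine hmax (j, i) (by simpa using hb) hj hi fun heq => hne ?_
      simpa [and_comm] using heq
    · intro ha
      have := hone ha
      rw [show (v, h) = Prod.swap (h, v) from rfl, content_swap]
      push_cast
      linarith
  | vertical h v a X Y hmem hend hmax hone hrest ih =>
    refine .horizontal v h a Y X (by simpa using hmem) (by simpa using hend) ?_ ?_ ih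
    · rintro ⟨i, j⟩ hb hi hj hne
      rw [entry_neg_mk, entry_neg_mk]
      refine hmax (j, i) (by simpa using hb) hj hi fun heq => hne ?_
      simpa [and_comm] using heq
    · intro ha
      have := hone ha
      rw [show (v, h) = Prod.swap (h, v) from rfl, content_swap]
      push_cast
      linarith

theorem Splits.transpose {m : ℝ} {lam : YoungDiagram} {A : YoungDiagram × YoungDiagram}
    (hA : Splits m lam A) : Splits (-m) lam.transpose A.swap := by
  obtain ⟨X, Y, h1, rfl⟩ := hA
  exact ⟨Y, X, h1.transpose, rfl⟩

theorem JoinsFrom.transpose {m : ℝ} {lam mu : YoungDiagram} {h v : ℕ} {X Y : Multiset ℕ}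
    (hj : JoinsFrom m lam mu h v X Y) :
    JoinsFrom (-m) lam.transpose mu.transpose v h Y X := by
  induction hj with
  | done h v => exact .done v h
  | horizontal mu mu' h v a X Y hX hY hplace hrest ih =>
    refine .vertical _ _ v h a Y X ?_ ?_ ?_ ih
    · simpa only [entry_neg_mk] using hY
    · simpa only [entry_neg_mk] using hX
    · ext ⟨i, j⟩
      have := Finset.ext_iff.1 hplace (j, i)
      simp only [YoungDiagram.mem_cells, Finset.mem_union, Finset.mem_product,
        YoungDiagram.mem_transpose, Prod.swap_prod_mk] at this ⊢
      rw [this]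
      tauto
  | vertical mu mu' h v a X Y hX hY hplace hrest ih =>
    refine .horizontal _ _ v h a Y X ?_ ?_ ?_ ih
    · simpa only [entry_neg_mk] using hY
    · simpa only [entry_neg_mk] using hX
    · ext ⟨i, j⟩
      have := Finset.ext_iff.1 hplace (j, i)
      simp only [YoungDiagram.mem_cells, Finset.mem_union, Finset.mem_product,
        YoungDiagram.mem_transpose, Prod.swap_prod_mk] at this ⊢
      rw [this]
      tauto

theorem Joins.transpose {m : ℝ} {lam : YoungDiagram} {A : YoungDiagram × YoungDiagram}
    (hA : Joins m A lam) : Joins (-m) A.swap lam.transpose := by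
  have := JoinsFrom.transpose hA
  have hbot : (⊥ : YoungDiagram).transpose = ⊥ := by
    ext b
    simp
  rwa [hbot] at this

/-! ### The number of boxes -/

theorem SplitsFrom.sum_eq {m : ℝ} {lam : YoungDiagram} {h v : ℕ} {X Y : Multiset ℕ}
    (hsp : SplitsFrom m lam h v X Y) :
    (lam.cells.filter fun b => h ≤ b.1 ∧ v ≤ b.2).card = X.sum + Y.sum := by
  induction hsp with
  | done h v hd =>
    rw [Multiset.sum_zero, add_zero, Finset.card_eq_zero, Finset.filter_eq_empty_iff]
    rintro ⟨i, j⟩ hb ⟨h1, h2⟩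
    exact hd (lam.up_left_mem h1 h2 hb)
  | horizontal h v a X Y hmem hend hmax hone hrest ih =>
    rw [YoungDiagram.mem_iff_lt_rowLen] at hmem hend
    have : (lam.cells.filter fun b => h ≤ b.1 ∧ v ≤ b.2) =
        (lam.cells.filter fun b => h + 1 ≤ b.1 ∧ v ≤ b.2) ∪
          {h} ×ˢ Finset.Ico v (v + (a + 1)) := by
      ext ⟨i, j⟩
      simp only [Finset.mem_filter, Finset.mem_union, Finset.mem_product, Finset.mem_singleton,
        Finset.mem_Ico, YoungDiagram.mem_cells]
      by_cases hi : i = h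
      · subst hi
        rw [YoungDiagram.mem_iff_lt_rowLen]
        omega
      · grind
    rw [this, Finset.card_union_of_disjoint, ih, Finset.card_product, Multiset.sum_cons]
    · simp
      ring
    · rw [Finset.disjoint_left]
      rintro ⟨i, j⟩ hb hb'
      simp only [Finset.mem_filter, Finset.mem_product, Finset.mem_singleton] at hb hb'
      omega
  | vertical h v a X Y hmem hend hmax hone hrest ih =>
    rw [YoungDiagram.mem_iff_lt_colLen] at hmem hend
    have : (lam.cells.filter fun b => h ≤ b.1 ∧ v ≤ b.2) =
        (lam.cells.filter fun b => h ≤ b.1 ∧ v + 1 ≤ b.2) ∪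
          Finset.Ico h (h + (a + 1)) ×ˢ {v} := by
      ext ⟨i, j⟩
      simp only [Finset.mem_filter, Finset.mem_union, Finset.mem_product, Finset.mem_singleton,
        Finset.mem_Ico, YoungDiagram.mem_cells]
      by_cases hi : j = v
      · subst hi
        rw [YoungDiagram.mem_iff_lt_colLen]
        omega
      · grind
    rw [this, Finset.card_union_of_disjoint, ih, Finset.card_product, Multiset.sum_cons]
    · simp
      ring
    · rw [Finset.disjoint_left]
      rintro ⟨i, j⟩ hb hb'
      simp only [Finset.mem_filter, Finset.mem_product, Finset.mem_singleton] at hb hb'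
      omega

theorem Splits.card_eq {m : ℝ} {lam : YoungDiagram} {A : YoungDiagram × YoungDiagram}
    (hA : Splits m lam A) : A.1.card + A.2.card = lam.card := by
  obtain ⟨X, Y, h1, rfl⟩ := hA
  rw [card_ofParts, card_ofParts, ← h1.sum_eq]
  simp [YoungDiagram.card]

/-! ### Counting signed coordinates -/

/-- The number of coordinates of `c` and `-c` that are equal to `x k`. -/
def signedCount {n : ℕ} (k : ℝ) (c : Fin n → ℝ) (x : ℝ) : ℕ :=
  (Finset.univ.filter fun p : Fin n × ℤˣ => ((p.2 : ℤ) : ℝ) * c p.1 = x * k).card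

section Counting

variable {n : ℕ} (k : ℝ) (c : Fin n → ℝ)

/-- The value of a signed coordinate. -/
def signedCoord (p : Fin n × ℤˣ) : ℝ := ((p.2 : ℤ) : ℝ) * c p.1

/-- The negation of signed coordinates. -/
def negIndex : (Fin n × ℤˣ) ≃ (Fin n × ℤˣ) := Equiv.prodCongr (Equiv.refl _) (Equiv.neg _)

theorem signedCoord_negIndex (p : Fin n × ℤˣ) :
    signedCoord c (negIndex p) = -signedCoord c p := by
  simp [signedCoord, negIndex]

theorem signedCount_eq (x : ℝ) :
    signedCount k c x = (Finset.univ.filter fun p => signedCoord c p = x * k).card := rfl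

theorem signedCount_neg (x : ℝ) : signedCount k c (-x) = signedCount k c x := by
  rw [signedCount_eq, signedCount_eq]
  refine Finset.card_equiv negIndex fun p => ?_
  simp only [Finset.mem_filter, Finset.mem_univ, true_and, signedCoord_negIndex]
  constructor <;> intro h <;> linarith

theorem card_filter_mul_units (a : ℝ) (p : ℝ → Prop) [DecidablePred p] :
    (Finset.univ.filter fun u : ℤˣ => p (((u : ℤ) : ℝ) * a)).card =
      (if p a then 1 else 0) + (if p (-a) then 1 else 0) := by
  have : (Finset.univ : Finset ℤˣ) = {1, -1} := rfl
  rw [this, Finset.card_filter, Finset.sum_pair (by decide)]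
  simp

theorem signedCount_eq_add (x : ℝ) :
    signedCount k c x = (Finset.univ.filter fun i => c i = x * k).card +
      (Finset.univ.filter fun i => c i = -x * k).card := by
  rw [signedCount, Finset.card_filter, Fintype.sum_prod_type]
  simp only [← Finset.card_filter]
  simp only [card_filter_mul_units _ (fun y => y = x * k)]
  rw [Finset.sum_add_distrib, ← Finset.card_filter, ← Finset.card_filter]
  congr 2
  ext i
  simp only [Finset.mem_filter, Finset.mem_univ, true_and]
  constructor <;> intro h <;> linarith

theorem mult_eq_card {l : ℝ} : mult k c l = (Finset.univ.filter fun i => |c i| = l * |k|).card := by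
  rw [mult, Set.ncard_eq_toFinset_card']
  congr 1
  ext i
  simp

variable {k}

theorem signedCount_eq_mult {l : ℝ} (hk : k ≠ 0) (hl : 0 < l) :
    signedCount k c l = mult k c l := by
  rw [signedCount_eq_add, mult_eq_card, ← Finset.card_union_of_disjoint]
  · congr 1
    ext i
    simp only [Finset.mem_union, Finset.mem_filter, Finset.mem_univ, true_and]
    rw [← abs_of_pos hl, ← abs_mul, abs_eq_abs, abs_of_pos hl, neg_mul]
  · rw [Finset.disjoint_left]
    intro i h1 h2
    simp only [Finset.mem_filter, Finset.mem_univ, true_and] at h1 h2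
    have : l * k = 0 := by linarith
    exact mul_ne_zero hl.ne' hk this

/-- Zero is its own negative, so a zero coordinate is counted twice. This evenness controls the
number of jumps for integral `m`. -/
theorem signedCount_zero : signedCount k c 0 = 2 * mult k c 0 := by
  rw [signedCount_eq_add, mult_eq_card]
  simp only [neg_zero, zero_mul, abs_eq_zero]
  ring

theorem mult_le {l : ℝ} : mult k c l ≤ n := by
  rw [mult_eq_card]
  exact (Finset.card_filter_le _ _).trans (by simp)

/-- The values of the signed coordinates, divided by `k`. -/
def signedValues (k : ℝ) (c : Fin n → ℝ) : Finset ℝ :=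
  Finset.univ.image fun p : Fin n × ℤˣ => signedCoord c p / k

theorem signedCount_eq_zero (hk : k ≠ 0) {x : ℝ} (hx : x ∉ signedValues k c) :
    signedCount k c x = 0 := by
  rw [signedCount_eq, Finset.card_eq_zero, Finset.filter_eq_empty_iff]
  intro p _ hp
  apply hx
  rw [signedValues, Finset.mem_image]
  exact ⟨p, Finset.mem_univ _, by rw [hp]; field_simp⟩

theorem sum_signedCoord (hk : k ≠ 0) (F : ℝ → ℤ) {S : Finset ℝ} (hS : signedValues k c ⊆ S) :
    ∑ p : Fin n × ℤˣ, F (signedCoord c p / k) = ∑ x ∈ S, (signedCount k c x : ℤ) * F x := by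
  rw [← Finset.sum_fiberwise_of_maps_to (t := S) (g := fun p => signedCoord c p / k)]
  · refine Finset.sum_congr rfl fun x _ => ?_
    rw [Finset.sum_congr rfl (g := fun _ => F x), Finset.sum_const, nsmul_eq_mul]
    · congr 2
      rw [signedCount_eq]
      congr 1
      ext p
      simp only [Finset.mem_filter, Finset.mem_univ, true_and]
      rw [div_eq_iff hk]
    · intro p hp
      rw [(Finset.mem_filter.1 hp).2]
  · intro p _
    exact hS (Finset.mem_image_of_mem _ (Finset.mem_univ _))

/-! ### Counting roots -/

/-- The sum of two signed coordinate functions. -/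
def pairRoot (x : (Fin n × ℤˣ) × (Fin n × ℤˣ)) : Fin n → ℝ :=
  Pi.single x.1.1 ((x.1.2 : ℤ) : ℝ) + Pi.single x.2.1 ((x.2.2 : ℤ) : ℝ)

theorem unit_cast_ne_zero (u : ℤˣ) : ((u : ℤ) : ℝ) ≠ 0 := by
  exact_mod_cast u.ne_zero

theorem unit_cast_inj {u v : ℤˣ} (h : ((u : ℤ) : ℝ) = ((v : ℤ) : ℝ)) : u = v := by
  exact_mod_cast h

theorem pairRoot_injective {x y : (Fin n × ℤˣ) × (Fin n × ℤˣ)} (hx : x.1.1 ≠ x.2.1)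
    (hy : y.1.1 ≠ y.2.1) (h : pairRoot x = pairRoot y) : x = y ∨ x = y.swap := by
  obtain ⟨⟨i, a⟩, ⟨j, b⟩⟩ := x
  obtain ⟨⟨i', a'⟩, ⟨j', b'⟩⟩ := y
  simp only at hx hy
  have h1 := congrFun h i
  have h2 := congrFun h j
  simp only [pairRoot, Pi.add_apply, Pi.single_eq_same, Pi.single_eq_of_ne hx,
    Pi.single_eq_of_ne hx.symm, add_zero, zero_add] at h1 h2
  simp only [Pi.single_apply] at h1 h2
  have ha := unit_cast_ne_zero a
  have hb := unit_cast_ne_zero b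
  by_cases e1 : i = i'
  · subst e1
    rw [if_pos rfl, if_neg hy, add_zero] at h1
    rw [if_neg hx.symm, zero_add] at h2
    by_cases e2 : j = j'
    · subst e2
      rw [if_pos rfl] at h2
      rw [unit_cast_inj h1, unit_cast_inj h2]
      exact Or.inl rfl
    · rw [if_neg e2] at h2
      exact absurd h2 hb
  · rw [if_neg e1, zero_add] at h1
    by_cases e2 : i = j'
    · subst e2
      rw [if_pos rfl] at h1
      rw [if_neg hx.symm, add_zero] at h2
      by_cases e3 : j = i'
      · subst e3
        rw [if_pos rfl] at h2
        rw [unit_cast_inj h1, unit_cast_inj h2]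
        exact Or.inr rfl
      · rw [if_neg e3] at h2
        exact absurd h2 hb
    · rw [if_neg e2] at h1
      exact absurd h1 ha

theorem pairRoot_dotProduct (x : (Fin n × ℤˣ) × (Fin n × ℤˣ)) :
    pairRoot x ⬝ᵥ c = signedCoord c x.1 + signedCoord c x.2 := by
  simp [pairRoot, signedCoord, add_dotProduct]

/-- Twice the number of long roots with the value `y` at `c`. -/
theorem two_mul_ncard_longRoots (y : ℝ) :
    2 * {α ∈ longRoots n | α ⬝ᵥ c = y}.ncard =
      (Finset.univ.filter fun x : (Fin n × ℤˣ) × (Fin n × ℤˣ) =>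
        x.1.1 ≠ x.2.1 ∧ signedCoord c x.1 + signedCoord c x.2 = y).card := by
  classical
  set S := Finset.univ.filter fun x : (Fin n × ℤˣ) × (Fin n × ℤˣ) =>
    x.1.1 ≠ x.2.1 ∧ signedCoord c x.1 + signedCoord c x.2 = y with hS
  have himg : {α ∈ longRoots n | α ⬝ᵥ c = y} = (S.image pairRoot : Finset (Fin n → ℝ)) := by
    ext α
    simp only [longRoots, Finset.coe_image, Set.mem_image, Finset.mem_coe, hS,
      Finset.mem_filter, Finset.mem_univ, true_and]
    constructor
    · rintro ⟨⟨i, j, hij, a, b, rfl⟩, h⟩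
      refine ⟨((i, a), (j, b)), ⟨hij, ?_⟩, rfl⟩
      rw [← pairRoot_dotProduct]
      exact h
    · rintro ⟨x, ⟨hx, h⟩, rfl⟩
      exact ⟨⟨x.1.1, x.2.1, hx, x.1.2, x.2.2, rfl⟩, by rw [pairRoot_dotProduct]; exact h⟩
  rw [himg, Set.ncard_coe_finset, Finset.card_eq_sum_card_image pairRoot S,
    Finset.sum_congr rfl (g := fun _ => 2), Finset.sum_const, smul_eq_mul, mul_comm]
  intro α hα
  obtain ⟨x, hx, rfl⟩ := Finset.mem_image.1 hα
  rw [hS, Finset.mem_filter] at hx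
  have hfib : S.filter (fun z => pairRoot z = pairRoot x) = {x, x.swap} := by
    ext z
    simp only [hS, Finset.mem_filter, Finset.mem_univ, true_and, Finset.mem_insert,
      Finset.mem_singleton]
    constructor
    · rintro ⟨⟨hz, -⟩, h⟩
      exact pairRoot_injective hz hx.2.1 h
    · rintro (rfl | rfl)
      · exact ⟨hx.2, rfl⟩
      · refine ⟨⟨hx.2.1.symm, ?_⟩, ?_⟩
        · rw [← hx.2.2]
          exact add_comm _ _
        · exact add_comm _ _
  rw [hfib, Finset.card_pair]
  intro h
  exact hx.2.1 (congrArg (fun z => z.1.1) h)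

theorem ncard_shortRoots (x : ℝ) :
    {α ∈ shortRoots n | α ⬝ᵥ c = x * k}.ncard = signedCount k c x := by
  classical
  have himg : {α ∈ shortRoots n | α ⬝ᵥ c = x * k} =
      ((Finset.univ.filter fun p => signedCoord c p = x * k).image
        (fun p : Fin n × ℤˣ => (Pi.single p.1 ((p.2 : ℤ) : ℝ) : Fin n → ℝ)) : Finset _) := by
    ext α
    simp only [shortRoots, Finset.coe_image, Set.mem_image, Finset.mem_coe,
      Finset.mem_filter, Finset.mem_univ, true_and]
    constructor
    · rintro ⟨⟨i, a, rfl⟩, h⟩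
      exact ⟨(i, a), by simpa [signedCoord] using h, rfl⟩
    · rintro ⟨p, h, rfl⟩
      exact ⟨⟨p.1, p.2, rfl⟩, by simpa [signedCoord] using h⟩
  rw [himg, Set.ncard_coe_finset, Finset.card_image_of_injective, signedCount_eq]
  rintro ⟨i, a⟩ ⟨j, b⟩ h
  have h1 := congrFun h i
  simp only [Pi.single_eq_same, Pi.single_apply] at h1
  by_cases e : i = j
  · subst e
    rw [if_pos rfl] at h1
    rw [unit_cast_inj h1]
  · rw [if_neg e] at h1
    exact absurd h1 (unit_cast_ne_zero a)

theorem longRoots_disjoint_shortRoots : Disjoint (longRoots n) (shortRoots n) := by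
  rw [Set.disjoint_left]
  rintro α ⟨i, j, hij, a, b, rfl⟩ ⟨l, u, h⟩
  have h1 := congrFun h i
  have h2 := congrFun h j
  simp only [Pi.add_apply, Pi.single_eq_same, Pi.single_eq_of_ne hij,
    Pi.single_eq_of_ne hij.symm, add_zero, zero_add] at h1 h2
  simp only [Pi.single_apply] at h1 h2
  by_cases e : i = l
  · subst e
    rw [if_neg hij.symm] at h2
    exact unit_cast_ne_zero b h2
  · rw [if_neg e] at h1
    exact unit_cast_ne_zero a h1

theorem longRoots_finite : (longRoots n).Finite := by
  refine (Set.finite_range (pairRoot (n := n))).subset ?_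
  rintro α ⟨i, j, hij, a, b, rfl⟩
  exact ⟨((i, a), (j, b)), rfl⟩

theorem shortRoots_finite : (shortRoots n).Finite := by
  refine (Set.finite_range
    (fun p : Fin n × ℤˣ => (Pi.single p.1 ((p.2 : ℤ) : ℝ) : Fin n → ℝ))).subset ?_
  rintro α ⟨i, a, rfl⟩
  exact ⟨(i, a), rfl⟩

theorem ncard_zeroRoots :
    {α ∈ longRoots n ∪ shortRoots n | α ⬝ᵥ c = 0}.ncard =
      {α ∈ longRoots n | α ⬝ᵥ c = 0}.ncard + {α ∈ shortRoots n | α ⬝ᵥ c = 0}.ncard := by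
  rw [← Set.ncard_union_eq
    (longRoots_disjoint_shortRoots.mono (fun _ h => h.1) (fun _ h => h.1))
    (longRoots_finite.subset fun _ h => h.1) (shortRoots_finite.subset fun _ h => h.1)]
  congr 1
  ext α
  simp only [Set.mem_union, Set.mem_ofPred_eq]
  tauto

/-- Pairs of signed coordinates with sum `y k`. -/
theorem card_pairs (hk : k ≠ 0) (y : ℝ) :
    (Finset.univ.filter fun x : (Fin n × ℤˣ) × (Fin n × ℤˣ) =>
        signedCoord c x.1 + signedCoord c x.2 = y * k).card =
      ∑ p : Fin n × ℤˣ, signedCount k c (signedCoord c p / k + y) := by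
  -- Negating the first coordinate turns the condition on the sum into one on the difference.
  rw [Finset.card_filter, Fintype.sum_prod_type, ← Equiv.sum_comp negIndex]
  refine Finset.sum_congr rfl fun p _ => ?_
  rw [← Finset.card_filter, signedCount_eq]
  congr 1
  ext p'
  simp only [Finset.mem_filter, Finset.mem_univ, true_and, signedCoord_negIndex]
  rw [add_mul, div_mul_cancel₀ _ hk]
  constructor <;> intro h <;> linarith

/-- Two signed coordinates with the same index are equal, with sum `2 p`, or opposite, with sum `0`;
there are `2 n` opposite pairs. -/
theorem card_pairs_split (y : ℝ) :
    (Finset.univ.filter fun x : (Fin n × ℤˣ) × (Fin n × ℤˣ) =>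
        signedCoord c x.1 + signedCoord c x.2 = y).card =
    (Finset.univ.filter fun x : (Fin n × ℤˣ) × (Fin n × ℤˣ) =>
        x.1.1 ≠ x.2.1 ∧ signedCoord c x.1 + signedCoord c x.2 = y).card +
    ((Finset.univ.filter fun p : Fin n × ℤˣ => 2 * signedCoord c p = y).card +
      if y = 0 then 2 * n else 0) := by
  classical
  have hdiag : (Finset.univ.filter fun x : (Fin n × ℤˣ) × (Fin n × ℤˣ) =>
      x.1.1 = x.2.1 ∧ signedCoord c x.1 + signedCoord c x.2 = y) =
      (Finset.univ.filter fun p : Fin n × ℤˣ => 2 * signedCoord c p = y).image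
        (fun p => (p, p)) ∪
      (Finset.univ.filter fun _ : Fin n × ℤˣ => y = 0).image (fun p => (p, negIndex p)) := by
    ext ⟨⟨i, a⟩, ⟨j, b⟩⟩
    rw [Finset.mem_filter, Finset.mem_union, Finset.mem_image, Finset.mem_image]
    simp only [Finset.mem_filter, Finset.mem_univ, true_and,
      Prod.mk.injEq, negIndex, Equiv.prodCongr_apply, Prod.map, Equiv.refl_apply, Equiv.neg_apply]
    simp only [signedCoord]
    constructor
    · rintro ⟨rfl, h⟩
      obtain rfl | rfl : b = a ∨ b = -a := by
        obtain rfl | rfl := Int.units_eq_one_or a <;> obtain rfl | rfl := Int.units_eq_one_or b <;>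
          simp
      · exact Or.inl ⟨(i, b), by linarith, rfl, rfl⟩
      · refine Or.inr ⟨(i, a), ?_, rfl, rfl, rfl⟩
        rw [← h]
        push_cast
        ring
    · rintro (⟨p, h, h1, h2⟩ | ⟨p, rfl, h1, h2, h3⟩)
      · have h3 := h1.symm.trans h2
        simp only [Prod.mk.injEq] at h3
        subst h1
        obtain ⟨rfl, rfl⟩ := h3
        exact ⟨rfl, by linarith⟩
      · subst h1 h2 h3
        refine ⟨rfl, ?_⟩
        push_cast
        ring
  have hcard : (Finset.univ.filter fun x : (Fin n × ℤˣ) × (Fin n × ℤˣ) =>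
      x.1.1 = x.2.1 ∧ signedCoord c x.1 + signedCoord c x.2 = y).card =
      (Finset.univ.filter fun p : Fin n × ℤˣ => 2 * signedCoord c p = y).card +
        if y = 0 then 2 * n else 0 := by
    rw [hdiag, Finset.card_union_of_disjoint, Finset.card_image_of_injective,
      Finset.card_image_of_injective]
    · congr 1
      split_ifs with hy
      · simp [hy, mul_comm]
      · simp [hy]
    · intro p p' h
      exact (Prod.mk.inj h).1
    · intro p p' h
      exact (Prod.mk.inj h).1
    · rw [Finset.disjoint_left]
      rintro ⟨p, p'⟩ h1 h2
      simp only [Finset.mem_image, Prod.mk.injEq] at h1 h2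
      obtain ⟨r, -, rfl, rfl⟩ := h1
      obtain ⟨r', -, rfl, h⟩ := h2
      have h' : -r'.2 = r'.2 := congrArg Prod.snd h
      obtain hu | hu := Int.units_eq_one_or r'.2 <;> rw [hu] at h' <;> revert h' <;> decide
  rw [← hcard, ← Finset.card_union_of_disjoint]
  · congr 1
    ext x
    simp only [Finset.mem_filter, Finset.mem_univ, true_and, Finset.mem_union]
    tauto
  · rw [Finset.disjoint_left]
    intro x h1 h2
    simp only [Finset.mem_filter] at h1 h2
    exact h1.2.1 h2.2.1

/-- The residual equation, doubled. The `2 n` opposite pairs removed from the roots vanishing at `c`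
cancel the `n` of the definition. -/
theorem IsResidualPoint.signedCount_eq {m : ℝ} (hk : k ≠ 0)
    (hc : IsResidualPoint k (m * k) c) :
    ∑ p : Fin n × ℤˣ, signedCount k c (signedCoord c p / k) +
        signedCount k c 0 + signedCount k c (1 / 2) =
      ∑ p : Fin n × ℤˣ, signedCount k c (signedCoord c p / k + 1) + 2 * signedCount k c m := by
  rw [IsResidualPoint, ncard_zeroRoots, ncard_shortRoots] at hc
  have h0 := ncard_shortRoots (k := k) c 0
  rw [zero_mul] at h0
  rw [h0] at hc
  have a1 := two_mul_ncard_longRoots c k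
  have a2 := two_mul_ncard_longRoots c 0
  have b1 := card_pairs c hk 1
  have b2 := card_pairs c hk 0
  rw [one_mul, card_pairs_split, ← a1, if_neg hk] at b1
  rw [zero_mul, card_pairs_split, ← a2, if_pos rfl] at b2
  simp only [add_zero] at b2
  have c1 : (Finset.univ.filter fun p : Fin n × ℤˣ => 2 * signedCoord c p = k).card =
      signedCount k c (1 / 2) := by
    rw [TypeB.signedCount_eq]
    congr 1
    ext p
    simp only [Finset.mem_filter, Finset.mem_univ, true_and]
    constructor <;> intro h <;> linarith
  have c2 : (Finset.univ.filter fun p : Fin n × ℤˣ => 2 * signedCoord c p = 0).card =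
      signedCount k c 0 := by
    rw [TypeB.signedCount_eq]
    congr 1
    ext p
    simp only [Finset.mem_filter, Finset.mem_univ, true_and]
    constructor <;> intro h <;> linarith
  rw [c1] at b1
  rw [c2] at b2
  omega

end Counting

/-! ### The structure of residual points -/

section Structure

variable {n : ℕ} {k : ℝ} (c : Fin n → ℝ)

/-- Expand the square. The sums of `f x ^ 2` and `f (x + 1) ^ 2` agree because `S` contains the
support of `f` and its translate by `-1`. -/
theorem IsResidualPoint.sum_sq_eq {m : ℝ} (hk : k ≠ 0) (hc : IsResidualPoint k (m * k) c)
    {S : Finset ℝ} (hS : signedValues k c ⊆ S)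
    (hS' : (signedValues k c).image (fun x => x - 1) ⊆ S) :
    ∑ x ∈ S, ((signedCount k c x : ℤ) - signedCount k c (x + 1)) ^ 2 =
      4 * signedCount k c m - 2 * signedCount k c 0 - 2 * signedCount k c (1 / 2) := by
  have h := hc.signedCount_eq c hk
  have h1 := sum_signedCoord c hk (fun x => (signedCount k c x : ℤ)) hS
  have h2 := sum_signedCoord c hk (fun x => (signedCount k c (x + 1) : ℤ)) hS
  have h3 : ∑ x ∈ S, (signedCount k c (x + 1) : ℤ) ^ 2 = ∑ x ∈ S, (signedCount k c x : ℤ) ^ 2 := by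
    rw [← Finset.sum_subset hS (f := fun x => (signedCount k c x : ℤ) ^ 2)]
    · have : ∑ x ∈ S, (signedCount k c (x + 1) : ℤ) ^ 2 =
          ∑ x ∈ S.image (fun x => x + 1), (signedCount k c x : ℤ) ^ 2 := by
        rw [Finset.sum_image]
        intro x _ y _ hxy
        exact add_right_cancel hxy
      rw [this]
      symm
      refine Finset.sum_subset ?_ ?_
      · intro x hx
        exact Finset.mem_image.2 ⟨x - 1, hS' (Finset.mem_image_of_mem _ hx), by ring⟩
      · intro x _ hx
        rw [signedCount_eq_zero c hk hx]
        simp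
    · intro x _ hx
      rw [signedCount_eq_zero c hk hx]
      simp
  have h4 : ∑ x ∈ S, ((signedCount k c x : ℤ) - signedCount k c (x + 1)) ^ 2 =
      2 * ∑ x ∈ S, (signedCount k c x : ℤ) * signedCount k c x -
        2 * ∑ x ∈ S, (signedCount k c x : ℤ) * signedCount k c (x + 1) := by
    have : ∀ x ∈ S, ((signedCount k c x : ℤ) - signedCount k c (x + 1)) ^ 2 =
        (signedCount k c x : ℤ) ^ 2 + (signedCount k c (x + 1) : ℤ) ^ 2 -
          2 * ((signedCount k c x : ℤ) * signedCount k c (x + 1)) := fun x _ => by ring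
    rw [Finset.sum_congr rfl this, Finset.sum_sub_distrib, Finset.sum_add_distrib, h3,
      ← Finset.mul_sum]
    have : ∑ x ∈ S, (signedCount k c x : ℤ) ^ 2 =
      ∑ x ∈ S, (signedCount k c x : ℤ) * signedCount k c x :=
        Finset.sum_congr rfl fun x _ => by ring
    rw [this]
    ring
  rw [h4, ← h1, ← h2]
  have h5 : ((∑ p : Fin n × ℤˣ, signedCount k c (signedCoord c p / k) +
      signedCount k c 0 + signedCount k c (1 / 2) : ℕ) : ℤ) =
      ((∑ p : Fin n × ℤˣ, signedCount k c (signedCoord c p / k + 1) +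
        2 * signedCount k c m : ℕ) : ℤ) := by rw [h]
  push_cast at h5
  linarith

theorem exists_bound_signedCount (hk : k ≠ 0) :
    ∃ B : ℝ, ∀ x, B ≤ x → signedCount k c x = 0 := by
  obtain ⟨M, hM⟩ := (signedValues k c).bddAbove
  refine ⟨M + 1, fun x hx => signedCount_eq_zero c hk fun hx' => ?_⟩
  have := hM (Finset.mem_coe.2 hx')
  linarith

theorem sum_Ico_sub_succ (F : ℕ → ℤ) {a b : ℕ} (hab : a ≤ b) :
    ∑ i ∈ Finset.Ico a b, (F i - F (i + 1)) = F a - F b := by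
  induction b, hab using Nat.le_induction with
  | base => simp
  | succ b hab ih =>
    rw [Finset.sum_Ico_succ_top hab, ih]
    ring

/-- Put `g a = F a - F (a + 1)`. The reflection `x ↦ -x - 1` makes each `g a ^ 2` with `a ≥ s` occur
twice, and `F q = ∑ g a` over `a ≥ q`, `F s - F q = ∑ g a` over `s ≤ a < q`. So `sum_sq_eq` says
that `∑ (g² - g)` over `a ≥ q`, `∑ (g² + g)` over `s ≤ a < q`, half of the other squares and `f ((1
- s) / 2)` add up to `0`. All of these are nonnegative, hence zero. -/
theorem IsResidualPoint.signedCount_structure {q s : ℕ} (hs : s ≤ 1) (hsq : s ≤ q) (hk : k ≠ 0)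
    (hc : IsResidualPoint k (((q : ℝ) - s / 2) * k) c) :
    (∀ x : ℝ, (∀ z : ℤ, x ≠ z - (s : ℝ) / 2) → signedCount k c x = 0) ∧
    (∀ a : ℕ, q ≤ a → signedCount k c (a - (s : ℝ) / 2) = signedCount k c ((a + 1 : ℕ) - (s : ℝ) / 2) ∨
      signedCount k c (a - (s : ℝ) / 2) = signedCount k c ((a + 1 : ℕ) - (s : ℝ) / 2) + 1) ∧
    (∀ a : ℕ, s ≤ a → a < q →
      signedCount k c (a - (s : ℝ) / 2) = signedCount k c ((a + 1 : ℕ) - (s : ℝ) / 2) ∨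
      signedCount k c (a - (s : ℝ) / 2) + 1 = signedCount k c ((a + 1 : ℕ) - (s : ℝ) / 2)) := by
  classical
  set f : ℝ → ℤ := fun x => (signedCount k c x : ℤ) with hf
  set F : ℕ → ℤ := fun a => f (a - (s : ℝ) / 2) with hF
  have hs1 : (s : ℝ) ≤ 1 := by exact_mod_cast hs
  have hs0 : (0 : ℝ) ≤ s := Nat.cast_nonneg s
  obtain ⟨M, hM⟩ := exists_bound_signedCount c hk
  set B : ℕ := ⌈M⌉₊ + 1 + q with hB
  have hFB : ∀ a, B ≤ a → F a = 0 := by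
    intro a ha
    have h1 : (B : ℝ) ≤ a := Nat.cast_le.2 ha
    have h2 := Nat.le_ceil M
    have h3 : (0 : ℝ) ≤ q := Nat.cast_nonneg q
    simp only [hF, hf]
    rw [hM, Nat.cast_zero]
    rw [hB] at h1
    push_cast at h1
    linarith
  set Tp : Finset ℝ := (Finset.Ico s B).image fun a : ℕ => (a : ℝ) - (s : ℝ) / 2 with hTp
  set Tm : Finset ℝ := (Finset.Ico s B).image fun a : ℕ => -((a : ℝ) - (s : ℝ) / 2) - 1 with hTm
  set S : Finset ℝ :=
    signedValues k c ∪ (signedValues k c).image (fun x => x - 1) ∪ (Tp ∪ Tm) with hSdef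
  have hsum := hc.sum_sq_eq c hk (S := S)
    (fun x hx => by simp [hSdef, hx])
    (fun x hx => by
      rw [hSdef, Finset.mem_union, Finset.mem_union]
      exact Or.inl (Or.inr hx))
  have hTS : Tp ∪ Tm ⊆ S := Finset.subset_union_right
  rw [← Finset.sum_sdiff hTS, Finset.sum_union, hTp, hTm, Finset.sum_image,
    Finset.sum_image] at hsum
  rotate_left
  · intro a _ b _ hab
    simp only at hab
    have : (a : ℝ) = b := by linarith
    exact_mod_cast this
  · intro a _ b _ hab
    simp only at hab
    have : (a : ℝ) = b := by linarith
    exact_mod_cast this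
  · rw [Finset.disjoint_left]
    intro x h1 h2
    obtain ⟨a, ha, rfl⟩ := Finset.mem_image.1 h1
    obtain ⟨b, hb, hab⟩ := Finset.mem_image.1 h2
    have ha' : (s : ℝ) ≤ a := Nat.cast_le.2 (Finset.mem_Ico.1 ha).1
    have hb' : (s : ℝ) ≤ b := Nat.cast_le.2 (Finset.mem_Ico.1 hb).1
    linarith
  have e1 : ∀ a : ℕ, ((signedCount k c ((a : ℝ) - (s : ℝ) / 2) : ℤ) -
      signedCount k c ((a : ℝ) - (s : ℝ) / 2 + 1)) ^ 2 = (F a - F (a + 1)) ^ 2 := by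
    intro a
    rw [show (a : ℝ) - (s : ℝ) / 2 + 1 = ((a + 1 : ℕ) : ℝ) - (s : ℝ) / 2 by push_cast; ring]
  have e2 : ∀ a : ℕ, ((signedCount k c (-((a : ℝ) - (s : ℝ) / 2) - 1) : ℤ) -
      signedCount k c (-((a : ℝ) - (s : ℝ) / 2) - 1 + 1)) ^ 2 = (F a - F (a + 1)) ^ 2 := by
    intro a
    rw [show -((a : ℝ) - (s : ℝ) / 2) - 1 + 1 = -((a : ℝ) - (s : ℝ) / 2) by ring,
      show -((a : ℝ) - (s : ℝ) / 2) - 1 = -(((a + 1 : ℕ) : ℝ) - (s : ℝ) / 2) by push_cast; ring,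
      signedCount_neg, signedCount_neg]
    simp only [hF, hf]
    ring
  simp only [e1, e2] at hsum
  have hqB : q ≤ B := by omega
  have t1 := sum_Ico_sub_succ F hqB
  have t2 := sum_Ico_sub_succ F (hsq.trans hqB)
  rw [hFB B le_rfl, sub_zero] at t1 t2
  have hm : (signedCount k c ((q : ℝ) - (s : ℝ) / 2) : ℤ) = F q := rfl
  -- One of `0`, `1/2` is the lattice point `s - s / 2`; the other is `(1 - s) / 2`, whose count
  -- only has to be nonnegative.
  have hother : (signedCount k c 0 : ℤ) + signedCount k c (1 / 2) =
      F s + f ((1 - (s : ℝ)) / 2) := by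
    simp only [hF, hf]
    obtain rfl | rfl : s = 0 ∨ s = 1 := by omega
    · norm_num
    · norm_num
      ring
  rw [hm] at hsum
  rw [← Finset.sum_Ico_consecutive _ hsq hqB] at hsum t2
  have u1 : ∑ a ∈ Finset.Ico q B, ((F a - F (a + 1)) ^ 2 - (F a - F (a + 1))) =
      ∑ a ∈ Finset.Ico q B, (F a - F (a + 1)) ^ 2 - F q := by
    rw [Finset.sum_sub_distrib, t1]
  have u2 : ∑ a ∈ Finset.Ico s q, ((F a - F (a + 1)) ^ 2 + (F a - F (a + 1))) =
      ∑ a ∈ Finset.Ico s q, (F a - F (a + 1)) ^ 2 + (F s - F q) := by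
    rw [Finset.sum_add_distrib]
    linarith
  have n1 : ∀ a ∈ Finset.Ico q B, 0 ≤ (F a - F (a + 1)) ^ 2 - (F a - F (a + 1)) := by
    intro a _
    generalize F a - F (a + 1) = x
    obtain h | h : x ≤ 0 ∨ 1 ≤ x := by omega
    · nlinarith
    · nlinarith
  have n2 : ∀ a ∈ Finset.Ico s q, 0 ≤ (F a - F (a + 1)) ^ 2 + (F a - F (a + 1)) := by
    intro a _
    generalize F a - F (a + 1) = x
    obtain h | h : x ≤ -1 ∨ 0 ≤ x := by omega
    · nlinarith
    · nlinarith
  have n3 : ∀ x ∈ S \ (Tp ∪ Tm),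
      (0 : ℤ) ≤ ((signedCount k c x : ℤ) - signedCount k c (x + 1)) ^ 2 := fun x _ => sq_nonneg _
  have n4 : 0 ≤ f ((1 - (s : ℝ)) / 2) := Nat.cast_nonneg _
  have p1 := Finset.sum_nonneg n1
  have p2 := Finset.sum_nonneg n2
  have p3 := Finset.sum_nonneg n3
  rw [hTp, hTm] at p3
  have z1 : ∑ a ∈ Finset.Ico q B, ((F a - F (a + 1)) ^ 2 - (F a - F (a + 1))) = 0 := by linarith
  have z2 : ∑ a ∈ Finset.Ico s q, ((F a - F (a + 1)) ^ 2 + (F a - F (a + 1))) = 0 := by linarith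
  have z3 : ∑ x ∈ S \ (Tp ∪ Tm),
      ((signedCount k c x : ℤ) - signedCount k c (x + 1)) ^ 2 = 0 := by
    rw [hTp, hTm]
    linarith
  rw [Finset.sum_eq_zero_iff_of_nonneg n1] at z1
  rw [Finset.sum_eq_zero_iff_of_nonneg n2] at z2
  rw [Finset.sum_eq_zero_iff_of_nonneg n3] at z3
  refine ⟨fun x hx => ?_, fun a ha => ?_, fun a ha haq => ?_⟩
  -- Off the lattice all differences vanish, so the count is constant along `x, x + 1, …`, where it
  -- is eventually `0`.
  · have step : ∀ y : ℝ, (∀ z : ℤ, y ≠ z - (s : ℝ) / 2) →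
        signedCount k c y = signedCount k c (y + 1) := by
      intro y hy
      by_cases hyS : y ∈ S
      · have hyT : y ∉ Tp ∪ Tm := by
          rw [Finset.mem_union, not_or, hTp, hTm, Finset.mem_image, Finset.mem_image]
          constructor
          · rintro ⟨a, -, rfl⟩
            exact hy a (by simp)
          · rintro ⟨a, -, rfl⟩
            refine hy (s - a - 1) ?_
            push_cast
            ring
        have := z3 y (Finset.mem_sdiff.2 ⟨hyS, hyT⟩)
        have := pow_eq_zero_iff (two_ne_zero) |>.1 this
        omega
      · rw [hSdef, Finset.mem_union, Finset.mem_union, not_or, not_or] at hyS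
        rw [signedCount_eq_zero c hk hyS.1.1, signedCount_eq_zero c hk]
        intro h
        exact hyS.1.2 (Finset.mem_image.2 ⟨y + 1, h, by ring⟩)
    have steps : ∀ d : ℕ, signedCount k c x = signedCount k c (x + d) := by
      intro d
      induction d with
      | zero => simp
      | succ d ih =>
        rw [ih, step, Nat.cast_succ, add_assoc]
        intro z hz
        apply hx (z - d)
        push_cast
        linarith
    rw [steps ⌈M - x⌉₊, hM]
    have := Nat.le_ceil (M - x)
    linarith
  · by_cases haB : a < B
    · have := z1 a (Finset.mem_Ico.2 ⟨ha, haB⟩)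
      have h : (F a - F (a + 1)) * (F a - F (a + 1) - 1) = 0 := by linarith
      simp only [hF, hf] at h
      obtain h | h := mul_eq_zero.1 h <;> omega
    · have h1 := hFB a (by omega)
      have h2 := hFB (a + 1) (by omega)
      simp only [hF, hf] at h1 h2
      omega
  · have := z2 a (Finset.mem_Ico.2 ⟨ha, haq⟩)
    have h : (F a - F (a + 1)) * (F a - F (a + 1) + 1) = 0 := by linarith
    simp only [hF, hf] at h
    obtain h | h := mul_eq_zero.1 h <;> omega

end Structure

/-! ### Orbits -/

section Orbits

variable {n : ℕ} {k : ℝ} {c d : Fin n → ℝ}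

theorem mem_weylOrbit_self (c : Fin n → ℝ) : c ∈ weylOrbit c :=
  ⟨Equiv.refl _, fun _ => 1, fun i => by simp⟩

theorem signedCount_eq_of_mem_weylOrbit (h : d ∈ weylOrbit c) (x : ℝ) :
    signedCount k d x = signedCount k c x := by
  obtain ⟨σ, ε, h⟩ := h
  rw [signedCount_eq, signedCount_eq]
  refine Finset.card_equiv (Equiv.prodShear σ fun i => Equiv.mulRight (ε i)) fun p => ?_
  simp only [Finset.mem_filter, Finset.mem_univ, true_and, Equiv.prodShear_apply,
    Equiv.coe_mulRight]
  simp only [signedCoord, h]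
  push_cast
  rw [mul_assoc]

theorem weylOrbit_subset (h : d ∈ weylOrbit c) : weylOrbit d ⊆ weylOrbit c := by
  obtain ⟨σ, ε, h⟩ := h
  rintro e ⟨τ, ε', h'⟩
  refine ⟨τ.trans σ, fun i => ε' i * ε (τ i), fun i => ?_⟩
  rw [h', h]
  push_cast
  rw [mul_assoc]
  rfl

/-- Equal counts give equally many coordinates of each absolute value. Matching these fibres yields
the permutation; the signs follow. -/
theorem mem_weylOrbit_of_signedCount_eq (hk : k ≠ 0)
    (h : ∀ x, signedCount k d x = signedCount k c x) : d ∈ weylOrbit c := by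
  have hmult : ∀ y : ℝ, (Finset.univ.filter fun i => |d i| = y).card =
      (Finset.univ.filter fun i => |c i| = y).card := by
    intro y
    have hk' : |k| ≠ 0 := abs_ne_zero.2 hk
    obtain hy | rfl | hy := lt_trichotomy y 0
    · rw [Finset.filter_false_of_mem, Finset.filter_false_of_mem]
      · intro i _ hi
        linarith [abs_nonneg (c i)]
      · intro i _ hi
        linarith [abs_nonneg (d i)]
    · have h0 := h 0
      rw [signedCount_zero, signedCount_zero, mult_eq_card, mult_eq_card, zero_mul] at h0
      omega
    · have hpos : 0 < y / |k| := div_pos hy (abs_pos.2 hk)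
      have h1 := h (y / |k|)
      rw [signedCount_eq_mult _ hk hpos, signedCount_eq_mult _ hk hpos, mult_eq_card,
        mult_eq_card, div_mul_cancel₀ _ hk'] at h1
      exact h1
  have key : ∃ σ : Equiv.Perm (Fin n), ∀ i, |d i| = |c (σ i)| := by
    have e : ∀ y : ℝ, Nonempty ({i // |d i| = y} ≃ {i // |c i| = y}) := fun y => by
      rw [← Fintype.card_eq, Fintype.card_subtype, Fintype.card_subtype]
      exact hmult y
    refine ⟨(Equiv.sigmaFiberEquiv fun i => |d i|).symm.trans
      ((Equiv.sigmaCongrRight fun y => (e y).some).trans (Equiv.sigmaFiberEquiv fun i => |c i|)), fun i => ?_⟩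
    exact ((e |d i|).some ⟨i, rfl⟩).2.symm
  obtain ⟨σ, hσ⟩ := key
  have : ∀ i, ∃ u : ℤˣ, d i = ((u : ℤ) : ℝ) * c (σ i) := by
    intro i
    obtain h | h := abs_eq_abs.1 (hσ i)
    · exact ⟨1, by simp [h]⟩
    · exact ⟨-1, by simp [h]⟩
  choose ε hε using this
  exact ⟨σ, ε, hε⟩

theorem weylOrbit_eq_iff (hk : k ≠ 0) :
    weylOrbit d = weylOrbit c ↔ ∀ x, signedCount k d x = signedCount k c x := by
  constructor
  · intro h
    exact signedCount_eq_of_mem_weylOrbit (h ▸ mem_weylOrbit_self d)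
  · intro h
    exact (weylOrbit_subset (mem_weylOrbit_of_signedCount_eq hk h)).antisymm
      (weylOrbit_subset (mem_weylOrbit_of_signedCount_eq hk fun x => (h x).symm))

end Orbits

/-! ### Diagonals of a diagram -/

/-- The number of boxes with content `d`. -/
def diagCount (lam : YoungDiagram) (d : ℤ) : ℕ := (lam.cells.filter fun b => content b = d).card

theorem card_filter_tableauPoint {n : ℕ} (lam : YoungDiagram) (h : lam.card = n) (k₁ k₂ : ℝ)
    (p : ℝ → Prop) [DecidablePred p] :
    (Finset.univ.filter fun i => p (tableauPoint lam h k₁ k₂ i)).card =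
      (lam.cells.filter fun b => p ((content b : ℝ) * k₁ + k₂)).card := by
  refine Finset.card_bij (fun i _ => ((lam.cells.equivFinOfCardEq h).symm i : ℕ × ℕ)) ?_ ?_ ?_
  · intro i hi
    rw [Finset.mem_filter] at hi ⊢
    exact ⟨((lam.cells.equivFinOfCardEq h).symm i).2, hi.2⟩
  · intro i _ j _ hij
    exact (lam.cells.equivFinOfCardEq h).symm.injective (Subtype.ext hij)
  · intro b hb
    rw [Finset.mem_filter] at hb
    refine ⟨lam.cells.equivFinOfCardEq h ⟨b, hb.1⟩, ?_, by simp⟩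
    rw [Finset.mem_filter]
    refine ⟨Finset.mem_univ _, ?_⟩
    simpa [tableauPoint] using hb.2

theorem signedCount_tableauPoint {n : ℕ} (lam : YoungDiagram) (h : lam.card = n) {k : ℝ}
    (hk : k ≠ 0) (m x : ℝ) :
    signedCount k (tableauPoint lam h k (m * k)) x =
      (lam.cells.filter fun b => (content b : ℝ) + m = x).card +
        (lam.cells.filter fun b => (content b : ℝ) + m = -x).card := by
  rw [signedCount_eq_add, card_filter_tableauPoint lam h k (m * k) (fun y => y = x * k),
    card_filter_tableauPoint lam h k (m * k) (fun y => y = -x * k)]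
  simp only [← add_mul]
  simp only [mul_left_inj' hk]

theorem signedCount_tableauPoint_eq_diagCount {n : ℕ} (lam : YoungDiagram) (h : lam.card = n)
    {k : ℝ} (hk : k ≠ 0) (q s a : ℤ) :
    signedCount k (tableauPoint lam h k (((q : ℝ) - s / 2) * k)) (a - (s : ℝ) / 2) =
      diagCount lam (a - q) + diagCount lam (s - a - q) := by
  rw [signedCount_tableauPoint lam h hk, diagCount, diagCount]
  congr 2
  · ext b
    simp only [Finset.mem_filter, and_congr_right_iff]
    intro _
    rw [← Int.cast_inj (α := ℝ)]
    push_cast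
    constructor <;> intro h <;> linarith
  · ext b
    simp only [Finset.mem_filter, and_congr_right_iff]
    intro _
    rw [← Int.cast_inj (α := ℝ)]
    push_cast
    constructor <;> intro h <;> linarith

theorem signedCount_tableauPoint_eq_zero {n : ℕ} (lam : YoungDiagram) (h : lam.card = n)
    {k : ℝ} (hk : k ≠ 0) (q s : ℤ) {x : ℝ} (hx : ∀ z : ℤ, x ≠ z - (s : ℝ) / 2) :
    signedCount k (tableauPoint lam h k (((q : ℝ) - s / 2) * k)) x = 0 := by
  rw [signedCount_tableauPoint lam h hk, Finset.filter_false_of_mem, Finset.filter_false_of_mem]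
  · rfl
  · intro b _ hb
    apply hx (s - q - content b)
    push_cast
    linarith
  · intro b _ hb
    apply hx (q + content b)
    push_cast
    linarith

/-- A row `i ≥ -d` meets the diagonal `d` once if it ends at content at least `d`, and otherwise not
at all. Rows `i < -d` always end at content at least `d` and account for the maximum. -/
theorem diagCount_add (lam : YoungDiagram) {d : ℤ} {K : ℕ} (hK : lam.colLen 0 ≤ K)
    (hd : -d ≤ K) :
    (diagCount lam d : ℤ) + max 0 (-d) =
      ((Finset.range K).filter fun i : ℕ => d ≤ (lam.rowLen i : ℤ) - 1 - i).card := by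
  have h1 : diagCount lam d = ((Finset.range K).filter fun i : ℕ =>
      -d ≤ i ∧ d ≤ (lam.rowLen i : ℤ) - 1 - i).card := by
    refine Finset.card_bij (fun b _ => b.1) ?_ ?_ ?_
    · rintro ⟨i, j⟩ hb
      rw [Finset.mem_filter, YoungDiagram.mem_cells, content] at hb
      have h2 := YoungDiagram.mem_iff_lt_rowLen.1 hb.1
      have h3 := YoungDiagram.mem_iff_lt_colLen.1 (lam.up_left_mem le_rfl (Nat.zero_le j) hb.1)
      have h4 := hb.2
      simp only at h4
      rw [Finset.mem_filter, Finset.mem_range]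
      simp only
      omega
    · rintro ⟨i, j⟩ hb ⟨i', j'⟩ hb' heq
      rw [Finset.mem_filter, content] at hb hb'
      have h4 := hb.2
      have h5 := hb'.2
      simp only at h4 h5 heq
      rw [Prod.mk.injEq]
      omega
    · intro i hi
      rw [Finset.mem_filter] at hi
      refine ⟨(i, (i + d).toNat), ?_, rfl⟩
      rw [Finset.mem_filter, YoungDiagram.mem_cells, YoungDiagram.mem_iff_lt_rowLen, content]
      simp only
      omega
  have h2 : ((Finset.range K).filter fun i : ℕ => d ≤ (lam.rowLen i : ℤ) - 1 - i) =
      ((Finset.range K).filter fun i : ℕ => -d ≤ i ∧ d ≤ (lam.rowLen i : ℤ) - 1 - i) ∪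
        Finset.range (-d).toNat := by
    ext i
    simp only [Finset.mem_filter, Finset.mem_union, Finset.mem_range]
    omega
  rw [h2, Finset.card_union_of_disjoint, ← h1, Finset.card_range]
  · push_cast
    omega
  · rw [Finset.disjoint_left]
    intro i hi hi'
    simp only [Finset.mem_filter, Finset.mem_range] at hi hi'
    omega

theorem diagCount_sub (lam : YoungDiagram) (d : ℤ) [Decidable (∃ i : ℕ, (lam.rowLen i : ℤ) - 1 - i = d)] :
    (diagCount lam d : ℤ) - diagCount lam (d + 1) =
      (if ∃ i : ℕ, (lam.rowLen i : ℤ) - 1 - i = d then 1 else 0) - (if d < 0 then 1 else 0) := by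
  set K := lam.colLen 0 + d.natAbs + 1 with hK
  have h1 := diagCount_add lam (d := d) (K := K) (by omega) (by omega)
  have h2 := diagCount_add lam (d := d + 1) (K := K) (by omega) (by omega)
  have h3 : ((Finset.range K).filter fun i : ℕ => d ≤ (lam.rowLen i : ℤ) - 1 - i) =
      ((Finset.range K).filter fun i : ℕ => d + 1 ≤ (lam.rowLen i : ℤ) - 1 - i) ∪
        ((Finset.range K).filter fun i : ℕ => (lam.rowLen i : ℤ) - 1 - i = d) := by
    ext i
    simp only [Finset.mem_filter, Finset.mem_union, Finset.mem_range]
    omega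
  have h4 : ((Finset.range K).filter fun i : ℕ => (lam.rowLen i : ℤ) - 1 - i = d).card =
      if ∃ i : ℕ, (lam.rowLen i : ℤ) - 1 - i = d then 1 else 0 := by
    split_ifs with h
    · obtain ⟨i, hi⟩ := h
      rw [Finset.card_eq_one]
      refine ⟨i, ?_⟩
      ext j
      simp only [Finset.mem_filter, Finset.mem_range, Finset.mem_singleton]
      constructor
      · rintro ⟨-, hj⟩
        obtain h | h := le_total i j
        · have := lam.rowLen_anti _ _ h
          omega
        · have := lam.rowLen_anti _ _ h
          omega
      · rintro rfl
        refine ⟨?_, hi⟩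
        by_contra hlt
        have : lam.rowLen j = 0 := by
          by_contra h0
          have h1 : (j, 0) ∈ lam := YoungDiagram.mem_iff_lt_rowLen.2 (Nat.pos_of_ne_zero h0)
          have := YoungDiagram.mem_iff_lt_colLen.1 h1
          omega
        omega
    · rw [Finset.card_eq_zero, Finset.filter_eq_empty_iff]
      exact fun i _ hi => h ⟨i, hi⟩
  rw [h3, Finset.card_union_of_disjoint, h4] at h1
  · push_cast at h1
    split_ifs at h1 ⊢ <;> omega
  · rw [Finset.disjoint_left]
    intro i hi hi'
    simp only [Finset.mem_filter] at hi hi'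
    omega

/-- Every boundary step of a diagram ends a row or a column, but not both. -/
theorem exists_row_iff_not_exists_col (lam : YoungDiagram) (d : ℤ) :
    (∃ i : ℕ, (lam.rowLen i : ℤ) - 1 - i = d) ↔ ¬ ∃ j : ℕ, (j : ℤ) - lam.colLen j = d := by
  constructor
  · rintro ⟨i, hi⟩ ⟨j, hj⟩
    by_cases hb : (i, j) ∈ lam
    · have := YoungDiagram.mem_iff_lt_rowLen.1 hb
      have := YoungDiagram.mem_iff_lt_colLen.1 hb
      omega
    · have := rowLen_le_of_notMem hb
      have := colLen_le_of_notMem hb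
      omega
  · intro h
    have hex : ∃ i : ℕ, (lam.rowLen i : ℤ) - 1 - i ≤ d := by
      refine ⟨lam.rowLen 0 + d.natAbs, ?_⟩
      have := lam.rowLen_anti 0 (lam.rowLen 0 + d.natAbs) (by omega)
      omega
    -- Row `i` is the first that ends at or before the diagonal `d`. If it ends strictly before,
    -- column `d + i` has length exactly `i`.
    set i := Nat.find hex with hi
    have h1 : (lam.rowLen i : ℤ) - 1 - i ≤ d := Nat.find_spec hex
    by_contra hcon
    have h2 : (lam.rowLen i : ℤ) - 1 - i < d := lt_of_le_of_ne h1 fun h => hcon ⟨i, h⟩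
    apply h
    refine ⟨(d + i).toNat, ?_⟩
    suffices lam.colLen (d + i).toNat = i by omega
    apply le_antisymm
    · refine colLen_le_of_notMem ?_
      rw [YoungDiagram.mem_iff_lt_rowLen]
      omega
    · cases hi' : i with
      | zero => exact Nat.zero_le _
      | succ i' =>
        have h3 := Nat.find_min hex (m := i') (by omega)
        have : (i', (d + (i' + 1 : ℕ)).toNat) ∈ lam := by
          rw [YoungDiagram.mem_iff_lt_rowLen]
          push_cast
          omega
        exact YoungDiagram.mem_iff_lt_colLen.1 this

/-! ### Letters of a point -/

/-- The multiplicity of the letter `a` for the point `c`; it is `0` or `1` for residual points. -/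
def letterCount {n : ℕ} (k : ℝ) (q s : ℕ) (c : Fin n → ℝ) (a : ℕ) : ℤ :=
  signedCount k c (a - (s : ℝ) / 2) - signedCount k c ((a + 1 : ℕ) - (s : ℝ) / 2) +
    if a < q then 1 else 0

open Classical in
-- The value `a - s / 2` comes from the diagonals `a - q` and, up to sign, `s - a - q`. By
-- `diagCount_sub` the first contributes a row end minus `[a < q]`, which `letterCount` compensates.
-- The second is differenced in the opposite direction on negative diagonals and contributes `1`
-- minus a row end, that is, a column end.
theorem letterCount_tableauPoint {n : ℕ} (lam : YoungDiagram) (h : lam.card = n) {k : ℝ}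
    (hk : k ≠ 0) {q s a : ℕ} (hsq : s ≤ q) :
    letterCount k q s (tableauPoint lam h k (((q : ℝ) - s / 2) * k)) a =
      (if ∃ i : ℕ, (lam.rowLen i : ℤ) - 1 - i + q = a then 1 else 0) +
        (if ∃ j : ℕ, (lam.colLen j : ℤ) - 1 - j - q + s = a then 1 else 0) := by
  have h1 := signedCount_tableauPoint_eq_diagCount lam h hk q s a
  have h2 := signedCount_tableauPoint_eq_diagCount lam h hk q s (a + 1 : ℕ)
  simp only [Int.cast_natCast] at h1 h2
  rw [letterCount, h1, h2]
  have h3 := diagCount_sub lam (a - q)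
  have h4 := diagCount_sub lam (s - a - q - 1)
  have e1 : ((a + 1 : ℕ) : ℤ) - q = a - q + 1 := by push_cast; ring
  have e2 : (s : ℤ) - (a + 1 : ℕ) - q = s - a - q - 1 := by push_cast; ring
  rw [sub_add_cancel] at h4
  rw [e1, e2]
  have r1 : (∃ i : ℕ, (lam.rowLen i : ℤ) - 1 - i + q = a) ↔
      ∃ i : ℕ, (lam.rowLen i : ℤ) - 1 - i = a - q :=
    exists_congr fun i => by omega
  have r2 : (∃ j : ℕ, (lam.colLen j : ℤ) - 1 - j - q + s = a) ↔
      ¬ ∃ i : ℕ, (lam.rowLen i : ℤ) - 1 - i = s - a - q - 1 := by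
    rw [exists_row_iff_not_exists_col, not_not]
    exact exists_congr fun j => by omega
  simp only [r1, r2]
  push_cast
  split_ifs at h3 h4 ⊢ <;> omega

/-- Whichever end is cut first, `row_lt` or `col_lt` puts the other strictly below it. -/
theorem HasWord.row_ne_col {lam : YoungDiagram} {q : ℤ} {s h v : ℕ} {w : List (Bool × ℕ)}
    (hw : HasWord lam q s h v w) (hj : IsJumpWord s w) {a : ℕ} (hsa : s ≤ a) {i j : ℕ}
    (hi : h ≤ i) (hv : v ≤ j) (hr : (lam.rowLen i : ℤ) - 1 - i + q = a) :
    (lam.colLen j : ℤ) - 1 - j - q + s ≠ a := by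
  induction w generalizing h v with
  | nil =>
    have := rowLen_le_of_notMem hw.2
    have := hw.1
    have := lam.rowLen_anti _ _ hi
    omega
  | cons p w ih =>
    obtain ⟨_ | _, l⟩ := p
    · obtain ⟨h1, h2⟩ := hw
      obtain rfl | hlt := eq_or_lt_of_le hv
      · have := h2.row_lt hj.2.1
        have := lam.rowLen_anti _ _ hi
        omega
      · exact ih h2 hj.2.2 hi hlt
    · obtain ⟨h1, h2⟩ := hw
      obtain rfl | hlt := eq_or_lt_of_le hi
      · have := h2.col_lt hj.1 (by omega)
        have := lam.colLen_anti _ _ hv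
        omega
      · exact ih h2 hj.2 hlt hv

/-- Letter counts fix consecutive differences, and the counts vanish far out, so descending from
there recovers them; negative arguments follow by symmetry. -/
theorem signedCount_eq_of_letterCount_eq {n : ℕ} {k : ℝ} (hk : k ≠ 0) {q s : ℕ}
    (hs : s ≤ 1) {c d : Fin n → ℝ}
    (hc : ∀ x : ℝ, (∀ z : ℤ, x ≠ z - (s : ℝ) / 2) → signedCount k c x = 0)
    (hd : ∀ x : ℝ, (∀ z : ℤ, x ≠ z - (s : ℝ) / 2) → signedCount k d x = 0)
    (h : ∀ a, s ≤ a → letterCount k q s d a = letterCount k q s c a) (x : ℝ) :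
    signedCount k d x = signedCount k c x := by
  obtain ⟨B, hB⟩ := exists_bound_signedCount c hk
  obtain ⟨B', hB'⟩ := exists_bound_signedCount d hk
  have hs1 : (s : ℝ) ≤ 1 := by exact_mod_cast hs
  have key : ∀ a : ℕ, s ≤ a →
      signedCount k d (a - (s : ℝ) / 2) = signedCount k c (a - (s : ℝ) / 2) := by
    intro a ha
    obtain ⟨T, hT1, hT2⟩ : ∃ T : ℕ, a ≤ T ∧
        signedCount k d (T - (s : ℝ) / 2) = signedCount k c (T - (s : ℝ) / 2) := by
      refine ⟨a + ⌈B⌉₊ + ⌈B'⌉₊ + 1, by omega, ?_⟩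
      have h1 := Nat.le_ceil B
      have h2 := Nat.le_ceil B'
      have h3 : (0 : ℝ) ≤ a := Nat.cast_nonneg a
      have h4 : (0 : ℝ) ≤ ⌈B⌉₊ := Nat.cast_nonneg _
      have h5 : (0 : ℝ) ≤ ⌈B'⌉₊ := Nat.cast_nonneg _
      rw [hB, hB'] <;> push_cast <;> linarith
    induction T, hT1 using Nat.le_induction with
    | base => exact hT2
    | succ T hT ih =>
      refine ih ?_
      have := h T (ha.trans hT)
      simp only [letterCount] at this
      omega
  by_cases hx : ∃ z : ℤ, x = z - (s : ℝ) / 2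
  · obtain ⟨z, rfl⟩ := hx
    by_cases hz : (s : ℤ) ≤ z
    · obtain ⟨a, rfl⟩ := Int.eq_ofNat_of_zero_le ((Int.natCast_nonneg s).trans hz)
      exact key a (by omega)
    · obtain ⟨a, ha⟩ := Int.eq_ofNat_of_zero_le (show 0 ≤ (s : ℤ) - z by omega)
      have hz' : (z : ℝ) = s - a := by
        have : z = s - a := by omega
        rw [this]
        push_cast
        rfl
      rw [← signedCount_neg, ← signedCount_neg k c, hz',
        show -((s : ℝ) - a - s / 2) = a - (s : ℝ) / 2 by ring]
      exact key a (by omega)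
  · have hx' : ∀ z : ℤ, x ≠ z - (s : ℝ) / 2 := fun z h => hx ⟨z, h⟩
    rw [hc x hx', hd x hx']

/-! ### The jumps of a residual point -/

/-- The jump `a - s / 2` with the letter `a`. -/
def jumpEmb (s : ℕ) : ℕ ↪ ℝ := ⟨fun a => (a : ℝ) - (s : ℝ) / 2, fun a b h => by
  simpa using h⟩

theorem jumpEmb_apply (s a : ℕ) : jumpEmb s a = (a : ℝ) - (s : ℝ) / 2 := rfl

theorem ceil_abs_eq {q s : ℕ} (hs : s ≤ 1) (hsq : s ≤ q) :
    ⌈|(q : ℝ) - (s : ℝ) / 2|⌉₊ = q := by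
  have h1 : (s : ℝ) ≤ q := Nat.cast_le.2 hsq
  have h2 : (s : ℝ) ≤ 1 := by exact_mod_cast hs
  have h3 : (0 : ℝ) ≤ s := Nat.cast_nonneg s
  rw [abs_of_nonneg (by linarith)]
  apply le_antisymm
  · rw [Nat.ceil_le]
    linarith
  · by_contra hcon
    have h4 := Nat.le_ceil ((q : ℝ) - (s : ℝ) / 2)
    have h5 : (⌈(q : ℝ) - (s : ℝ) / 2⌉₊ : ℝ) + 1 ≤ q := by exact_mod_cast not_le.1 hcon
    linarith

section Jumps

variable {n : ℕ} {k : ℝ} (c : Fin n → ℝ)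

theorem IsResidualPoint.letterCount_eq {q s : ℕ} (hs : s ≤ 1) (hsq : s ≤ q) (hk : k ≠ 0)
    (hc : IsResidualPoint k (((q : ℝ) - s / 2) * k) c) {a : ℕ} (ha : s ≤ a) :
    letterCount k q s c a = 0 ∨ letterCount k q s c a = 1 := by
  obtain ⟨-, h1, h2⟩ := hc.signedCount_structure c hs hsq hk
  rw [letterCount]
  split_ifs with haq
  · have := h2 a ha haq
    omega
  · have := h1 a (by omega)
    omega

theorem mem_posJumps_iff {q s : ℕ} (hs : s ≤ 1) (hsq : s ≤ q) (hk : k ≠ 0) (l : ℝ) :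
    l ∈ posJumps k ((q : ℝ) - s / 2) c ↔
      ∃ a : ℕ, 1 ≤ a ∧ letterCount k q s c a = 1 ∧ jumpEmb s a = l := by
  have h1 : (s : ℝ) ≤ q := Nat.cast_le.2 hsq
  have h2 : (s : ℝ) ≤ 1 := by exact_mod_cast hs
  have h3 : (0 : ℝ) ≤ s := Nat.cast_nonneg s
  have habs : |(q : ℝ) - (s : ℝ) / 2| = q - (s : ℝ) / 2 := abs_of_nonneg (by linarith)
  have key : ∀ a : ℕ, 1 ≤ a → (letterCount k q s c a = 1 ↔
      (q ≤ a ∧ mult k c (a - (s : ℝ) / 2) = mult k c (a - (s : ℝ) / 2 + 1) + 1) ∨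
      (a < q ∧ mult k c (a - (s : ℝ) / 2) = mult k c (a - (s : ℝ) / 2 + 1))) := by
    intro a ha
    have ha' : (1 : ℝ) ≤ a := by exact_mod_cast ha
    rw [letterCount, signedCount_eq_mult c hk (by linarith),
      signedCount_eq_mult c hk (by push_cast; linarith),
      show ((a + 1 : ℕ) : ℝ) - (s : ℝ) / 2 = a - (s : ℝ) / 2 + 1 by push_cast; ring]
    split_ifs with haq <;> omega
  rw [posJumps, Set.mem_ofPred_eq, habs]
  constructor
  · rintro ⟨hl, ⟨z, hz⟩, hM⟩
    have hz0 : 0 < (2 * (z + q) - s : ℤ) := by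
      have : (0 : ℝ) < ((2 * (z + q) - s : ℤ) : ℝ) := by
        push_cast
        linarith
      exact_mod_cast this
    obtain ⟨a, ha⟩ := Int.eq_ofNat_of_zero_le (show 0 ≤ z + q by omega)
    have ha1 : 1 ≤ a := by omega
    have hla : l = (a : ℝ) - (s : ℝ) / 2 := by
      have : (a : ℝ) = z + q := by exact_mod_cast ha.symm
      rw [this]
      linarith
    refine ⟨a, ha1, (key a ha1).2 ?_, hla.symm⟩
    subst hla
    obtain ⟨h, h'⟩ | ⟨h, h'⟩ := hM
    · refine Or.inl ⟨?_, h'⟩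
      have : (q : ℝ) ≤ a := by linarith
      exact_mod_cast this
    · refine Or.inr ⟨?_, h'⟩
      have : (a : ℝ) + 1 ≤ q := by linarith
      have : a + 1 ≤ q := by exact_mod_cast this
      omega
  · rintro ⟨a, ha, hJ, rfl⟩
    have ha' : (1 : ℝ) ≤ a := by exact_mod_cast ha
    rw [key a ha] at hJ
    rw [jumpEmb_apply]
    refine ⟨by linarith, ⟨(a : ℤ) - q, by push_cast; ring⟩, ?_⟩
    obtain ⟨h, h'⟩ | ⟨h, h'⟩ := hJ
    · refine Or.inl ⟨?_, h'⟩
      have : (q : ℝ) ≤ a := by exact_mod_cast h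
      linarith
    · refine Or.inr ⟨?_, h'⟩
      have : (a : ℝ) + 1 ≤ q := by exact_mod_cast h
      linarith

/-- The letter counts over `a ≥ s` add up to `F s + q - s`. For `s = 0`, `F 0` is even, so the
padding rule adds the letter `0` exactly when its count is `1`. For `s = 1`, the letter `0` is the
jump `-1/2`, present only for parity. The bound `r ≤ n` makes symbols of length `n` long enough. -/
theorem IsResidualPoint.exists_jumpSet {q s : ℕ} (hs : s ≤ 1) (hsq : s ≤ q) (hk : k ≠ 0)
    (hdef : defect ((q : ℝ) - s / 2) = s)
    (hc : IsResidualPoint k (((q : ℝ) - s / 2) * k) c) :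
    ∃ (J : Finset ℕ) (r : ℕ), J.card = q + 2 * r ∧ r ≤ n ∧
      (∀ a, s ≤ a → (a ∈ J ↔ letterCount k q s c a = 1)) ∧
      jumps k ((q : ℝ) - s / 2) c = J.map (jumpEmb s) := by
  classical
  have hs1 : (s : ℝ) ≤ 1 := by exact_mod_cast hs
  set F : ℕ → ℤ := fun a => (signedCount k c (a - (s : ℝ) / 2) : ℤ) with hF
  obtain ⟨M, hM⟩ := exists_bound_signedCount c hk
  set B : ℕ := ⌈M⌉₊ + 1 + q with hB
  have hFB : ∀ a, B ≤ a → F a = 0 := by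
    intro a ha
    have h1 : (B : ℝ) ≤ a := Nat.cast_le.2 ha
    have h2 := Nat.le_ceil M
    have h3 : (0 : ℝ) ≤ q := Nat.cast_nonneg q
    simp only [hF]
    rw [hM, Nat.cast_zero]
    rw [hB] at h1
    push_cast at h1
    linarith
  have hJB : ∀ a, B ≤ a → letterCount k q s c a = 0 := by
    intro a ha
    have h1 := hFB a ha
    have h2 := hFB (a + 1) (by omega)
    simp only [hF] at h1 h2
    rw [letterCount, h1, h2, if_neg (by omega)]
    rfl
  have hcount : (((Finset.Ico s B).filter fun a => letterCount k q s c a = 1).card : ℤ) =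
      F s + (q - s) := by
    have h1 : (((Finset.Ico s B).filter fun a => letterCount k q s c a = 1).card : ℤ) =
        ∑ a ∈ Finset.Ico s B, letterCount k q s c a := by
      rw [Finset.card_filter]
      push_cast
      refine Finset.sum_congr rfl fun a ha => ?_
      obtain h | h := hc.letterCount_eq c hs hsq hk (Finset.mem_Ico.1 ha).1 <;> simp [h]
    rw [h1]
    simp only [letterCount]
    rw [Finset.sum_add_distrib]
    have h2 := sum_Ico_sub_succ F (show s ≤ B by omega)
    rw [hFB B le_rfl, sub_zero] at h2
    simp only [hF] at h2 ⊢
    rw [h2]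
    congr 1
    rw [← Finset.sum_Ico_consecutive _ hsq (show q ≤ B by omega)]
    have h3 : ∑ a ∈ Finset.Ico s q, (if a < q then (1 : ℤ) else 0) =
        ∑ a ∈ Finset.Ico s q, 1 :=
      Finset.sum_congr rfl fun a ha => if_pos (Finset.mem_Ico.1 ha).2
    have h4 : ∑ a ∈ Finset.Ico q B, (if a < q then (1 : ℤ) else 0) = 0 :=
      Finset.sum_eq_zero fun a ha => if_neg (not_lt.2 (Finset.mem_Ico.1 ha).1)
    rw [h3, h4]
    simp
    omega
  set A := (Finset.Ico 1 B).filter fun a => letterCount k q s c a = 1 with hA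
  have hAmem : ∀ a, a ∈ A ↔ 1 ≤ a ∧ letterCount k q s c a = 1 := by
    intro a
    rw [hA, Finset.mem_filter, Finset.mem_Ico]
    constructor
    · rintro ⟨h, h'⟩
      exact ⟨h.1, h'⟩
    · rintro ⟨h, h'⟩
      refine ⟨⟨h, ?_⟩, h'⟩
      by_contra hcon
      rw [hJB a (by omega)] at h'
      omega
  have hpos : (posJumps_finite k ((q : ℝ) - s / 2) c).toFinset = A.map (jumpEmb s) := by
    ext l
    rw [Set.Finite.mem_toFinset, mem_posJumps_iff c hs hsq hk, Finset.mem_map]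
    simp only [hAmem, and_assoc]
  have hins : insert (-(s : ℝ) / 2) (A.map (jumpEmb s)) = (insert 0 A).map (jumpEmb s) := by
    rw [Finset.map_insert, jumpEmb_apply]
    congr 1
    push_cast
    ring
  have h0A : 0 ∉ A := by
    rw [hAmem]
    omega
  obtain ⟨F', hF'⟩ : ∃ F' : ℕ, F s = F' := ⟨_, rfl⟩
  have hjumps : jumps k ((q : ℝ) - s / 2) c =
      (if ∃ r, A.card = q + 2 * r then A else insert 0 A).map (jumpEmb s) := by
    rw [jumps, hpos, hdef, Finset.card_map, ceil_abs_eq hs hsq]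
    split_ifs
    · rfl
    · exact hins
  obtain rfl | rfl : s = 0 ∨ s = 1 := by omega
  · have hM0 : F 0 = 2 * mult k c 0 := by
      simp only [hF]
      norm_num
      rw [signedCount_zero]
      push_cast
      rfl
    have hle := mult_le (k := k) c (l := 0)
    have hsplit : ((Finset.Ico 0 B).filter fun a => letterCount k q 0 c a = 1).card =
        A.card + if letterCount k q 0 c 0 = 1 then 1 else 0 := by
      have : Finset.Ico 0 B = insert 0 (Finset.Ico 1 B) := by
        ext a
        simp only [Finset.mem_insert, Finset.mem_Ico]
        omega
      rw [this, Finset.filter_insert]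
      split_ifs
      · rw [Finset.card_insert_of_notMem h0A]
      · rfl
    by_cases h0 : letterCount k q 0 c 0 = 1
    · rw [if_pos h0] at hsplit
      have hno : ¬ ∃ r, A.card = q + 2 * r := by
        rintro ⟨r, hr⟩
        omega
      refine ⟨insert 0 A, mult k c 0, ?_, hle, ?_, ?_⟩
      · rw [Finset.card_insert_of_notMem h0A]
        omega
      · intro a _
        rw [Finset.mem_insert, hAmem]
        constructor
        · rintro (rfl | h)
          · exact h0
          · exact h.2
        · intro h
          by_cases ha : a = 0
          · exact Or.inl ha
          · exact Or.inr ⟨by omega, h⟩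
      · rw [hjumps, if_neg hno]
    · rw [if_neg h0] at hsplit
      have hyes : A.card = q + 2 * mult k c 0 := by omega
      refine ⟨A, mult k c 0, hyes, hle, ?_, ?_⟩
      · intro a _
        rw [hAmem]
        constructor
        · exact fun h => h.2
        · intro h
          refine ⟨?_, h⟩
          by_contra ha
          obtain rfl : a = 0 := by omega
          exact h0 h
      · rw [hjumps, if_pos ⟨_, hyes⟩]
  · have hle : F 1 ≤ n := by
      simp only [hF]
      rw [signedCount_eq_mult c hk (by norm_num)]
      exact_mod_cast mult_le c
    have hAcard : (A.card : ℤ) = F 1 + (q - 1) := by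
      rw [← Nat.cast_one (R := ℤ), ← hcount]
    by_cases hyes : ∃ r, A.card = q + 2 * r
    · obtain ⟨r, hr⟩ := hyes
      refine ⟨A, r, hr, by omega, fun a ha => ?_, ?_⟩
      · rw [hAmem]
        exact ⟨fun h => h.2, fun h => ⟨ha, h⟩⟩
      · rw [hjumps, if_pos ⟨r, hr⟩]
    · refine ⟨insert 0 A, F' / 2, ?_, by omega, fun a ha => ?_, ?_⟩
      · rw [Finset.card_insert_of_notMem h0A]
        obtain ⟨d, hd | hd⟩ := Nat.even_or_odd' F'
        · omega
        · exact absurd ⟨d, by omega⟩ hyes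
      · rw [Finset.mem_insert, hAmem]
        constructor
        · rintro (h | h)
          · omega
          · exact h.2
        · exact fun h => Or.inr ⟨ha, h⟩
      · rw [hjumps, if_neg hyes]

end Jumps

/-! ### The word of the distinguished double partition -/

/-- The word with the letters `j 0 < j 1 < …` whose letters `j 1, j 3, …, j (2 r - 1)` are
vertical. -/
def alternatingWord (j : ℕ → ℕ) (r : ℕ) : ℕ → List (Bool × ℕ)
  | 0 => []
  | i + 1 => (decide (2 * r ≤ i ∨ i % 2 = 0), j i) :: alternatingWord j r i

section Alternating

variable {j : ℕ → ℕ} {r : ℕ}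

theorem alternatingWord_succ_true {i : ℕ} (h : 2 * r ≤ i ∨ i % 2 = 0) :
    alternatingWord j r (i + 1) = (true, j i) :: alternatingWord j r i := by
  simp [alternatingWord, h]

theorem alternatingWord_succ_false {i : ℕ} (h : ¬ (2 * r ≤ i ∨ i % 2 = 0)) :
    alternatingWord j r (i + 1) = (false, j i) :: alternatingWord j r i := by
  simp only [alternatingWord, decide_eq_false h]

theorem mem_map_alternatingWord {T a : ℕ} :
    a ∈ (alternatingWord j r T).map Prod.snd ↔ ∃ i < T, j i = a := by
  induction T with
  | zero => simp [alternatingWord]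
  | succ T ih =>
    rw [alternatingWord, List.map_cons, List.mem_cons, ih]
    constructor
    · rintro (rfl | ⟨i, hi, rfl⟩)
      · exact ⟨T, by omega, rfl⟩
      · exact ⟨i, by omega, rfl⟩
    · rintro ⟨i, hi, rfl⟩
      by_cases h : i = T
      · exact Or.inl (by rw [h])
      · exact Or.inr ⟨i, by omega, rfl⟩

theorem isJumpWord_alternatingWord {s T : ℕ} (hs : s ≤ 1)
    (hj : ∀ i i', i < i' → i' < T → j i < j i') : IsJumpWord s (alternatingWord j r T) := by
  induction T with
  | zero => trivial
  | succ T ih =>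
    have h1 : ∀ x ∈ alternatingWord j r T, x.2 < j T := by
      intro x hx
      obtain ⟨i, hi, h⟩ := mem_map_alternatingWord.1 (List.mem_map_of_mem (f := Prod.snd) hx)
      rw [← h]
      exact hj i T hi (by omega)
    have h2 := ih fun i i' hi hi' => hj i i' hi (by omega)
    by_cases h : 2 * r ≤ T ∨ T % 2 = 0
    · rw [alternatingWord_succ_true h]
      exact ⟨h1, h2⟩
    · rw [alternatingWord_succ_false h]
      refine ⟨?_, h1, h2⟩
      -- A vertical letter has odd index, so it exceeds `j 0` and is at least `1`.
      have := hj 0 T (by omega) (by omega)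
      omega

theorem excess_alternatingWord_even {i : ℕ} (hi : i ≤ r) :
    excess (alternatingWord j r (2 * i)) = 0 := by
  induction i with
  | zero => rfl
  | succ i ih =>
    rw [show 2 * (i + 1) = 2 * i + 1 + 1 by ring, alternatingWord_succ_false (by omega),
      alternatingWord_succ_true (by omega), excess, excess, ih (by omega)]
    rfl

theorem rowParts_alternatingWord_even {i : ℕ} (hi : i ≤ r) :
    (rowParts (alternatingWord j r (2 * i)) : Multiset ℕ) =
      (Multiset.range i).map fun i => j (2 * i) := by
  induction i with
  | zero => rfl
  | succ i ih =>
    rw [show 2 * (i + 1) = 2 * i + 1 + 1 by ring, alternatingWord_succ_false (by omega),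
      alternatingWord_succ_true (by omega), rowParts, rowParts,
      excess_alternatingWord_even (by omega), ← Multiset.cons_coe, ih (by omega),
      Multiset.range_succ, Multiset.map_cons]
    simp

theorem colParts_alternatingWord_even (s : ℕ) {i : ℕ} (hi : i ≤ r) :
    (colParts s (alternatingWord j r (2 * i)) : Multiset ℕ) =
      (Multiset.range i).map fun i => j (2 * i + 1) + 1 - s := by
  induction i with
  | zero => rfl
  | succ i ih =>
    rw [show 2 * (i + 1) = 2 * i + 1 + 1 by ring, alternatingWord_succ_false (by omega),
      alternatingWord_succ_true (by omega), colParts, colParts, excess,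
      excess_alternatingWord_even (by omega), ← Multiset.cons_coe, ih (by omega),
      Multiset.range_succ, Multiset.map_cons]
    congr 1
    omega

theorem excess_alternatingWord (t : ℕ) : excess (alternatingWord j r (2 * r + t)) = t := by
  induction t with
  | zero => exact excess_alternatingWord_even le_rfl
  | succ t ih =>
    rw [← add_assoc, alternatingWord_succ_true (by omega), excess, ih]
    push_cast
    rfl

/-- From the smallest letter on, the excess returns to `0` after each of the `r` pairs and then
grows by one per letter; this is the shift by `t` in the last parts of `ξ(c)`. -/
theorem rowParts_alternatingWord (t : ℕ) :
    (rowParts (alternatingWord j r (2 * r + t)) : Multiset ℕ) =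
      (Multiset.range r).map (fun i => j (2 * i)) +
        (Multiset.range t).map (fun t => j (2 * r + t) - t) := by
  induction t with
  | zero => simpa using rowParts_alternatingWord_even (j := j) (le_refl r)
  | succ t ih =>
    rw [← add_assoc, alternatingWord_succ_true (by omega), rowParts, excess_alternatingWord,
      ← Multiset.cons_coe, ih, Multiset.range_succ, Multiset.map_cons, Multiset.add_cons]
    congr 1
    omega

theorem colParts_alternatingWord (s t : ℕ) :
    (colParts s (alternatingWord j r (2 * r + t)) : Multiset ℕ) =
      (Multiset.range r).map (fun i => j (2 * i + 1) + 1 - s) := by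
  induction t with
  | zero => exact colParts_alternatingWord_even s le_rfl
  | succ t ih =>
    rw [← add_assoc, alternatingWord_succ_true (by omega), colParts, ih]

end Alternating

theorem jump_eq {n : ℕ} {k m : ℝ} {c : Fin n → ℝ} {s : ℕ} {J : Finset ℕ}
    (hJ : jumps k m c = J.map (jumpEmb s)) {i : ℕ} (hi : i < J.card) :
    jump k m c i = (J.sort.getD i 0 : ℕ) - (s : ℝ) / 2 := by
  have hmono : StrictMonoOn (jumpEmb s) J := by
    intro a _ b _ hab
    rw [jumpEmb_apply, jumpEmb_apply]
    have : (a : ℝ) < b := Nat.cast_lt.2 hab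
    linarith
  have hlen : i < J.sort.length := by rwa [Finset.length_sort]
  rw [jump, hJ, ← hmono.map_finsetSort, List.getD_eq_getElem _ _ (by simpa using hi),
    List.getElem_map, jumpEmb_apply, List.getD_eq_getElem _ _ hlen]

/-- The distinguished double partition comes from a word. -/
theorem exists_word_jumpPartition {n : ℕ} {k : ℝ} {c : Fin n → ℝ} {q s r : ℕ} (hs : s ≤ 1)
    (hsq : s ≤ q) (hdef : defect ((q : ℝ) - s / 2) = s) {J : Finset ℕ}
    (hcard : J.card = q + 2 * r) (hJ : jumps k ((q : ℝ) - s / 2) c = J.map (jumpEmb s)) :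
    ∃ w, IsJumpWord s w ∧ excess w = q ∧ w.map Prod.snd = J.sort (· ≥ ·) ∧
      jumpPartition₁ k ((q : ℝ) - s / 2) c = ofParts (rowParts w : Multiset ℕ) ∧
      jumpPartition₂ k ((q : ℝ) - s / 2) c = ofParts (colParts s w : Multiset ℕ) := by
  set j : ℕ → ℕ := fun i => J.sort.getD i 0 with hj
  have hrank : jumpRank k ((q : ℝ) - s / 2) c = r := by
    rw [jumpRank, hJ, Finset.card_map, ceil_abs_eq hs hsq, hcard]
    omega
  have hlen : J.sort.length = 2 * r + q := by rw [Finset.length_sort, hcard, add_comm]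
  have hmono : ∀ i i', i < i' → i' < 2 * r + q → j i < j i' := by
    intro i i' h h'
    simp only [hj]
    rw [List.getD_eq_getElem _ _ (by omega), List.getD_eq_getElem _ _ (by omega)]
    exact J.sortedLT_sort.getElem_lt_getElem_of_lt h
  have hword : IsJumpWord s (alternatingWord j r (2 * r + q)) :=
    isJumpWord_alternatingWord hs hmono
  refine ⟨alternatingWord j r (2 * r + q), hword, excess_alternatingWord q, ?_, ?_, ?_⟩
  · refine hword.sortedGT.eq_of_mem_iff J.sortedGT_sort fun a => ?_
    rw [mem_map_alternatingWord, Finset.mem_sort, ← Finset.mem_sort (· ≤ ·), List.mem_iff_getElem]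
    simp only [hj, ← hlen]
    constructor
    · rintro ⟨i, hi, h⟩
      rw [List.getD_eq_getElem _ _ hi] at h
      exact ⟨i, hi, h⟩
    · rintro ⟨i, hi, h⟩
      exact ⟨i, hi, by rw [List.getD_eq_getElem _ _ hi, h]⟩
  · rw [jumpPartition₁, hrank, ceil_abs_eq hs hsq, rowParts_alternatingWord, hdef]
    congr 2
    · refine Multiset.map_congr rfl fun i hi => ?_
      rw [Multiset.mem_range] at hi
      rw [jump_eq hJ (by omega), sub_add_cancel, Nat.floor_natCast]
    · refine Multiset.map_congr rfl fun i hi => ?_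
      rw [Multiset.mem_range] at hi
      rw [jump_eq hJ (by omega), sub_add_cancel, Nat.floor_sub_natCast, Nat.floor_natCast]
  · rw [jumpPartition₂, hrank, colParts_alternatingWord, hdef]
    congr 1
    refine Multiset.map_congr rfl fun i hi => ?_
    rw [Multiset.mem_range] at hi
    rw [jump_eq hJ (by omega)]
    -- The `-s / 2` in the jump and the `-δ` of the formula add up to the `-s` in `colParts`.
    have : ((J.sort.getD (2 * i + 1) 0 : ℕ) : ℝ) - (s : ℝ) / 2 + 1 - (s : ℝ) / 2 =
        ((J.sort.getD (2 * i + 1) 0 + 1 : ℕ) : ℝ) - s := by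
      push_cast
      ring
    rw [this, Nat.floor_sub_natCast, Nat.floor_natCast]

/-! ### Correspondence for nonnegative labels -/

/-- As the excess is `q`, the same number of zeroes pads the two rows to the lengths `N + q` and
`N`. -/
theorem symbolEntries_word {q s : ℕ} (hs : s ≤ 1) (hsq : s ≤ q)
    (hdef : defect ((q : ℝ) - s / 2) = s) {w : List (Bool × ℕ)} (hw : IsJumpWord s w)
    (hex : excess w = q) {N : ℕ} (hN : (colParts s w).length ≤ N) :
    symbolEntries ((q : ℝ) - s / 2) N
        (ofParts (rowParts w : Multiset ℕ), ofParts (colParts s w : Multiset ℕ)) =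
      letterEntries (N - (colParts s w).length) (w.map Prod.snd) +
        zeroSymbol s (N - (colParts s w).length) := by
  have hm : 0 ≤ (q : ℝ) - (s : ℝ) / 2 := by
    have h1 : (s : ℝ) ≤ q := Nat.cast_le.2 hsq
    have h3 : (0 : ℝ) ≤ s := Nat.cast_nonneg s
    linarith
  set t := N - (colParts s w).length with ht
  have hlen := excess_eq s w
  have h1 := symbolRow_ofParts (sortedGE_append_replicate (hw.sortedGE_rowParts hs) t) 0
  have h2 := symbolRow_ofParts (sortedGE_append_replicate (hw.sortedGE_colParts hs) t) s
  rw [ofParts_append_replicate, List.length_append, List.length_replicate] at h1 h2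
  rw [symbolEntries, if_pos hm, ceil_abs_eq hs hsq, hdef, ← hw.symbol_eq hs t, ← h1, ← h2]
  congr 2 <;> omega

/-- Only the letter `0` can be left open by the hypothesis, and the parity of the number of letters
decides it. -/
theorem eq_of_parity {A B : Finset ℕ} {s : ℕ} (hs : s ≤ 1)
    (h : ∀ a, s ≤ a → (a ∈ A ↔ a ∈ B)) (hpar : A.card % 2 = B.card % 2) : A = B := by
  have herase : A.erase 0 = B.erase 0 := by
    ext a
    rw [Finset.mem_erase, Finset.mem_erase, and_congr_right_iff]
    intro ha
    exact h a (by omega)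
  have hcard := congrArg Finset.card herase
  rw [Finset.card_erase_eq_ite, Finset.card_erase_eq_ite] at hcard
  have h0 : 0 ∈ A ↔ 0 ∈ B := by
    split_ifs at hcard with hA hB hB
    · exact ⟨fun _ => hB, fun _ => hA⟩
    · have := Finset.card_pos.2 ⟨0, hA⟩
      omega
    · have := Finset.card_pos.2 ⟨0, hB⟩
      omega
    · exact ⟨fun h => absurd h hA, fun h => absurd h hB⟩
  ext a
  by_cases ha : a = 0
  · rw [ha, h0]
  · exact h a (by omega)

theorem HasWord.splits {lam : YoungDiagram} {q s : ℕ} (hs : s ≤ 1) {w : List (Bool × ℕ)}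
    (hw : HasWord lam q s 0 0 w) (hj : IsJumpWord s w) :
    Splits ((q : ℝ) - s / 2) lam
      (ofParts (rowParts w : Multiset ℕ), ofParts (colParts s w : Multiset ℕ)) := by
  refine ⟨_, _, hw.splitsFrom (by simp) hs hj, ?_⟩
  rw [posParts, posParts, ofParts_filter, ofParts_filter]

theorem HasWord.joins {lam : YoungDiagram} {q s : ℕ} (hs : s ≤ 1) {w : List (Bool × ℕ)}
    (hw : HasWord lam q s 0 0 w) (hj : IsJumpWord s w) :
    Joins ((q : ℝ) - s / 2)
      (ofParts (rowParts w : Multiset ℕ), ofParts (colParts s w : Multiset ℕ)) lam := by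
  rw [Joins, ← ofParts_filter (rowParts w : Multiset ℕ), ← ofParts_filter (colParts s w),
    rowLens_ofParts fun x hx => (Multiset.mem_filter.1 hx).2,
    rowLens_ofParts fun x hx => (Multiset.mem_filter.1 hx).2]
  exact hw.joinsFrom (by simp) hs hj (by simp)

section Nonnegative

variable {n : ℕ} {k : ℝ} {c : Fin n → ℝ} {q s : ℕ}

theorem exists_correspondent (hs : s ≤ 1) (hsq : s ≤ q) (hk : k ≠ 0)
    (hdef : defect ((q : ℝ) - s / 2) = s)
    (hc : IsResidualPoint k (((q : ℝ) - s / 2) * k) c) {lam : YoungDiagram}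
    (hlam : lam ∈ partitionsOver k ((q : ℝ) - s / 2) c) :
    ∃ A ∈ correspondents k ((q : ℝ) - s / 2) c,
      Splits ((q : ℝ) - s / 2) lam A ∧ Joins ((q : ℝ) - s / 2) A lam := by
  classical
  obtain ⟨hcard, horb⟩ := hlam
  rw [weylOrbit_eq_iff hk] at horb
  have hlet : ∀ a, letterCount k q s c a =
      (if ∃ i : ℕ, (lam.rowLen i : ℤ) - 1 - i + q = a then 1 else 0) +
        (if ∃ j : ℕ, (lam.colLen j : ℤ) - 1 - j - q + s = a then 1 else 0) := by
    intro a
    rw [← letterCount_tableauPoint lam hcard hk hsq, letterCount, letterCount, horb, horb]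
  obtain ⟨J, r, hJcard, hr, hJ, hjumps⟩ := hc.exists_jumpSet c hs hsq hk hdef
  obtain ⟨w, hw, hwl⟩ := exists_hasWord lam q (s := s) (by
    intro a ha i j hi hj
    have h := hlet a
    rw [if_pos ⟨i, hi⟩, if_pos ⟨j, hj⟩] at h
    have := hc.letterCount_eq c hs hsq hk ha
    omega)
  have hex := hwl.excess_eq
  simp only [Nat.cast_zero, sub_zero, add_zero] at hex
  have hlen := excess_eq s w
  have hlen' := length_rowParts_add s w
  have hnodup : (w.map Prod.snd).Nodup := hw.sortedGT.nodup
  have hset : (w.map Prod.snd).toFinset = J := by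
    refine eq_of_parity hs (fun a ha => ?_) ?_
    · rw [List.mem_toFinset, hwl.mem_letters_iff hw, hJ a ha, hlet]
      have := hc.letterCount_eq c hs hsq hk ha
      rw [hlet] at this
      simp only [zero_le, true_and, ha]
      split_ifs at this ⊢ with h1 h2 h2
      · simp at this
      · simp [h1]
      · simp [h2]
      · simp [h1, h2]
    -- The excess `q` gives the number of letters the parity of `q`, which is also that of `J.card`.
    · rw [List.toFinset_card_of_nodup hnodup, List.length_map]
      omega
  have hwlen : w.length = q + 2 * r := by
    rw [← hJcard, ← hset, List.toFinset_card_of_nodup hnodup, List.length_map]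
  have hletters : w.map Prod.snd = J.sort (· ≥ ·) := by
    refine hw.sortedGT.eq_of_mem_iff J.sortedGT_sort fun a => ?_
    rw [Finset.mem_sort, ← hset, List.mem_toFinset]
  have hsplit := hwl.splits hs hw
  -- Symbols of length `n` suffice: both words have `r ≤ n` vertical letters.
  refine ⟨_, ⟨hsplit.card_eq.trans hcard, n, le_rfl, ?_⟩, hsplit, hwl.joins hs hw⟩
  obtain ⟨w', hw', hex', hletters', hp1, hp2⟩ :=
    exists_word_jumpPartition hs hsq hdef hJcard hjumps
  have hm : 0 ≤ (q : ℝ) - (s : ℝ) / 2 := by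
    have h1 : (s : ℝ) ≤ q := Nat.cast_le.2 hsq
    have h3 : (0 : ℝ) ≤ s := Nat.cast_nonneg s
    linarith
  have hlen2 := excess_eq s w'
  have hlen2' := length_rowParts_add s w'
  have hwlen' : w'.length = q + 2 * r := by
    rw [← List.length_map (f := Prod.snd), hletters', Finset.length_sort, hJcard]
  rw [jumpBipartition, if_pos hm, hp1, hp2,
    symbolEntries_word hs hsq hdef hw hex (by omega),
    symbolEntries_word hs hsq hdef hw' hex' (by omega), hletters, hletters',
    show (colParts s w).length = (colParts s w').length by omega]

theorem exists_partitionOver (hs : s ≤ 1) (hsq : s ≤ q) (hk : k ≠ 0)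
    (hdef : defect ((q : ℝ) - s / 2) = s)
    (hc : IsResidualPoint k (((q : ℝ) - s / 2) * k) c) {A : YoungDiagram × YoungDiagram}
    (hA : A ∈ correspondents k ((q : ℝ) - s / 2) c) :
    ∃ lam ∈ partitionsOver k ((q : ℝ) - s / 2) c, Splits ((q : ℝ) - s / 2) lam A := by
  classical
  obtain ⟨hcard, N, hN, hsym⟩ := hA
  obtain ⟨J, r, hJcard, hr, hJ, hjumps⟩ := hc.exists_jumpSet c hs hsq hk hdef
  obtain ⟨w', hw', hex', hletters', hp1, hp2⟩ :=
    exists_word_jumpPartition hs hsq hdef hJcard hjumps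
  have hm : 0 ≤ (q : ℝ) - (s : ℝ) / 2 := by
    have h1 : (s : ℝ) ≤ q := Nat.cast_le.2 hsq
    have h3 : (0 : ℝ) ≤ s := Nat.cast_nonneg s
    linarith
  have hlen2 := excess_eq s w'
  have hlen2' := length_rowParts_add s w'
  have hwlen' : w'.length = q + 2 * r := by
    rw [← List.length_map (f := Prod.snd), hletters', Finset.length_sort, hJcard]
  have hA1 := colLen_zero_le_card A.1
  have hA2 := colLen_zero_le_card A.2
  rw [jumpBipartition, if_pos hm, hp1, hp2,
    symbolEntries_word hs hsq hdef hw' hex' (by omega), hletters', symbolEntries, if_pos hm,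
    ceil_abs_eq hs hsq, hdef, symbolRow_eq_symbolList A.1 (by omega),
    symbolRow_eq_symbolList A.2 (by omega)] at hsym
  -- The distribution of the entries over the two rows of the symbol of `A` gives the kinds of the
  -- jumps; the row lengths then force the excess `q`.
  obtain ⟨w, hw, hletters, hx, hy⟩ := exists_jumpWord_of_symbol_eq hs J.sortedGT_sort
    (sortedGE_map_rowLen _ _) (sortedGE_map_rowLen _ _) hsym
  have hlx := congrArg List.length hx
  have hly := congrArg List.length hy
  simp only [List.length_map, List.length_range, List.length_append, List.length_replicate]
    at hlx hly
  have hex : excess w = q := by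
    rw [excess_eq s w]
    omega
  have hAeq : A = (ofParts (rowParts w : Multiset ℕ), ofParts (colParts s w : Multiset ℕ)) := by
    refine Prod.ext ?_ ?_
    · rw [← ofParts_map_rowLen A.1 (show A.1.colLen 0 ≤ N + q by omega), hx,
        ofParts_append_replicate]
    · rw [← ofParts_map_rowLen A.2 (show A.2.colLen 0 ≤ N by omega), hy,
        ofParts_append_replicate]
  obtain ⟨lam, hwl⟩ := exists_diagram_of_jumpWord hw
  rw [hex] at hwl
  have hsplit := hwl.splits hs hw
  rw [← hAeq] at hsplit
  have hlcard : lam.card = n := hsplit.card_eq.symm.trans hcard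
  refine ⟨lam, ⟨hlcard, (weylOrbit_eq_iff hk).2 ?_⟩, hsplit⟩
  refine signedCount_eq_of_letterCount_eq hk hs (hc.signedCount_structure c hs hsq hk).1 ?_ ?_ (q := q)
  · intro x hx
    exact signedCount_tableauPoint_eq_zero lam hlcard hk q s (by simpa using hx)
  · intro a ha
    rw [letterCount_tableauPoint lam hlcard hk hsq]
    have hmem : a ∈ J ↔ a ∈ w.map Prod.snd := by
      rw [hletters, Finset.mem_sort]
    rw [hJ a ha, hwl.mem_letters_iff hw] at hmem
    simp only [zero_le, true_and, ha] at hmem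
    have hdisj : (∃ i : ℕ, (lam.rowLen i : ℤ) - 1 - i + q = a) →
        ¬ ∃ j : ℕ, (lam.colLen j : ℤ) - 1 - j - q + s = a := by
      rintro ⟨i, hi⟩ ⟨j, hj⟩
      exact hwl.row_ne_col hw ha (Nat.zero_le i) (Nat.zero_le j) hi hj
    obtain h | h := hc.letterCount_eq c hs hsq hk ha
    · have hno : ¬ letterCount k q s c a = 1 := by omega
      rw [hmem, not_or] at hno
      rw [if_neg hno.1, if_neg hno.2, h]
      rfl
    · obtain h' | h' := hmem.1 h
      · rw [if_pos h', if_neg (hdisj h'), h]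
        rfl
      · rw [if_neg fun h'' => hdisj h'' h', if_pos h', h]
        rfl

end Nonnegative

/-! ### Half-integral labels in the form `q - s / 2` -/

theorem exists_label_eq {m : ℝ} (hm : ∃ z : ℤ, 2 * m = z) (hm0 : 0 ≤ m) :
    ∃ q s : ℕ, s ≤ 1 ∧ s ≤ q ∧ m = (q : ℝ) - s / 2 ∧ defect m = s := by
  obtain ⟨z, hz⟩ := hm
  have hz0 : 0 ≤ z := by
    have : (0 : ℝ) ≤ z := by linarith
    exact_mod_cast this
  obtain ⟨a, rfl⟩ := Int.eq_ofNat_of_zero_le hz0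
  obtain ⟨d, rfl | rfl⟩ := Nat.even_or_odd' a
  · have hmd : m = d := by
      push_cast at hz
      linarith
    refine ⟨d, 0, by omega, by omega, by simp [hmd], ?_⟩
    rw [defect, if_pos ⟨d, by simp [hmd]⟩]
  · have hmd : m = d + 1 / 2 := by
      push_cast at hz
      linarith
    refine ⟨d + 1, 1, by omega, by omega, by rw [hmd]; push_cast; ring, ?_⟩
    rw [defect, if_neg]
    rintro ⟨z, h⟩
    have : ((2 * d + 1 : ℤ) : ℝ) = ((2 * z : ℤ) : ℝ) := by
      push_cast
      linarith
    have : (2 * d + 1 : ℤ) = 2 * z := by exact_mod_cast this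
    omega

/-! ### Change of sign of the label -/

section Negation

variable {n : ℕ} {k m : ℝ} {c : Fin n → ℝ}

theorem IsResidualPoint.neg_label (hc : IsResidualPoint k (m * k) c) :
    IsResidualPoint k (-m * k) c := by
  rw [IsResidualPoint] at hc ⊢
  rw [ncard_shortRoots, signedCount_neg, ← ncard_shortRoots]
  exact hc

theorem defect_neg (m : ℝ) : defect (-m) = defect m := by
  have : (∃ z : ℤ, -m = z) ↔ ∃ z : ℤ, m = z := by
    constructor <;> rintro ⟨z, hz⟩ <;> exact ⟨-z, by push_cast; linarith⟩
  rw [defect, defect, this]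

/-- As `2 m` is an integer, `m + ℤ` and `-m + ℤ` coincide; otherwise only `|m|` enters. -/
theorem posJumps_neg (hm : ∃ z : ℤ, 2 * m = z) : posJumps k (-m) c = posJumps k m c := by
  obtain ⟨z₀, hz₀⟩ := hm
  have : ∀ l : ℝ, (∃ z : ℤ, l - -m = z) ↔ ∃ z : ℤ, l - m = z := by
    intro l
    constructor
    · rintro ⟨z, hz⟩
      exact ⟨z - z₀, by push_cast; linarith⟩
    · rintro ⟨z, hz⟩
      exact ⟨z + z₀, by push_cast; linarith⟩
  simp only [posJumps, abs_neg, this]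

theorem jumps_neg (hm : ∃ z : ℤ, 2 * m = z) : jumps k (-m) c = jumps k m c := by
  have h : (posJumps_finite k (-m) c).toFinset = (posJumps_finite k m c).toFinset := by
    ext l
    rw [Set.Finite.mem_toFinset, Set.Finite.mem_toFinset, posJumps_neg hm]
  rw [jumps, jumps, h, abs_neg, defect_neg]

theorem jumpPartition₁_neg (hm : ∃ z : ℤ, 2 * m = z) :
    jumpPartition₁ k (-m) c = jumpPartition₁ k m c := by
  simp only [jumpPartition₁, jumpRank, jump, jumps_neg hm, abs_neg, defect_neg]

theorem jumpPartition₂_neg (hm : ∃ z : ℤ, 2 * m = z) :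
    jumpPartition₂ k (-m) c = jumpPartition₂ k m c := by
  simp only [jumpPartition₂, jumpRank, jump, jumps_neg hm, abs_neg, defect_neg]

theorem swap_mem_correspondents_neg (hm : ∃ z : ℤ, 2 * m = z) (hneg : m < 0)
    {A : YoungDiagram × YoungDiagram} :
    A.swap ∈ correspondents k (-m) c ↔ A ∈ correspondents k m c := by
  have h1 : ¬ 0 ≤ m := not_le.2 hneg
  have h2 : 0 ≤ -m := by linarith
  have hsym : ∀ (N : ℕ) (B : YoungDiagram × YoungDiagram),
      symbolEntries (-m) N B.swap = symbolEntries m N B := by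
    intro N B
    rw [symbolEntries, symbolEntries, if_neg h1, if_pos h2, abs_neg, defect_neg, add_comm]
    rfl
  have hbip : jumpBipartition k (-m) c = (jumpBipartition k m c).swap := by
    rw [jumpBipartition, jumpBipartition, if_neg h1, if_pos h2, jumpPartition₁_neg hm,
      jumpPartition₂_neg hm]
    rfl
  simp only [correspondents, Similar, hbip, hsym, Set.mem_ofPred_eq, Prod.fst_swap,
    Prod.snd_swap, add_comm A.2.card]

theorem card_transpose (lam : YoungDiagram) : lam.transpose.card = lam.card := by
  refine Finset.card_equiv (Equiv.prodComm ℕ ℕ) fun b => ?_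
  simp

/-- The coordinates for the transpose and `-m` are the negatives of those for `lam` and `m`, up to
order. -/
theorem transpose_mem_partitionsOver_neg (hk : k ≠ 0) {lam : YoungDiagram}
    (h : lam ∈ partitionsOver k m c) : lam.transpose ∈ partitionsOver k (-m) c := by
  obtain ⟨hcard, horb⟩ := h
  have hcard' : lam.transpose.card = n := (card_transpose lam).trans hcard
  rw [weylOrbit_eq_iff hk] at horb
  refine ⟨hcard', (weylOrbit_eq_iff hk).2 fun x => ?_⟩
  rw [← horb, signedCount_tableauPoint _ _ hk, signedCount_tableauPoint _ _ hk, add_comm]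
  congr 1
  · refine Finset.card_equiv (Equiv.prodComm ℕ ℕ) fun b => ?_
    simp only [Finset.mem_filter, YoungDiagram.mem_cells, YoungDiagram.mem_transpose,
      Equiv.prodComm_apply, content_swap, and_congr_right_iff]
    intro _
    push_cast
    constructor <;> intro h <;> linarith
  · refine Finset.card_equiv (Equiv.prodComm ℕ ℕ) fun b => ?_
    simp only [Finset.mem_filter, YoungDiagram.mem_cells, YoungDiagram.mem_transpose,
      Equiv.prodComm_apply, content_swap, and_congr_right_iff]
    intro _
    push_cast
    constructor <;> intro h <;> linarith

end Negation

/-! ### The correspondence -/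

theorem splitting_joining {n : ℕ} {k m : ℝ} (hk : k ≠ 0) (hm : ∃ z : ℤ, 2 * m = z)
    {c : Fin n → ℝ} (hc : IsResidualPoint k (m * k) c) :
    (∀ lam ∈ partitionsOver k m c, ∃ A ∈ correspondents k m c, Splits m lam A ∧ Joins m A lam) ∧
      ∀ A ∈ correspondents k m c, ∃ lam ∈ partitionsOver k m c, Splits m lam A := by
  obtain hm0 | hneg := le_or_gt 0 m
  · obtain ⟨q, s, hs, hsq, rfl, hdef⟩ := exists_label_eq hm hm0
    exact ⟨fun lam => exists_correspondent hs hsq hk hdef hc,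
      fun A => exists_partitionOver hs hsq hk hdef hc⟩
  · have hm' : ∃ z : ℤ, 2 * -m = z := by
      obtain ⟨z, hz⟩ := hm
      exact ⟨-z, by push_cast; linarith⟩
    have hc' := hc.neg_label
    obtain ⟨q, s, hs, hsq, hq, hdef⟩ := exists_label_eq hm' (by linarith)
    constructor
    · intro lam hlam
      have hlam' := transpose_mem_partitionsOver_neg hk hlam
      rw [hq] at hlam' hc' hdef
      obtain ⟨A, hA, h1, h2⟩ := exists_correspondent hs hsq hk hdef hc' hlam'
      rw [← hq] at hA h1 h2
      refine ⟨A.swap, ?_, ?_, ?_⟩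
      · rw [← swap_mem_correspondents_neg hm hneg, Prod.swap_swap]
        exact hA
      · simpa using h1.transpose
      · simpa using h2.transpose
    · intro A hA
      rw [← swap_mem_correspondents_neg hm hneg] at hA
      rw [hq] at hA hc' hdef
      obtain ⟨lam, hlam, h1⟩ := exists_partitionOver hs hsq hk hdef hc' hA
      rw [← hq] at hlam h1
      refine ⟨lam.transpose, ?_, ?_⟩
      · simpa using transpose_mem_partitionsOver_neg hk hlam
      · simpa using h1.transpose

end TypeB

end

theorem mainTheorem4 (n : ℕ) (hn : 1 ≤ n) (k m : ℝ) (hk : k ≠ 0) (hm : ∃ z : ℤ, 2 * m = z)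
    (c : Fin n → ℝ) (hc : TypeB.IsResidualPoint k (m * k) c) :
    ∃ e : TypeB.partitionsOver k m c ≃ TypeB.correspondents k m c,
      (∀ (lam : TypeB.partitionsOver k m c) (A : YoungDiagram × YoungDiagram),
        TypeB.Splits m lam A ↔ A = e lam) ∧
      (∀ (A : TypeB.correspondents k m c) (lam : YoungDiagram),
        TypeB.Joins m A lam ↔ lam = e.symm A) := by
  obtain ⟨h1, h2⟩ := TypeB.splitting_joining hk hm hc
  choose f hf hsplit hjoin using h1
  have hbij : Function.Bijective (fun lam : TypeB.partitionsOver k m c =>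
      (⟨f lam.1 lam.2, hf lam.1 lam.2⟩ : TypeB.correspondents k m c)) := by
    constructor
    -- Joining is deterministic and recovers a diagram from its image.
    · intro lam mu h
      have h' : f lam.1 lam.2 = f mu.1 mu.2 := congrArg Subtype.val h
      have j1 := hjoin lam.1 lam.2
      rw [h'] at j1
      exact Subtype.ext (TypeB.JoinsFrom.unique j1 (hjoin mu.1 mu.2))
    · intro A
      obtain ⟨lam, hlam, h⟩ := h2 A.1 A.2
      exact ⟨⟨lam, hlam⟩, Subtype.ext ((hsplit lam hlam).unique h)⟩
  refine ⟨Equiv.ofBijective _ hbij, fun lam A => ?_, fun A lam => ?_⟩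
  · constructor
    · intro h
      exact h.unique (hsplit lam.1 lam.2)
    · rintro rfl
      exact hsplit lam.1 lam.2
  · have hA : TypeB.Joins m A ((Equiv.ofBijective _ hbij).symm A : TypeB.partitionsOver k m c) := by
      obtain ⟨mu, rfl⟩ := (Equiv.ofBijective _ hbij).surjective A
      rw [Equiv.symm_apply_apply]
      exact hjoin mu.1 mu.2
    constructor
    · intro h
      exact TypeB.JoinsFrom.unique h hA
    · rintro rfl
      exact hA
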